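/- Let $N\ge 1$, let $R\subset\mathbb R^N\setminus\{0\}$ be a normalized root system (a finite set with $|\alpha|=\sqrt2$, $R\cap\mathbb R\alpha=\{\pm\alpha\}$ and $\sigma_\alpha R=R$ for all $\alpha\in R$, where $\sigma_\alpha$ is the reflection in $\alpha^\perp$), and let $G$ be the finite group generated by the reflections $\sigma_\alpha$, $\alpha\in R$. Put $d(x,y)=\min_{\sigma\in G}|x-\sigma(y)|$. Functions are real- or complex-valued. Let $L^p_G$ be the closed subspace of $L^p(\mathbb R^N)$ of functions with $f\circ\sigma=f$ a.e. for all $\sigma\in G$, and let $\mathrm{BMO}_G$ be the space of $G$-invariant locally integrable functions $b$, modulo constants, with $\|b\|_{\mathrm{BMO}}=\sup_B\frac1{|B|}\int_B|b-b_B|<\infty$, where $B$ runs over all balls and $b_B$ is the mean of $b$ on $B$. For $0<\eta\le1$ let $C^\eta_{G,0}$ be the space of continuous compactly supported $f$ on $\mathbb R^N$ with $\sup_{d(x,y)\ne0}|f(x)-f(y)|/d(x,y)^\eta<\infty$, and $(C^\eta_{G,0})'$ its dual for the inductive limit topology (functionals that are bounded for this seminorm on the functions supported in any fixed ball). Let $T:C^\eta_{G,0}\to(C^\eta_{G,0})'$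 be a singular integral operator: $T$ is linear, and there are a function $K(x,y)$ and constants $C$ and $0<\varepsilon\le1$ such that, whenever $d(x,y)\neq0$, $$|K(x,y)|\le \frac{C}{d(x,y)^{N}},$$ $$|K(x,y)-K(x',y)|\le C\frac{d(x,x')^\varepsilon}{d(x,y)^{N+\varepsilon}}\quad\text{if } d(x,x')\le\tfrac12 d(x,y),$$ $$|K(x,y)-K(x,y')|\le C\frac{d(y,y')^\varepsilon}{d(x,y)^{N+\varepsilon}}\quad\text{if } d(y,y')\le\tfrac12 d(x,y),$$ and, for $f,g\in C^\eta_{G,0}$, $$\langle Tf,g\rangle=\int_{\mathbb R^N}\int_{\mathbb R^N}K(x,y)f(y)g(x)\,dy\,dx$$ whenever this integral converges absolutely. Suppose that $T$ is bounded on $L^2_G$, i.e. there is a bounded linear operator $S$ on $L^2_G$ with $\langle Tf,g\rangle=\int (Sf)\,g\,dx$ for all $f,g\in C^\eta_{G,0}$. Then: 1. For every $1<p<\infty$, $T$ is bounded on $L^p_G$: there is a bounded linear operator $S_p$ on $L^p_G$ with $\langle Tf,g\rangle=\int (S_pf)\,g\,dx$ for all $f,g\in C^\eta_{G,0}$, and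 $S_pf=Sf$ for $f\in L^p_G\cap L^2_G$. 2. $T$ is of weak type $(1,1)$ on $L^1_G$: there are a linear map $S_1$ from $L^1_G$ to the ($G$-invariant, a.e. defined) measurable functions, with $S_1f=Sf$ for $f\in L^1_G\cap L^2_G$, and a constant $A$ such that $|\{x:|S_1f(x)|\ge t\}|\le A\|f\|_1/t$ for all $f\in L^1_G$ and $t>0$. 3. $T$ maps $L^\infty_G$ boundedly to $\mathrm{BMO}_G$: there is a constant $A$ such that, for every $f\in L^\infty_G$, with $f_j=f\chi_{\{|x|\le j\}}$ and $c_j=\int_{1\le d(0,y)\le j}K(0,y)f(y)\,dy$, the functions $S(f_j)-c_j$ converge uniformly (up to null sets) on every compact set, as $j\to\infty$, to a function $b\in\mathrm{BMO}_G$, which defines $Tf$ modulo constants, and $\|b\|_{\mathrm{BMO}}\le A\|f\|_\infty$. -/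

import Mathlib

open MeasureTheory Filter Topology
open scoped ENNReal

noncomputable section

namespace ReflectionSIO

variable {N : ℕ} {𝕜 : Type*} [RCLike 𝕜]

/-! ### Root systems, reflection groups, the orbit distance -/

/-- The reflection `σ_α` of `ℝ^N` in the hyperplane orthogonal to `α`. -/
def rootReflection (α : EuclideanSpace ℝ (Fin N)) :
    EuclideanSpace ℝ (Fin N) ≃ₗᵢ[ℝ] EuclideanSpace ℝ (Fin N) :=
  (Submodule.span ℝ {α})ᗮ.reflection

/-- The explicit formula `σ_α(x) = x - 2 (⟨x, α⟩ / |α|²) α`. -/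
theorem rootReflection_apply (α x : EuclideanSpace ℝ (Fin N)) :
    rootReflection α x = x - (2 * (inner ℝ α x / ‖α‖ ^ 2)) • α := by
  unfold rootReflection
  rw [Submodule.reflection_orthogonal_apply, Submodule.reflection_singleton_apply]
  simp only [RCLike.ofReal_real_eq_id, id_eq, neg_sub, two_smul, mul_smul]

/-- A normalized root system: a finite set `R` of nonzero vectors with `R ∩ ℝα = {α, -α}`,
`σ_α R = R` and `|α| = √2` for all `α ∈ R`. -/
structure IsNormalizedRootSystem (R : Set (EuclideanSpace ℝ (Fin N))) : Prop where
  finite : R.Finite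
  zero_notMem : (0 : EuclideanSpace ℝ (Fin N)) ∉ R
  inter_line : ∀ α ∈ R, R ∩ (Submodule.span ℝ {α} : Set (EuclideanSpace ℝ (Fin N))) = {α, -α}
  reflection_image : ∀ α ∈ R, rootReflection α '' R = R
  norm_eq : ∀ α ∈ R, ‖α‖ = √2

/-- The group generated by the reflections `σ_α`, `α ∈ R`. -/
def reflectionGroup (R : Set (EuclideanSpace ℝ (Fin N))) :
    Subgroup (EuclideanSpace ℝ (Fin N) ≃ₗᵢ[ℝ] EuclideanSpace ℝ (Fin N)) :=
  Subgroup.closure (rootReflection '' R)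

variable (G : Subgroup (EuclideanSpace ℝ (Fin N) ≃ₗᵢ[ℝ] EuclideanSpace ℝ (Fin N)))

/-- The distance `d(x,y) = min_{σ ∈ G} |x - σ(y)|` of the orbits of `x` and `y`
(the infimum is a minimum when `G` is finite). -/
def orbitDist (x y : EuclideanSpace ℝ (Fin N)) : ℝ := ⨅ σ : G, ‖x - σ.1 y‖

theorem orbitDist_nonneg (x y : EuclideanSpace ℝ (Fin N)) : 0 ≤ orbitDist G x y :=
  Real.iInf_nonneg fun _ => norm_nonneg _

theorem orbitDist_apply_self {σ : EuclideanSpace ℝ (Fin N) ≃ₗᵢ[ℝ] EuclideanSpace ℝ (Fin N)}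
    (hσ : σ ∈ G) (x : EuclideanSpace ℝ (Fin N)) : orbitDist G (σ x) x = 0 := by
  refine le_antisymm ?_ (orbitDist_nonneg G _ _)
  have h : orbitDist G (σ x) x ≤ ‖σ x - σ x‖ :=
    ciInf_le (f := fun τ : G => ‖σ x - τ.1 x‖)
      ⟨0, by rintro _ ⟨τ, rfl⟩; exact norm_nonneg _⟩ ⟨σ, hσ⟩
  simpa using h

/-! ### Invariant functions and the spaces `L^p_G` -/

/-- Invariance `f(σ(x)) = f(x)` for almost every `x`, for every `σ ∈ G`. -/
def AEInvariant (f : EuclideanSpace ℝ (Fin N) → 𝕜) : Prop :=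
  ∀ σ ∈ G, (fun x => f (σ x)) =ᵐ[volume] f

variable (𝕜) in
/-- `L^p_G(ℝ^N)`: the `G`-invariant elements of `L^p(ℝ^N)`, with the same norm. -/
def LpG (p : ℝ≥0∞) :
    Submodule 𝕜 (Lp 𝕜 p (volume : Measure (EuclideanSpace ℝ (Fin N)))) where
  carrier := {f | AEInvariant G (f : EuclideanSpace ℝ (Fin N) → 𝕜)}
  zero_mem' := by
    intro σ hσ
    have h := Lp.coeFn_zero 𝕜 p (volume : Measure (EuclideanSpace ℝ (Fin N)))
    have h' := σ.measurePreserving.quasiMeasurePreserving.ae_eq_comp h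
    exact h'.trans h.symm
  add_mem' := by
    intro f g hf hg σ hσ
    have h := Lp.coeFn_add f g
    have h' := σ.measurePreserving.quasiMeasurePreserving.ae_eq_comp h
    exact (h'.trans ((hf σ hσ).add (hg σ hσ))).trans h.symm
  smul_mem' := by
    intro c f hf σ hσ
    have h := Lp.coeFn_smul c f
    have h' := σ.measurePreserving.quasiMeasurePreserving.ae_eq_comp h
    exact (h'.trans ((hf σ hσ).const_smul c)).trans h.symm

/-! ### Compactly supported `G`-invariant Hölder functions and their dual -/

/-- `A` is a bound for the Hölder seminorm
`‖f‖_{G,η} = sup_{d(x,y) ≠ 0} |f(x) - f(y)| / d(x,y)^η`.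
For `η > 0` the pairs with `d(x,y) = 0` express the invariance `f(x) = f(σ(x))`, which follows
from the other pairs when `f` is continuous. -/
def HolderBound (η : ℝ) (f : EuclideanSpace ℝ (Fin N) → 𝕜) (A : ℝ) : Prop :=
  0 ≤ A ∧ ∀ x y, ‖f x - f y‖ ≤ A * orbitDist G x y ^ η

variable (𝕜) in
/-- `C^η_{G,0}(ℝ^N)`: continuous functions with compact support and finite `‖f‖_{G,η}`. -/
def HolderC (η : ℝ) : Submodule 𝕜 (EuclideanSpace ℝ (Fin N) → 𝕜) where
  carrier := {f | Continuous f ∧ HasCompactSupport f ∧ ∃ A, HolderBound G η f A}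
  zero_mem' := ⟨continuous_zero, HasCompactSupport.zero, 0, le_rfl, by simp⟩
  add_mem' := by
    rintro f g ⟨hf, hf', A, hA, hfA⟩ ⟨hg, hg', B, hB, hgB⟩
    refine ⟨hf.add hg, hf'.add hg', A + B, add_nonneg hA hB, fun x y => ?_⟩
    calc ‖(f + g) x - (f + g) y‖ = ‖(f x - f y) + (g x - g y)‖ := by
          congr 1; simp only [Pi.add_apply]; ring
      _ ≤ ‖f x - f y‖ + ‖g x - g y‖ := norm_add_le _ _
      _ ≤ A * orbitDist G x y ^ η + B * orbitDist G x y ^ η := add_le_add (hfA x y) (hgB x y)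
      _ = (A + B) * orbitDist G x y ^ η := by ring
  smul_mem' := by
    rintro c f ⟨hf, hf', A, hA, hfA⟩
    refine ⟨hf.const_smul c, hf'.smul_left (f := fun _ => c), ‖c‖ * A,
      mul_nonneg (norm_nonneg c) hA, fun x y => ?_⟩
    calc ‖(c • f) x - (c • f) y‖ = ‖c‖ * ‖f x - f y‖ := by
          rw [← norm_mul]; congr 1; simp only [Pi.smul_apply, smul_eq_mul]; ring
      _ ≤ ‖c‖ * (A * orbitDist G x y ^ η) := mul_le_mul_of_nonneg_left (hfA x y) (norm_nonneg c)
      _ = ‖c‖ * A * orbitDist G x y ^ η := by ring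

variable (𝕜) in
/-- The dual `(C^η_{G,0}(ℝ^N))'`: linear functionals that are bounded, with respect to
`‖·‖_{G,η}`, on the functions supported in any fixed ball (i.e. continuous for the inductive
limit topology). -/
def HolderDual (η : ℝ) : Submodule 𝕜 (Module.Dual 𝕜 (HolderC 𝕜 G η)) where
  carrier := {Λ | ∀ r : ℝ, ∃ M : ℝ, ∀ (g : HolderC 𝕜 G η) (A : ℝ),
    tsupport g.1 ⊆ Metric.closedBall 0 r → HolderBound G η g.1 A → ‖Λ g‖ ≤ M * A}
  zero_mem' := fun _ => ⟨0, fun _ _ _ _ => by simp⟩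
  add_mem' := by
    intro Λ Λ' h h' r
    obtain ⟨M, hM⟩ := h r
    obtain ⟨M', hM'⟩ := h' r
    refine ⟨M + M', fun g A hg hA => ?_⟩
    calc ‖(Λ + Λ') g‖ ≤ ‖Λ g‖ + ‖Λ' g‖ := norm_add_le _ _
      _ ≤ M * A + M' * A := add_le_add (hM g A hg hA) (hM' g A hg hA)
      _ = (M + M') * A := by ring
  smul_mem' := by
    intro c Λ h r
    obtain ⟨M, hM⟩ := h r
    refine ⟨‖c‖ * M, fun g A hg hA => ?_⟩
    calc ‖(c • Λ) g‖ = ‖c‖ * ‖Λ g‖ := norm_mul _ _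
      _ ≤ ‖c‖ * (M * A) := mul_le_mul_of_nonneg_left (hM g A hg hA) (norm_nonneg c)
      _ = ‖c‖ * M * A := by ring

variable {G}

theorem HolderC.aeInvariant {η : ℝ} (hη : 0 < η) (f : HolderC 𝕜 G η) : AEInvariant G f.1 := by
  intro σ hσ
  obtain ⟨-, -, A, -, hA⟩ := f.2
  refine Eventually.of_forall fun x => ?_
  have h := hA (σ x) x
  rw [orbitDist_apply_self G hσ, Real.zero_rpow hη.ne', mul_zero] at h
  exact sub_eq_zero.1 (norm_le_zero_iff.1 h)

/-- A function of `C^η_{G,0}`, `η > 0`, as an element of `L^p_G`. -/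
def HolderC.toLpG {η : ℝ} (hη : 0 < η) (p : ℝ≥0∞) (f : HolderC 𝕜 G η) : LpG 𝕜 G p :=
  ⟨(f.2.1.memLp_of_hasCompactSupport f.2.2.1).toLp f.1, by
    intro σ hσ
    have h := (f.2.1.memLp_of_hasCompactSupport (p := p) (μ := volume) f.2.2.1).coeFn_toLp
    have h' := σ.measurePreserving.quasiMeasurePreserving.ae_eq_comp h
    exact (h'.trans (HolderC.aeInvariant hη f σ hσ)).trans h.symm⟩

/-! ### Singular integral operators -/

/-- `K` satisfies the size and smoothness conditions of a singular kernel
(`K(x,y)` matters only where `d(x,y) ≠ 0`). -/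
def IsSingularKernel (G : Subgroup (EuclideanSpace ℝ (Fin N) ≃ₗᵢ[ℝ] EuclideanSpace ℝ (Fin N)))
    (K : EuclideanSpace ℝ (Fin N) → EuclideanSpace ℝ (Fin N) → 𝕜) : Prop :=
  ∃ C ε : ℝ, 0 < ε ∧ ε ≤ 1 ∧
    (∀ x y, orbitDist G x y ≠ 0 → ‖K x y‖ ≤ C * (1 / orbitDist G x y ^ N)) ∧
    (∀ x x' y, orbitDist G x y ≠ 0 → orbitDist G x x' ≤ 1 / 2 * orbitDist G x y →
      ‖K x y - K x' y‖ ≤ C * (orbitDist G x x' ^ ε / orbitDist G x y ^ (N + ε))) ∧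
    (∀ x y y', orbitDist G x y ≠ 0 → orbitDist G y y' ≤ 1 / 2 * orbitDist G x y →
      ‖K x y - K x y'‖ ≤ C * (orbitDist G y y' ^ ε / orbitDist G x y ^ (N + ε)))

/-- `T : C^η_{G,0} → (C^η_{G,0})'` is a singular integral operator with kernel `K`: the kernel
satisfies the size and smoothness conditions, and
`⟨T f, g⟩ = ∫ ∫ K(x,y) f(y) g(x) dy dx` whenever this integral converges absolutely. -/
structure IsSingularIntegral {η : ℝ} (T : HolderC 𝕜 G η →ₗ[𝕜] HolderDual 𝕜 G η)
    (K : EuclideanSpace ℝ (Fin N) → EuclideanSpace ℝ (Fin N) → 𝕜) : Prop where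
  kernel : IsSingularKernel G K
  integral_eq : ∀ f g : HolderC 𝕜 G η,
    Integrable (fun z : EuclideanSpace ℝ (Fin N) × EuclideanSpace ℝ (Fin N) =>
      K z.1 z.2 * f.1 z.2 * g.1 z.1) (volume.prod volume) →
    (T f).1 g = ∫ x, ∫ y, K x y * f.1 y * g.1 x

/-- The bounded operator `S` on `L^p_G` is an extension of `T`: for `f ∈ C^η_{G,0}` the functional
`T f` is given by integration against `S f`. -/
def IsLpExtension {η : ℝ} (hη : 0 < η) (T : HolderC 𝕜 G η →ₗ[𝕜] HolderDual 𝕜 G η)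
    (p : ℝ≥0∞) [Fact (1 ≤ p)] (S : LpG 𝕜 G p →L[𝕜] LpG 𝕜 G p) : Prop :=
  ∀ f g : HolderC 𝕜 G η,
    (T f).1 g = ∫ x, ((S (HolderC.toLpG hη p f)).1 : EuclideanSpace ℝ (Fin N) → 𝕜) x * g.1 x

/-! ### `BMO` and the action on `L^∞_G` -/

/-- The `BMO` seminorm: the supremum over all balls `B` of `(1/|B|) ∫_B |b - b_B|`,
where `b_B` is the mean of `b` over `B`. -/
def bmoNorm (b : EuclideanSpace ℝ (Fin N) → 𝕜) : ℝ≥0∞ :=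
  ⨆ (x : EuclideanSpace ℝ (Fin N)) (r : ℝ) (_ : 0 < r),
    (∫⁻ y in Metric.ball x r, ‖b y - ⨍ z in Metric.ball x r, b z‖ₑ) / volume (Metric.ball x r)

variable (G) in
/-- `b` is (a representative of) an element of `BMO_G(ℝ^N)`. -/
structure MemBMOG (b : EuclideanSpace ℝ (Fin N) → 𝕜) : Prop where
  locallyIntegrable : LocallyIntegrable b
  invariant : AEInvariant G b
  norm_lt_top : bmoNorm b < ∞

/-- `b` is the value at `f ∈ L^∞_G` of the operator `S` of `L²_G` with kernel `K`, as a function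
modulo constants: with `f_j = f · 1_{|x| ≤ j}` and `c_j = ∫_{1 ≤ d(0,y) ≤ j} K(0,y) f(y) dy`,
the functions `S(f_j) - c_j` converge to `b` uniformly (up to null sets) on every ball
`{|x| ≤ r}`. -/
def IsLinftyValue (K : EuclideanSpace ℝ (Fin N) → EuclideanSpace ℝ (Fin N) → 𝕜)
    (S : LpG 𝕜 G 2 →L[𝕜] LpG 𝕜 G 2) (f : LpG 𝕜 G ∞) (b : EuclideanSpace ℝ (Fin N) → 𝕜) : Prop :=
  ∃ F : ℕ → LpG 𝕜 G 2,
    (∀ j, ((F j).1 : EuclideanSpace ℝ (Fin N) → 𝕜) =ᵐ[volume]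
      (Metric.closedBall 0 (j : ℝ)).indicator (f.1 : EuclideanSpace ℝ (Fin N) → 𝕜)) ∧
    ∀ r : ℝ, Tendsto
      (fun j : ℕ => eLpNorm
        (fun x => ((S (F j)).1 : EuclideanSpace ℝ (Fin N) → 𝕜) x
          - (∫ y in {y | 1 ≤ orbitDist G 0 y ∧ orbitDist G 0 y ≤ j}, K 0 y * f.1 y) - b x)
        ∞ (volume.restrict (Metric.closedBall 0 r)))
      atTop (𝓝 0)

end ReflectionSIO

end

open ReflectionSIO

open MeasureTheory Filter Topology
open scoped ENNReal

noncomputable section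

namespace ReflectionSIO

variable {N : ℕ} {𝕜 : Type*} [RCLike 𝕜]

local notation "𝔼" => EuclideanSpace ℝ (Fin N)

variable {G : Subgroup (EuclideanSpace ℝ (Fin N) ≃ₗᵢ[ℝ] EuclideanSpace ℝ (Fin N))}

/-! ### The orbit distance as a pseudometric -/

/-! The operator is turned into an ordinary Calderón–Zygmund operator on all of `L²(ℝ^N)`, whose
kernel is singular on {d(x,y) = 0}, a finite union of graphs y = σ(x), instead of on the diagonal.
The group is finite, so `d` is a pseudometric, a d-ball is covered by |G| Euclidean balls, and
∫_{d(x,z) ≥ ρ} d(x,z)^(-N-ε) dx = O(ρ^(-ε)). The Euclidean arguments therefore survive at the cost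
of factors |G|.

Transfer. The smoothness conditions with d(x,x') = 0 force `K` to be invariant in each variable off
the singular set. Compose `S` with the orthogonal projection P of `L²` onto `L²_G`, which is
averaging over G. For smooth φ, ψ whose supports have no orbit in common, ∫ (S P φ) ψ = ⟨T(Pφ), Pψ⟩
= ∬ K Pφ Pψ = ∬ K φ ψ (`IsSingularIntegral.hasSmoothKernel`). Testing against smooth functions and
passing twice to the transpose gives S P f(x) = ∫ K(x,y) f(y) dy for a.e. x off the orbits of a
compact set carrying f (`HasSmoothKernel.hasKernel`).

Weak type and `L^p`. A Calderón–Zygmund decomposition with Euclidean balls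
(`exists_calderonZygmund_decomposition`) gives weak type (1,1) on `L¹ ∩ L²`
(`HasKernel.exists_weak_type`): the cancellation of a bad piece makes its image integrable away from
the orbit of its ball. Marcinkiewicz interpolation with the `L²` bound covers 1 < p < 2. The
transpose has the kernel K(y,x), of the same type, and duality (`IsTranspose.strong_type`) covers p
> 2. On invariant functions S P is `S`, and density of `L^p_G ∩ L²_G` in `L^p_G` extends `S`; for p
= 1 the extension is made by a Borel–Cantelli argument (`exists_linear_extension_of_weak_type`).

Bounded functions. Subtracting c_j replaces K(x,y) by K(x,y) - K(0,y) at large y, which is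
integrable there, so S(f_j) - c_j is locally uniformly Cauchy (`HasKernel.exists_norm_sub_le`). On a
ball B the limit is compared with a constant: the part of f in the orbit ball of twice the radius is
controlled by the `L²` bound, the rest by the smoothness of `K` (`HasKernel.exists_bmoNorm_le`). -/

theorem orbitDist_le {σ : EuclideanSpace ℝ (Fin N) ≃ₗᵢ[ℝ] EuclideanSpace ℝ (Fin N)}
    (hσ : σ ∈ G) (x y : 𝔼) : orbitDist G x y ≤ ‖x - σ y‖ :=
  ciInf_le (f := fun τ : G => ‖x - τ.1 y‖)
    ⟨0, by rintro _ ⟨τ, rfl⟩; exact norm_nonneg _⟩ ⟨σ, hσ⟩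

theorem orbitDist_le_norm_sub (x y : 𝔼) : orbitDist G x y ≤ ‖x - y‖ :=
  orbitDist_le G.one_mem x y

theorem exists_orbitDist_eq [Finite G] (x y : 𝔼) :
    ∃ σ ∈ G, orbitDist G x y = ‖x - σ y‖ := by
  obtain ⟨σ, hσ⟩ := exists_eq_ciInf_of_finite (f := fun τ : G => ‖x - τ.1 y‖)
  exact ⟨σ.1, σ.2, hσ.symm⟩

theorem orbitDist_comm [Finite G] (x y : 𝔼) : orbitDist G x y = orbitDist G y x := by
  have key : ∀ x y : 𝔼, orbitDist G x y ≤ orbitDist G y x := by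
    intro x y
    obtain ⟨σ, hσ, h⟩ := exists_orbitDist_eq (G := G) y x
    rw [h, norm_sub_rev]
    refine (orbitDist_le (G.inv_mem hσ) x y).trans (le_of_eq ?_)
    rw [← σ.norm_map (x - σ⁻¹ y), map_sub]
    congr 2
    exact σ.apply_symm_apply y
  exact le_antisymm (key x y) (key y x)

/-- If σ and τ realize the two distances on the right, then στ is a competitor for the one on the
left, since σ is an isometry. -/
theorem orbitDist_triangle [Finite G] (x y z : 𝔼) :
    orbitDist G x z ≤ orbitDist G x y + orbitDist G y z := by
  obtain ⟨σ, hσ, h⟩ := exists_orbitDist_eq (G := G) x y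
  obtain ⟨τ, hτ, h'⟩ := exists_orbitDist_eq (G := G) y z
  rw [h, h', ← σ.norm_map (y - τ z), map_sub]
  refine (orbitDist_le (G.mul_mem hσ hτ) x z).trans ?_
  have : x - (σ * τ) z = (x - σ y) + (σ y - σ (τ z)) := by
    rw [sub_add_sub_cancel]; rfl
  rw [this]
  exact norm_add_le _ _

theorem orbitDist_apply_left [Finite G]
    {σ : EuclideanSpace ℝ (Fin N) ≃ₗᵢ[ℝ] EuclideanSpace ℝ (Fin N)} (hσ : σ ∈ G) (x y : 𝔼) :
    orbitDist G (σ x) y = orbitDist G x y := by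
  have h1 := orbitDist_triangle (G := G) (σ x) x y
  have h2 := orbitDist_triangle (G := G) x (σ x) y
  rw [orbitDist_comm x (σ x)] at h2
  rw [orbitDist_apply_self G hσ] at h1 h2
  linarith

theorem orbitDist_apply_right [Finite G]
    {σ : EuclideanSpace ℝ (Fin N) ≃ₗᵢ[ℝ] EuclideanSpace ℝ (Fin N)} (hσ : σ ∈ G) (x y : 𝔼) :
    orbitDist G x (σ y) = orbitDist G x y := by
  rw [orbitDist_comm, orbitDist_apply_left hσ, orbitDist_comm]

theorem orbitDist_zero_left (y : 𝔼) : orbitDist G 0 y = ‖y‖ := by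
  simp [orbitDist]

theorem abs_orbitDist_sub_le [Finite G] (x y x' y' : 𝔼) :
    |orbitDist G x y - orbitDist G x' y'| ≤ ‖x - x'‖ + ‖y - y'‖ := by
  have h1 := orbitDist_triangle (G := G) x x' y
  have h2 := orbitDist_triangle (G := G) x' y' y
  have h3 := orbitDist_triangle (G := G) x' x y'
  have h4 := orbitDist_triangle (G := G) x y y'
  have h5 := orbitDist_le_norm_sub (G := G) x x'
  have h6 := orbitDist_le_norm_sub (G := G) y y'
  rw [orbitDist_comm x' x] at h3
  rw [orbitDist_comm y' y] at h2
  rw [abs_le]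
  constructor <;> linarith

theorem continuous_orbitDist [Finite G] :
    Continuous (fun z : 𝔼 × 𝔼 => orbitDist G z.1 z.2) := by
  refine LipschitzWith.continuous (K := 2) (LipschitzWith.of_dist_le_mul fun z w => ?_)
  rw [Real.dist_eq]
  refine (abs_orbitDist_sub_le _ _ _ _).trans ?_
  rw [← dist_eq_norm, ← dist_eq_norm, Prod.dist_eq]
  have h1 := le_max_left (dist z.1 w.1) (dist z.2 w.2)
  have h2 := le_max_right (dist z.1 w.1) (dist z.2 w.2)
  push_cast
  linarith

theorem continuous_orbitDist_left [Finite G] (y : 𝔼) : Continuous (fun x : 𝔼 => orbitDist G x y) :=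
  by
  have h := (continuous_orbitDist (G := G)).comp
    (Continuous.prodMk continuous_id (continuous_const (y := y)))
  exact h

theorem continuous_orbitDist_right [Finite G] (x : 𝔼) : Continuous (fun y : 𝔼 => orbitDist G x y) :=
  by
  have h := (continuous_orbitDist (G := G)).comp
    (Continuous.prodMk (continuous_const (y := x)) continuous_id)
  exact h

/-! ### Volumes of balls and orbit balls -/

theorem volume_closedBall_eq (x : 𝔼) {r : ℝ} (hr : 0 ≤ r) :
    volume (Metric.closedBall x r) =
      ENNReal.ofReal (r ^ N) * volume (Metric.ball (0 : 𝔼) 1) := by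
  have := Measure.addHaar_closedBall (volume : Measure 𝔼) x hr
  simpa using this

theorem volume_ball_eq (x : 𝔼) {r : ℝ} (hr : 0 < r) :
    volume (Metric.ball x r) = ENNReal.ofReal (r ^ N) * volume (Metric.ball (0 : 𝔼) 1) := by
  have := Measure.addHaar_ball_of_pos (volume : Measure 𝔼) x hr
  simpa using this

theorem volume_closedBall_mul (x y : 𝔼) {r c : ℝ} (hr : 0 ≤ r) (hc : 0 ≤ c) :
    volume (Metric.closedBall x (c * r)) =
      ENNReal.ofReal (c ^ N) * volume (Metric.closedBall y r) := by
  rw [volume_closedBall_eq x (mul_nonneg hc hr), volume_closedBall_eq y hr, mul_pow,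
    ENNReal.ofReal_mul (by positivity), mul_assoc]

variable (G) in
/-- The closed ball of the orbit distance. -/
def orbitBall (x : EuclideanSpace ℝ (Fin N)) (r : ℝ) : Set (EuclideanSpace ℝ (Fin N)) :=
  {y | orbitDist G x y ≤ r}

theorem isClosed_orbitBall [Finite G] (x : 𝔼) (r : ℝ) : IsClosed (orbitBall G x r) :=
  isClosed_le (continuous_orbitDist_right x) continuous_const

/-- An orbit ball is covered by the Euclidean balls of the same radius about the points σ(x). -/
theorem volume_orbitBall_le [Finite G] (x : 𝔼) (r : ℝ) :
    volume (orbitBall G x r) ≤ Nat.card G * volume (Metric.closedBall x r) := by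
  have := Fintype.ofFinite G
  have hsub : orbitBall G x r ⊆ ⋃ σ : G, Metric.closedBall (σ.1 x) r := by
    intro y hy
    obtain ⟨σ, hσ, h⟩ := exists_orbitDist_eq (G := G) y x
    refine Set.mem_iUnion.2 ⟨⟨σ, hσ⟩, ?_⟩
    rw [Metric.mem_closedBall, dist_eq_norm, ← h, orbitDist_comm]
    exact hy
  calc volume (orbitBall G x r) ≤ volume (⋃ σ : G, Metric.closedBall (σ.1 x) r) :=
        measure_mono hsub
    _ ≤ ∑ σ : G, volume (Metric.closedBall (σ.1 x) r) := measure_iUnion_fintype_le _ _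
    _ = Nat.card G * volume (Metric.closedBall x r) := by
        have : ∀ σ : G, volume (Metric.closedBall (σ.1 x) r) = volume (Metric.closedBall x r) :=
          fun σ => by
            rw [Measure.addHaar_closedBall_center, ← Measure.addHaar_closedBall_center _ x]
        simp [this, Nat.card_eq_fintype_card]

/-! ### Decay of the kernel bound away from an orbit -/

/-- Where ‖x - z‖ ≥ ρ one has ‖x - z‖ ≥ (ρ + ‖x - z‖)/2. Translation and dilation by ρ then reduce
the integral to that of (1 + ‖x‖)^(-N-ε), which is finite. -/
theorem exists_lintegral_norm_rpow_le {ε : ℝ} (hε : 0 < ε) :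
    ∃ A : ℝ≥0∞, A ≠ ∞ ∧ ∀ (z : EuclideanSpace ℝ (Fin N)) (ρ : ℝ), 0 < ρ →
      ∫⁻ x in {x : EuclideanSpace ℝ (Fin N) | ρ ≤ ‖x - z‖},
        ENNReal.ofReal (1 / ‖x - z‖ ^ (N + ε)) ≤ A * ENNReal.ofReal (ρ ^ (-ε)) := by
  set s : ℝ := N + ε with hs
  have hs0 : 0 < s := by positivity
  set I : ℝ≥0∞ := ∫⁻ x : EuclideanSpace ℝ (Fin N), ENNReal.ofReal ((1 + ‖x‖) ^ (-s)) with hI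
  have hIfin : I < ∞ := finite_integral_one_add_norm (by simp [hs, hε])
  refine ⟨ENNReal.ofReal (2 ^ s) * I, ENNReal.mul_ne_top ENNReal.ofReal_ne_top hIfin.ne, ?_⟩
  intro z ρ hρ
  have hmeas : Measurable fun x : 𝔼 => ENNReal.ofReal ((1 + ‖x‖) ^ (-s)) := by
    fun_prop
  have hscale : ∫⁻ x : 𝔼, ENNReal.ofReal ((1 + ‖ρ⁻¹ • (x - z)‖) ^ (-s))
      = ENNReal.ofReal (ρ ^ N) * I := by
    rw [lintegral_sub_right_eq_self
      (fun x : 𝔼 => ENNReal.ofReal ((1 + ‖ρ⁻¹ • x‖) ^ (-s))) z]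
    have := Measure.map_addHaar_smul (volume : Measure 𝔼) (inv_ne_zero hρ.ne')
    have h2 := lintegral_map (μ := (volume : Measure 𝔼)) hmeas
      (measurable_const_smul (ρ⁻¹) : Measurable fun x : 𝔼 => ρ⁻¹ • x)
    rw [← h2, this, lintegral_smul_measure]
    simp only [finrank_euclideanSpace, Fintype.card_fin, smul_eq_mul]
    congr 2
    rw [inv_pow, inv_inv, abs_of_pos (by positivity)]
  calc ∫⁻ x in {x : 𝔼 | ρ ≤ ‖x - z‖}, ENNReal.ofReal (1 / ‖x - z‖ ^ s)
      ≤ ∫⁻ x in {x : 𝔼 | ρ ≤ ‖x - z‖}, ENNReal.ofReal (2 ^ s * ρ ^ (-s)) *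
          ENNReal.ofReal ((1 + ‖ρ⁻¹ • (x - z)‖) ^ (-s)) := by
        refine setLIntegral_mono' (measurableSet_le measurable_const (by fun_prop)) fun x hx => ?_
        have hx' : ρ ≤ ‖x - z‖ := hx
        rw [← ENNReal.ofReal_mul (by positivity)]
        refine ENNReal.ofReal_le_ofReal ?_
        have hpos : 0 < ‖x - z‖ := hρ.trans_le hx'
        rw [norm_smul, norm_inv, Real.norm_of_nonneg hρ.le, one_div, ← Real.rpow_neg hpos.le,
          mul_assoc, ← Real.mul_rpow hρ.le (by positivity)]
        have e1 : ρ * (1 + ρ⁻¹ * ‖x - z‖) = ρ + ‖x - z‖ := by field_simp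
        rw [e1]
        have e2 : (2 : ℝ) ^ s * (ρ + ‖x - z‖) ^ (-s) = ((ρ + ‖x - z‖) / 2) ^ (-s) := by
          rw [Real.div_rpow (by positivity) (by norm_num), Real.rpow_neg (by norm_num : (0:ℝ) ≤ 2)]
          field_simp
        rw [e2]
        exact Real.rpow_le_rpow_of_nonpos (by positivity) (by linarith) (by linarith)
    _ ≤ ∫⁻ x : 𝔼, ENNReal.ofReal (2 ^ s * ρ ^ (-s)) *
          ENNReal.ofReal ((1 + ‖ρ⁻¹ • (x - z)‖) ^ (-s)) := setLIntegral_le_lintegral _ _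
    _ = ENNReal.ofReal (2 ^ s) * I * ENNReal.ofReal (ρ ^ (-ε)) := by
        rw [lintegral_const_mul _ (by fun_prop), hscale, ENNReal.ofReal_mul (by positivity)]
        have : ENNReal.ofReal (ρ ^ (-s)) * ENNReal.ofReal (ρ ^ N) = ENNReal.ofReal (ρ ^ (-ε)) := by
          rw [← ENNReal.ofReal_mul (by positivity), ← Real.rpow_natCast, ← Real.rpow_add hρ]
          congr 2
          rw [hs]; ring
        rw [← this]
        ring

/-- At each x the orbit distance equals ‖x - σ(z)‖ for some σ, so the integrand is at most the sum
over G of its Euclidean analogues. -/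
theorem exists_lintegral_orbitDist_rpow_le [Finite G] {ε : ℝ} (hε : 0 < ε) :
    ∃ A : ℝ≥0∞, A ≠ ∞ ∧ ∀ (z : 𝔼) (ρ : ℝ), 0 < ρ →
      ∫⁻ x in {x : 𝔼 | ρ ≤ orbitDist G x z},
        ENNReal.ofReal (1 / orbitDist G x z ^ (N + ε)) ≤ A * ENNReal.ofReal (ρ ^ (-ε)) := by
  have := Fintype.ofFinite G
  obtain ⟨A, hA, h⟩ := exists_lintegral_norm_rpow_le (N := N) hε
  refine ⟨Nat.card G * A, ENNReal.mul_ne_top (by simp) hA, fun z ρ hρ => ?_⟩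
  have key : ∀ x : 𝔼, ENNReal.ofReal (1 / orbitDist G x z ^ (N + ε)) ≤
      ∑ σ : G, ENNReal.ofReal (1 / ‖x - σ.1 z‖ ^ (N + ε)) := by
    intro x
    obtain ⟨σ, e⟩ : ∃ σ : G, orbitDist G x z = ‖x - σ.1 z‖ := by
      obtain ⟨σ, hσ, e⟩ := exists_orbitDist_eq (G := G) x z
      exact ⟨⟨σ, hσ⟩, e⟩
    rw [e]
    exact Finset.single_le_sum (f := fun σ : G => ENNReal.ofReal (1 / ‖x - σ.1 z‖ ^ (N + ε)))
      (fun _ _ => zero_le) (Finset.mem_univ σ)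
  have hm : MeasurableSet {x : 𝔼 | ρ ≤ orbitDist G x z} :=
    measurableSet_le measurable_const (continuous_orbitDist_left z).measurable
  calc ∫⁻ x in {x : 𝔼 | ρ ≤ orbitDist G x z}, ENNReal.ofReal (1 / orbitDist G x z ^ (N + ε))
      ≤ ∫⁻ x in {x : 𝔼 | ρ ≤ orbitDist G x z},
          ∑ σ : G, ENNReal.ofReal (1 / ‖x - σ.1 z‖ ^ (N + ε)) := by
        exact setLIntegral_mono' hm fun x _ => key x
    _ = ∑ σ : G, ∫⁻ x in {x : 𝔼 | ρ ≤ orbitDist G x z},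
          ENNReal.ofReal (1 / ‖x - σ.1 z‖ ^ (N + ε)) :=
        lintegral_finsetSum _ fun σ _ => by fun_prop
    _ ≤ ∑ σ : G, A * ENNReal.ofReal (ρ ^ (-ε)) := by
        refine Finset.sum_le_sum fun σ _ => ?_
        refine (lintegral_mono_set ?_).trans (h (σ.1 z) ρ hρ)
        intro x hx
        exact le_trans hx (orbitDist_le σ.2 x z)
    _ = Nat.card G * A * ENNReal.ofReal (ρ ^ (-ε)) := by
        simp [Nat.card_eq_fintype_card, mul_assoc]

/-! ### Singular kernels and their potentials -/

/-- The size and smoothness conditions of a singular kernel, with explicit constants. -/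
structure KernelBounds (G : Subgroup (EuclideanSpace ℝ (Fin N) ≃ₗᵢ[ℝ] EuclideanSpace ℝ (Fin N)))
    (K : EuclideanSpace ℝ (Fin N) → EuclideanSpace ℝ (Fin N) → 𝕜) (C ε : ℝ) : Prop where
  nonneg : 0 ≤ C
  pos : 0 < ε
  size : ∀ x y, orbitDist G x y ≠ 0 → ‖K x y‖ ≤ C * (1 / orbitDist G x y ^ N)
  smooth_left : ∀ x x' y, orbitDist G x y ≠ 0 → orbitDist G x x' ≤ 1 / 2 * orbitDist G x y →
      ‖K x y - K x' y‖ ≤ C * (orbitDist G x x' ^ ε / orbitDist G x y ^ (N + ε))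
  smooth_right : ∀ x y y', orbitDist G x y ≠ 0 → orbitDist G y y' ≤ 1 / 2 * orbitDist G x y →
      ‖K x y - K x y'‖ ≤ C * (orbitDist G y y' ^ ε / orbitDist G x y ^ (N + ε))

/-- The sign of the constant is not prescribed in `IsSingularKernel`, so it is replaced by its
absolute value. -/
theorem IsSingularKernel.exists_kernelBounds {K : 𝔼 → 𝔼 → 𝕜} (h : IsSingularKernel G K) :
    ∃ C ε : ℝ, KernelBounds G K C ε := by
  obtain ⟨C, ε, h0, -, h1, h2, h3⟩ := h
  have hp : ∀ x y : 𝔼, 0 ≤ orbitDist G x y := orbitDist_nonneg G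
  refine ⟨|C|, ε, abs_nonneg C, h0, fun x y h => (h1 x y h).trans ?_,
    fun x x' y h h' => (h2 x x' y h h').trans ?_, fun x y y' h h' => (h3 x y y' h h').trans ?_⟩
  · have := hp x y
    exact mul_le_mul_of_nonneg_right (le_abs_self C) (by positivity)
  · have := hp x y
    have := hp x x'
    exact mul_le_mul_of_nonneg_right (le_abs_self C) (by positivity)
  · have := hp x y
    have := hp y y'
    exact mul_le_mul_of_nonneg_right (le_abs_self C) (by positivity)

namespace KernelBounds

variable {K : EuclideanSpace ℝ (Fin N) → EuclideanSpace ℝ (Fin N) → 𝕜} {C ε : ℝ}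

theorem swap [Finite G] (h : KernelBounds G K C ε) :
    KernelBounds G (fun x y => K y x) C ε where
  nonneg := h.nonneg
  pos := h.pos
  size x y hxy := by
    rw [orbitDist_comm] at hxy ⊢
    exact h.size y x hxy
  smooth_left x x' y hxy hx := by
    rw [orbitDist_comm x y] at hxy hx ⊢
    exact h.smooth_right y x x' hxy hx
  smooth_right x y y' hxy hx := by
    rw [orbitDist_comm x y] at hxy hx ⊢
    exact h.smooth_left y y' x hxy hx

/-- Smoothness at d(x,x') = 0 has right-hand side 0, because 0^ε = 0 for ε > 0. This is the source
of the G-invariance of the kernel off its singular set. -/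
theorem apply_left (h : KernelBounds G K C ε) {x x' y : 𝔼} (hx : orbitDist G x x' = 0)
    (hxy : orbitDist G x y ≠ 0) : K x' y = K x y := by
  have h1 := h.smooth_left x x' y hxy (by rw [hx]; have := orbitDist_nonneg G x y; positivity)
  rw [hx, Real.zero_rpow h.pos.ne', zero_div, mul_zero] at h1
  exact (sub_eq_zero.1 (norm_le_zero_iff.1 h1)).symm

theorem apply_right (h : KernelBounds G K C ε) {x y y' : 𝔼} (hy : orbitDist G y y' = 0)
    (hxy : orbitDist G x y ≠ 0) : K x y' = K x y := by
  have h1 := h.smooth_right x y y' hxy (by rw [hy]; have := orbitDist_nonneg G x y; positivity)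
  rw [hy, Real.zero_rpow h.pos.ne', zero_div, mul_zero] at h1
  exact (sub_eq_zero.1 (norm_le_zero_iff.1 h1)).symm

/-- A modulus of continuity of the kernel at distance at least `δ` from the orbit. -/
theorem norm_sub_left_le (h : KernelBounds G K C ε) {x x' y : 𝔼} {δ : ℝ} (hδ : 0 < δ)
    (hxy : δ ≤ orbitDist G x y) (hx : ‖x - x'‖ ≤ δ / 2) :
    ‖K x y - K x' y‖ ≤ C * (‖x - x'‖ ^ ε / δ ^ (N + ε)) := by
  have h0 := orbitDist_le_norm_sub (G := G) x x'
  have hε := h.pos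
  have h1 : (0 : ℝ) ≤ orbitDist G x x' := orbitDist_nonneg G _ _
  refine (h.smooth_left x x' y (hδ.trans_le hxy).ne' (by linarith)).trans ?_
  refine mul_le_mul_of_nonneg_left ?_ h.nonneg
  gcongr

theorem continuousOn_uncurry [Finite G] (h : KernelBounds G K C ε) :
    ContinuousOn (fun z : 𝔼 × 𝔼 => K z.1 z.2) {z | orbitDist G z.1 z.2 ≠ 0} := by
  rintro ⟨x, y⟩ hxy
  have hxy : orbitDist G x y ≠ 0 := hxy
  have hε := h.pos
  set d := orbitDist G x y with hd
  have hd0 : 0 < d := lt_of_le_of_ne (orbitDist_nonneg G _ _) hxy.symm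
  refine ContinuousAt.continuousWithinAt ?_
  rw [ContinuousAt, tendsto_iff_norm_sub_tendsto_zero]
  have hlim : Tendsto (fun z : 𝔼 × 𝔼 => C * (‖z.1 - x‖ ^ ε / (d / 2) ^ (N + ε)) +
      C * (‖z.2 - y‖ ^ ε / d ^ (N + ε))) (𝓝 (x, y)) (𝓝 0) := by
    have : Continuous (fun z : 𝔼 × 𝔼 => C * (‖z.1 - x‖ ^ ε / (d / 2) ^ (N + ε)) +
      C * (‖z.2 - y‖ ^ ε / d ^ (N + ε))) := by
      have h1 : Continuous (fun z : 𝔼 × 𝔼 => ‖z.1 - x‖ ^ ε) :=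
        Continuous.rpow_const (by fun_prop) fun _ => Or.inr hε.le
      have h2 : Continuous (fun z : 𝔼 × 𝔼 => ‖z.2 - y‖ ^ ε) :=
        Continuous.rpow_const (by fun_prop) fun _ => Or.inr hε.le
      exact ((h1.div_const _).const_mul _).add ((h2.div_const _).const_mul _)
    have h3 := this.tendsto (x, y)
    simpa [Real.zero_rpow hε.ne'] using h3
  refine squeeze_zero' (Eventually.of_forall fun _ => norm_nonneg _) ?_ hlim
  filter_upwards [prod_mem_nhds (Metric.ball_mem_nhds x (by positivity : 0 < d / 4))
    (Metric.ball_mem_nhds y (by positivity : 0 < d / 4))] with z hz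
  have hz1 : ‖z.1 - x‖ < d / 4 := by simpa [dist_eq_norm] using hz.1
  have hz2 : ‖z.2 - y‖ < d / 4 := by simpa [dist_eq_norm] using hz.2
  -- The second variable is moved first. As z.2 is within d/4 of y, it remains at orbit distance at
  -- least d/2 from x, which leaves room to move the first variable by d/4.
  have e1 : ‖K x z.2 - K z.1 z.2‖ ≤ C * (‖x - z.1‖ ^ ε / (d / 2) ^ (N + ε)) := by
    refine h.norm_sub_left_le (by positivity) ?_ (by rw [norm_sub_rev]; linarith)
    have := orbitDist_triangle (G := G) x z.2 y
    have := orbitDist_le_norm_sub (G := G) z.2 y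
    linarith
  have e2 : ‖K x y - K x z.2‖ ≤ C * (‖y - z.2‖ ^ ε / d ^ (N + ε)) := by
    have h0 := orbitDist_le_norm_sub (G := G) y z.2
    have h1 : (0 : ℝ) ≤ orbitDist G y z.2 := orbitDist_nonneg G _ _
    rw [norm_sub_rev] at hz2
    refine (h.smooth_right x y z.2 hxy (by linarith)).trans ?_
    refine mul_le_mul_of_nonneg_left ?_ h.nonneg
    gcongr
  rw [norm_sub_rev x] at e1
  rw [norm_sub_rev y] at e2
  calc ‖K z.1 z.2 - K x y‖ = ‖(K x z.2 - K z.1 z.2) + (K x y - K x z.2)‖ := by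
        rw [← norm_neg]; congr 1; ring
    _ ≤ _ := (norm_add_le _ _).trans (add_le_add e1 e2)

theorem continuousOn_right [Finite G] (h : KernelBounds G K C ε) (x : 𝔼) :
    ContinuousOn (fun y => K x y) {y | orbitDist G x y ≠ 0} := by
  have h1 := h.continuousOn_uncurry.comp
    (Continuous.prodMk (continuous_const (y := x)) continuous_id).continuousOn
    (s := {y : 𝔼 | orbitDist G x y ≠ 0}) (fun y hy => hy)
  exact h1

theorem aestronglyMeasurable_right [Finite G] (h : KernelBounds G K C ε) (x : 𝔼) {A : Set 𝔼}
    (hA : MeasurableSet A) (hxA : ∀ y ∈ A, orbitDist G x y ≠ 0) :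
    AEStronglyMeasurable (fun y => K x y) (volume.restrict A) :=
  ((h.continuousOn_right x).mono hxA).aestronglyMeasurable hA

theorem aestronglyMeasurable_mul [Finite G] (h : KernelBounds G K C ε) (x : 𝔼) {A : Set 𝔼}
    (hA : MeasurableSet A) (hxA : ∀ y ∈ A, orbitDist G x y ≠ 0) {f : 𝔼 → 𝕜}
    (hf : AEStronglyMeasurable f) (hfA : ∀ᵐ y, y ∉ A → f y = 0) :
    AEStronglyMeasurable (fun y => K x y * f y) := by
  have h1 : AEStronglyMeasurable (A.indicator fun y => K x y * f y) :=
    (aestronglyMeasurable_indicator_iff hA).2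
      ((h.aestronglyMeasurable_right x hA hxA).mul hf.restrict)
  refine h1.congr ?_
  filter_upwards [hfA] with y hy
  by_cases hyA : y ∈ A
  · simp [hyA]
  · simp [hyA, hy hyA]

theorem norm_le_of_le (h : KernelBounds G K C ε) {x y : 𝔼} {δ : ℝ} (hδ : 0 < δ)
    (hxy : δ ≤ orbitDist G x y) : ‖K x y‖ ≤ C * (1 / δ ^ N) := by
  refine (h.size x y (hδ.trans_le hxy).ne').trans ?_
  refine mul_le_mul_of_nonneg_left ?_ h.nonneg
  gcongr

theorem integrable_mul [Finite G] (h : KernelBounds G K C ε) {x : 𝔼} {A : Set 𝔼} {δ : ℝ}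
    (hA : MeasurableSet A) (hδ : 0 < δ) (hxA : ∀ y ∈ A, δ ≤ orbitDist G x y) {f : 𝔼 → 𝕜}
    (hf : Integrable f) (hfA : ∀ᵐ y, y ∉ A → f y = 0) :
    Integrable (fun y => K x y * f y) := by
  refine Integrable.mono' (hf.norm.const_mul (C * (1 / δ ^ N)))
    (h.aestronglyMeasurable_mul x hA (fun y hy => (hδ.trans_le (hxA y hy)).ne') hf.1 hfA) ?_
  filter_upwards [hfA] with y hy
  by_cases hyA : y ∈ A
  · rw [norm_mul]
    exact mul_le_mul_of_nonneg_right (h.norm_le_of_le hδ (hxA y hyA)) (norm_nonneg _)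
  · simp [hy hyA]

end KernelBounds

theorem exists_pos_le_orbitDist [Finite G] {B : Set 𝔼} (hB : IsCompact B) {x : 𝔼}
    (hx : ∀ y ∈ B, orbitDist G x y ≠ 0) : ∃ δ > 0, ∀ y ∈ B, δ ≤ orbitDist G x y := by
  rcases B.eq_empty_or_nonempty with rfl | hne
  · exact ⟨1, one_pos, by simp⟩
  · obtain ⟨y₀, hy₀, hmin⟩ := hB.exists_isMinOn hne (continuous_orbitDist_right (G := G) x).continuousOn
    exact ⟨orbitDist G x y₀, lt_of_le_of_ne (orbitDist_nonneg G _ _) (hx y₀ hy₀).symm,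
      fun y hy => hmin hy⟩

theorem isOpen_forall_orbitDist_ne [Finite G] {B : Set 𝔼} (hB : IsCompact B) :
    IsOpen {x : 𝔼 | ∀ y ∈ B, orbitDist G x y ≠ 0} := by
  rw [isOpen_iff_mem_nhds]
  intro x hx
  obtain ⟨δ, hδ, h⟩ := exists_pos_le_orbitDist hB hx
  filter_upwards [Metric.ball_mem_nhds x hδ] with x' hx' y hy h0
  have h1 := orbitDist_triangle (G := G) x x' y
  have h2 := orbitDist_le_norm_sub (G := G) x x'
  have h3 := h y hy
  rw [Metric.mem_ball, dist_comm, dist_eq_norm] at hx'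
  linarith

namespace KernelBounds

variable {K : EuclideanSpace ℝ (Fin N) → EuclideanSpace ℝ (Fin N) → 𝕜} {C ε : ℝ}

/-- Near x the orbit distance to the compact set stays bounded below by some δ/2, and the potential
varies by at most C ‖x - x'‖^ε δ^(-N-ε) ‖f‖₁. -/
theorem continuousOn_potential [Finite G] (h : KernelBounds G K C ε) {B : Set 𝔼}
    (hB : IsCompact B) {f : 𝔼 → 𝕜} (hf : Integrable f) (hfB : ∀ᵐ y, y ∉ B → f y = 0) :
    ContinuousOn (fun x => ∫ y, K x y * f y) {x | ∀ y ∈ B, orbitDist G x y ≠ 0} := by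
  intro x hx
  have hε := h.pos
  obtain ⟨δ, hδ, hδB⟩ := exists_pos_le_orbitDist hB hx
  refine ContinuousAt.continuousWithinAt ?_
  rw [ContinuousAt, tendsto_iff_norm_sub_tendsto_zero]
  have hlim : Tendsto (fun x' : 𝔼 => C * (‖x - x'‖ ^ ε / δ ^ (N + ε)) * ∫ y, ‖f y‖) (𝓝 x)
      (𝓝 0) := by
    have h1 : Continuous (fun x' : 𝔼 => ‖x - x'‖ ^ ε) :=
      Continuous.rpow_const (by fun_prop) fun _ => Or.inr hε.le
    have h3 := (((h1.div_const (δ ^ (N + ε))).const_mul C).mul_const (∫ y, ‖f y‖)).tendsto x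
    simpa [Real.zero_rpow hε.ne'] using h3
  refine squeeze_zero' (Eventually.of_forall fun _ => norm_nonneg _) ?_ hlim
  filter_upwards [Metric.ball_mem_nhds x (by positivity : 0 < δ / 2)] with x' hx'
  rw [Metric.mem_ball, dist_comm, dist_eq_norm] at hx'
  have hx'B : ∀ y ∈ B, δ / 2 ≤ orbitDist G x' y := by
    intro y hy
    have h1 := orbitDist_triangle (G := G) x x' y
    have h2 := orbitDist_le_norm_sub (G := G) x x'
    have h3 := hδB y hy
    linarith
  rw [← integral_sub (h.integrable_mul hB.measurableSet (by positivity) hx'B hf hfB)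
    (h.integrable_mul hB.measurableSet hδ hδB hf hfB), ← integral_const_mul]
  refine norm_integral_le_of_norm_le (hf.norm.const_mul _) ?_
  filter_upwards [hfB] with y hy
  by_cases hyB : y ∈ B
  · rw [← sub_mul, norm_mul, norm_sub_rev]
    exact mul_le_mul_of_nonneg_right (h.norm_sub_left_le hδ (hδB y hyB) hx'.le) (norm_nonneg _)
  · simp [hy hyB]

theorem integrable_prod [Finite G] (h : KernelBounds G K C ε) {A B : Set 𝔼}
    (hA : IsCompact A) (hB : IsCompact B) (hAB : ∀ x ∈ A, ∀ y ∈ B, orbitDist G x y ≠ 0)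
    {f g : 𝔼 → 𝕜} (hf : Integrable f) (hfB : ∀ᵐ y, y ∉ B → f y = 0)
    (hg : Integrable g) (hgA : ∀ᵐ x, x ∉ A → g x = 0) :
    Integrable (fun z : 𝔼 × 𝔼 => K z.1 z.2 * f z.2 * g z.1) (volume.prod volume) := by
  have hsub : A ×ˢ B ⊆ {z : 𝔼 × 𝔼 | orbitDist G z.1 z.2 ≠ 0} :=
    fun z hz => hAB z.1 hz.1 z.2 hz.2
  have hm : MeasurableSet (A ×ˢ B) := hA.measurableSet.prod hB.measurableSet
  have hcont := h.continuousOn_uncurry.mono hsub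
  obtain ⟨M, hM⟩ := (hA.prod hB).exists_bound_of_continuousOn hcont
  have h1 : AEStronglyMeasurable ((A ×ˢ B).indicator fun z : 𝔼 × 𝔼 => K z.1 z.2)
      (volume.prod volume) :=
    (aestronglyMeasurable_indicator_iff hm).2 (hcont.aestronglyMeasurable hm)
  have h2 : Integrable (fun z : 𝔼 × 𝔼 => g z.1 * f z.2) (volume.prod volume) := hg.mul_prod hf
  have h3 := h2.bdd_mul (c := max M 0) h1 (Eventually.of_forall fun z => by
    by_cases hz : z ∈ A ×ˢ B
    · rw [Set.indicator_of_mem hz]; exact (hM z hz).trans (le_max_left _ _)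
    · rw [Set.indicator_of_notMem hz, norm_zero]; exact le_max_right _ _)
  refine h3.congr ?_
  filter_upwards [Measure.quasiMeasurePreserving_fst.ae hgA,
    Measure.quasiMeasurePreserving_snd.ae hfB] with z hz1 hz2
  by_cases h4 : z.1 ∈ A
  · by_cases h5 : z.2 ∈ B
    · rw [Set.indicator_of_mem (Set.mem_prod.2 ⟨h4, h5⟩)]; ring
    · rw [hz2 h5]; ring
  · rw [hz1 h4]; ring

/-- The potential of a function of mean zero supported in a ball, away from the ball. -/
theorem norm_potential_le_of_integral_eq_zero [Finite G] (h : KernelBounds G K C ε) {x x₀ : 𝔼}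
    {r : ℝ} (hr : 0 < r) (hx : 2 * r ≤ orbitDist G x x₀) {b : 𝔼 → 𝕜} (hb : Integrable b)
    (hbB : ∀ᵐ y, y ∉ Metric.closedBall x₀ r → b y = 0) (hb0 : ∫ y, b y = 0) :
    ‖∫ y, K x y * b y‖ ≤ C * r ^ ε * (1 / orbitDist G x x₀ ^ (N + ε)) * ∫ y, ‖b y‖ := by
  have hε := h.pos
  have hpos : 0 < orbitDist G x x₀ := by linarith
  have hball : ∀ y ∈ Metric.closedBall x₀ r, orbitDist G x₀ y ≤ r := fun y hy => by
    rw [Metric.mem_closedBall, dist_comm, dist_eq_norm] at hy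
    exact (orbitDist_le_norm_sub _ _).trans hy
  have hK : Integrable (fun y => K x y * b y) := by
    refine h.integrable_mul measurableSet_closedBall hr (fun y hy => ?_) hb hbB
    have h1 := orbitDist_triangle (G := G) x y x₀
    rw [orbitDist_comm y x₀] at h1
    have := hball y hy
    linarith
  -- The mean of b is zero, so K(x,x₀) may be subtracted from the kernel; this produces the extra
  -- decay of order ε.
  have e : ∫ y, K x y * b y = ∫ y, (K x y * b y - K x x₀ * b y) := by
    rw [integral_sub hK (hb.const_mul _), integral_const_mul, hb0, mul_zero, sub_zero]
  rw [e, ← integral_const_mul]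
  refine norm_integral_le_of_norm_le (hb.norm.const_mul _) ?_
  filter_upwards [hbB] with y hy
  by_cases hyB : y ∈ Metric.closedBall x₀ r
  · rw [← sub_mul, norm_mul, norm_sub_rev]
    refine mul_le_mul_of_nonneg_right ?_ (norm_nonneg _)
    have h1 := hball y hyB
    have h2 : 0 ≤ orbitDist G x₀ y := orbitDist_nonneg G _ _
    refine (h.smooth_right x x₀ y hpos.ne' (by linarith)).trans ?_
    rw [mul_assoc, mul_one_div]
    refine mul_le_mul_of_nonneg_left ?_ h.nonneg
    gcongr
  · simp [hy hyB]

end KernelBounds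

/-! ### Operators on `L²` with a singular kernel -/

/-- `T'` is the transpose of `T` for the bilinear pairing `∫ f g`. -/
def IsTranspose (T T' : Lp 𝕜 2 (volume : Measure (EuclideanSpace ℝ (Fin N))) →L[𝕜]
    Lp 𝕜 2 (volume : Measure (EuclideanSpace ℝ (Fin N)))) : Prop :=
  ∀ u v : Lp 𝕜 2 (volume : Measure (EuclideanSpace ℝ (Fin N))),
    ∫ x, T u x * v x = ∫ x, u x * T' v x

theorem IsTranspose.symm {T T' : Lp 𝕜 2 (volume : Measure 𝔼) →L[𝕜] Lp 𝕜 2 (volume : Measure 𝔼)}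
    (h : IsTranspose T T') : IsTranspose T' T := fun u v => by
  have := h v u
  simp_rw [mul_comm (v _), mul_comm (u _)] at this ⊢
  rw [this]

theorem norm_star_Lp {p : ℝ≥0∞} (f : Lp 𝕜 p (volume : Measure 𝔼)) : ‖star f‖ = ‖f‖ := by
  rw [Lp.norm_def, Lp.norm_def]
  congr 1
  refine eLpNorm_congr_norm_ae ?_
  filter_upwards [Lp.coeFn_star f] with x hx
  rw [hx]
  simp

/-- The transpose is g ↦ conj(T*(conj g)). The bilinear pairing is used instead of the inner product
so that the transposed kernel is K(y,x), without a conjugation. -/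
theorem exists_isTranspose (T : Lp 𝕜 2 (volume : Measure 𝔼) →L[𝕜] Lp 𝕜 2 (volume : Measure 𝔼)) :
    ∃ T', IsTranspose T T' := by
  have star_add' : ∀ f g : Lp 𝕜 2 (volume : Measure 𝔼), star (f + g) = star f + star g := by
    intro f g
    refine Lp.ext ?_
    filter_upwards [Lp.coeFn_star f, Lp.coeFn_star g, Lp.coeFn_star (f + g), Lp.coeFn_add f g,
      Lp.coeFn_add (star f) (star g)] with x h1 h2 h3 h4 h5
    simp only [h1, h2, h3, h4, h5, Pi.add_apply, Pi.star_apply, star_add]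
  have star_smul' : ∀ (c : 𝕜) (f : Lp 𝕜 2 (volume : Measure 𝔼)),
      star (c • f) = (star c) • star f := by
    intro c f
    refine Lp.ext ?_
    filter_upwards [Lp.coeFn_star f, Lp.coeFn_star (c • f), Lp.coeFn_smul c f,
      Lp.coeFn_smul (star c) (star f)] with x h1 h2 h3 h4
    simp only [h1, h2, h3, h4, Pi.smul_apply, Pi.star_apply, smul_eq_mul, star_mul']
  obtain ⟨Ta, hTa⟩ : ∃ Ta : Lp 𝕜 2 (volume : Measure 𝔼) →L[𝕜] Lp 𝕜 2 (volume : Measure 𝔼),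
      ∀ u w, inner 𝕜 (Ta w) u = inner 𝕜 w (T u) :=
    ⟨ContinuousLinearMap.adjoint T, fun u w => ContinuousLinearMap.adjoint_inner_left T u w⟩
  let A : Lp 𝕜 2 (volume : Measure 𝔼) →ₗ[𝕜] Lp 𝕜 2 (volume : Measure 𝔼) :=
    { toFun := fun g => star (Ta (star g))
      map_add' := fun f g => by rw [star_add', Ta.map_add, star_add']
      map_smul' := fun c f => by
        rw [star_smul', Ta.map_smul, star_smul', star_star, RingHom.id_apply] }
  have hbound : ∀ g, ‖A g‖ ≤ ‖Ta‖ * ‖g‖ := by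
    intro g
    have h1 := Ta.le_opNorm (star g)
    rw [norm_star_Lp] at h1
    exact (norm_star_Lp (Ta (star g))).trans_le h1
  refine ⟨A.mkContinuous _ hbound, fun u v => ?_⟩
  · have hA : A v =ᵐ[volume] star (Ta (star v)) :=
      Lp.coeFn_star (Ta (star v))
    have hv : (star v : Lp 𝕜 2 (volume : Measure 𝔼)) =ᵐ[volume] star v := Lp.coeFn_star v
    generalize (star v : Lp 𝕜 2 (volume : Measure 𝔼)) = w at hA hv
    have key := hTa u w
    rw [L2.inner_def, L2.inner_def] at key
    have e1 : ∫ x, T u x * v x = ∫ x, inner 𝕜 (w x) (T u x) := by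
      refine integral_congr_ae ?_
      filter_upwards [hv] with x hx
      rw [hx, RCLike.inner_apply]
      simp
    have e2 : ∫ x, inner 𝕜 (Ta w x) (u x) = ∫ x, u x * A v x := by
      refine integral_congr_ae ?_
      filter_upwards [hA] with x hx
      rw [hx, RCLike.inner_apply]
      simp
    rw [e1, ← key, e2]
    rfl

/-- `T` is given by the kernel `K` off the orbit of the support. -/
def HasKernel (G : Subgroup (EuclideanSpace ℝ (Fin N) ≃ₗᵢ[ℝ] EuclideanSpace ℝ (Fin N)))
    (T : Lp 𝕜 2 (volume : Measure (EuclideanSpace ℝ (Fin N))) →L[𝕜]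
      Lp 𝕜 2 (volume : Measure (EuclideanSpace ℝ (Fin N))))
    (K : EuclideanSpace ℝ (Fin N) → EuclideanSpace ℝ (Fin N) → 𝕜) : Prop :=
  ∀ (f : Lp 𝕜 2 (volume : Measure (EuclideanSpace ℝ (Fin N)))) (B : Set (EuclideanSpace ℝ (Fin N))),
    IsCompact B → (∀ᵐ y, y ∉ B → f y = 0) →
    ∀ᵐ x, (∀ y ∈ B, orbitDist G x y ≠ 0) → T f x = ∫ y, K x y * f y

/-- `T` is given by the kernel `K` on pairs of smooth functions with separated orbits. -/
def HasSmoothKernel (G : Subgroup (EuclideanSpace ℝ (Fin N) ≃ₗᵢ[ℝ] EuclideanSpace ℝ (Fin N)))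
    (T : Lp 𝕜 2 (volume : Measure (EuclideanSpace ℝ (Fin N))) →L[𝕜]
      Lp 𝕜 2 (volume : Measure (EuclideanSpace ℝ (Fin N))))
    (K : EuclideanSpace ℝ (Fin N) → EuclideanSpace ℝ (Fin N) → 𝕜) : Prop :=
  ∀ φ ψ : EuclideanSpace ℝ (Fin N) → ℝ,
    ContDiff ℝ ((⊤ : ℕ∞) : WithTop ℕ∞) φ → ContDiff ℝ ((⊤ : ℕ∞) : WithTop ℕ∞) ψ →
    HasCompactSupport φ → HasCompactSupport ψ →
    (∀ x ∈ tsupport ψ, ∀ y ∈ tsupport φ, orbitDist G x y ≠ 0) →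
    ∀ u v : Lp 𝕜 2 (volume : Measure (EuclideanSpace ℝ (Fin N))),
      u =ᵐ[volume] (fun y => (φ y : 𝕜)) → v =ᵐ[volume] (fun y => (ψ y : 𝕜)) →
      ∫ x, T u x * v x = ∫ x, ∫ y, K x y * (φ y : 𝕜) * (ψ x : 𝕜)

/-! ### From the kernel on smooth test functions to the kernel on compactly supported `L²` functions
-/

theorem integrable_ofReal_of_contDiff {φ : 𝔼 → ℝ}
    (h : ContDiff ℝ ((⊤ : ℕ∞) : WithTop ℕ∞) φ) (hc : HasCompactSupport φ) :
    Integrable (fun y => (φ y : 𝕜)) := by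
  have h1 : Integrable φ := h.continuous.integrable_of_hasCompactSupport hc
  exact h1.ofReal

theorem memLp_ofReal_of_contDiff {φ : 𝔼 → ℝ}
    (h : ContDiff ℝ ((⊤ : ℕ∞) : WithTop ℕ∞) φ) (hc : HasCompactSupport φ) (p : ℝ≥0∞) :
    MemLp (fun y => (φ y : 𝕜)) p := by
  have h1 : MemLp φ p volume := h.continuous.memLp_of_hasCompactSupport hc
  exact h1.ofReal

theorem ofReal_eq_zero_of_notMem_tsupport {φ : 𝔼 → ℝ} {y : 𝔼} (hy : y ∉ tsupport φ) :
    (φ y : 𝕜) = 0 := by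
  rw [image_eq_zero_of_notMem_tsupport hy, RCLike.ofReal_zero]

theorem HasSmoothKernel.transpose [Finite G] {K : 𝔼 → 𝔼 → 𝕜} {C ε : ℝ}
    (hK : KernelBounds G K C ε)
    {T T' : Lp 𝕜 2 (volume : Measure 𝔼) →L[𝕜] Lp 𝕜 2 (volume : Measure 𝔼)}
    (h : HasSmoothKernel G T K) (hT : IsTranspose T T') :
    HasSmoothKernel G T' (fun x y => K y x) := by
  intro φ ψ hφ hψ hφc hψc hsep u v hu hv
  have h1 := h ψ φ hψ hφ hψc hφc (fun x hx y hy => by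
    rw [orbitDist_comm]; exact hsep y hy x hx) v u hv hu
  calc ∫ x, T' u x * v x = ∫ x, v x * T' u x := by simp_rw [mul_comm]
    _ = ∫ x, ∫ y, K x y * (ψ y : 𝕜) * (φ x : 𝕜) := by rw [← hT v u, h1]
    _ = ∫ y, ∫ x, K x y * (ψ y : 𝕜) * (φ x : 𝕜) := by
        refine integral_integral_swap ?_
        exact hK.integrable_prod hφc hψc (fun x hx y hy => by
          rw [orbitDist_comm]; exact hsep y hy x hx)
          (integrable_ofReal_of_contDiff hψ hψc)
          (Eventually.of_forall fun y => ofReal_eq_zero_of_notMem_tsupport)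
          (integrable_ofReal_of_contDiff hφ hφc)
          (Eventually.of_forall fun y => ofReal_eq_zero_of_notMem_tsupport)
    _ = _ := by
        refine integral_congr_ae (Eventually.of_forall fun x => ?_)
        refine integral_congr_ae (Eventually.of_forall fun y => ?_)
        simp only
        ring

theorem integrable_mul_L2 (u v : Lp 𝕜 2 (volume : Measure 𝔼)) :
    Integrable (fun x => u x * v x) := (Lp.memLp u).integrable_mul (Lp.memLp v)

theorem locallyIntegrable_L2 (u : Lp 𝕜 2 (volume : Measure 𝔼)) :
    LocallyIntegrable (fun x => u x) :=
  (Lp.memLp u).locallyIntegrable (by norm_num)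

/-- Off the orbits of the support both sides are locally integrable and have the same integrals
against smooth test functions supported there; hence they agree almost everywhere. -/
theorem HasSmoothKernel.apply_smooth [Finite G] {K : 𝔼 → 𝔼 → 𝕜} {C ε : ℝ}
    (hK : KernelBounds G K C ε)
    {T : Lp 𝕜 2 (volume : Measure 𝔼) →L[𝕜] Lp 𝕜 2 (volume : Measure 𝔼)}
    (h : HasSmoothKernel G T K) {φ : 𝔼 → ℝ} (hφ : ContDiff ℝ ((⊤ : ℕ∞) : WithTop ℕ∞) φ)
    (hφc : HasCompactSupport φ) {u : Lp 𝕜 2 (volume : Measure 𝔼)}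
    (hu : u =ᵐ[volume] (fun y => (φ y : 𝕜))) :
    ∀ᵐ x, (∀ y ∈ tsupport φ, orbitDist G x y ≠ 0) → T u x = ∫ y, K x y * (φ y : 𝕜) := by
  have hU := isOpen_forall_orbitDist_ne (G := G) hφc
  set U : Set 𝔼 := {x : 𝔼 | ∀ y ∈ tsupport φ, orbitDist G x y ≠ 0} with hUdef
  have hpot := hK.continuousOn_potential hφc (integrable_ofReal_of_contDiff hφ hφc)
    (Eventually.of_forall fun y => ofReal_eq_zero_of_notMem_tsupport)
  have hloc : LocallyIntegrableOn (fun x => T u x - ∫ y, K x y * (φ y : 𝕜)) U volume :=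
    ((locallyIntegrable_L2 (T u)).locallyIntegrableOn U).sub
      (hpot.locallyIntegrableOn hU.measurableSet)
  have key := hU.ae_eq_zero_of_integral_contDiff_smul_eq_zero hloc ?_
  · filter_upwards [key] with x hx hxU
    exact sub_eq_zero.1 (hx hxU)
  intro ψ hψ hψc hψU
  have hv := MemLp.coeFn_toLp (memLp_ofReal_of_contDiff (𝕜 := 𝕜) hψ hψc 2)
  set v := (memLp_ofReal_of_contDiff (𝕜 := 𝕜) hψ hψc 2).toLp with hvdef
  have h1 := h φ ψ hφ hψ hφc hψc (fun x hx => hψU hx) u v hu hv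
  have hint : Integrable (fun z : 𝔼 × 𝔼 => K z.1 z.2 * (φ z.2 : 𝕜) * (ψ z.1 : 𝕜))
      (volume.prod volume) :=
    hK.integrable_prod hψc hφc (fun x hx => hψU hx) (integrable_ofReal_of_contDiff hφ hφc)
      (Eventually.of_forall fun y => ofReal_eq_zero_of_notMem_tsupport)
      (integrable_ofReal_of_contDiff hψ hψc)
      (Eventually.of_forall fun y => ofReal_eq_zero_of_notMem_tsupport)
  have hint' : Integrable (fun x => (∫ y, K x y * (φ y : 𝕜)) * (ψ x : 𝕜)) := by
    have := hint.integral_prod_left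
    simpa only [integral_mul_const] using this
  have hTv : Integrable (fun x => T u x * (ψ x : 𝕜)) := by
    refine (integrable_mul_L2 (T u) v).congr ?_
    filter_upwards [hv] with x hx
    rw [hx]
  calc ∫ x, ψ x • (T u x - ∫ y, K x y * (φ y : 𝕜))
      = ∫ x, (T u x * (ψ x : 𝕜) - (∫ y, K x y * (φ y : 𝕜)) * (ψ x : 𝕜)) := by
        refine integral_congr_ae (Eventually.of_forall fun x => ?_)
        simp only [RCLike.real_smul_eq_coe_mul]
        ring
    _ = 0 := by
        rw [integral_sub hTv hint', sub_eq_zero]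
        calc ∫ x, T u x * (ψ x : 𝕜) = ∫ x, T u x * v x := by
              refine integral_congr_ae ?_
              filter_upwards [hv] with x hx
              rw [hx]
          _ = _ := by
              rw [h1]
              simp only [integral_mul_const]

theorem integrable_of_compact_support {u : Lp 𝕜 2 (volume : Measure 𝔼)} {B : Set 𝔼}
    (hB : IsCompact B) (hu : ∀ᵐ y, y ∉ B → u y = 0) : Integrable (fun x => u x) := by
  have h1 : IntegrableOn (fun x => u x) B :=
    (locallyIntegrable_L2 u).integrableOn_isCompact hB
  refine ((integrable_indicator_iff hB.measurableSet).2 h1).congr ?_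
  filter_upwards [hu] with x hx
  by_cases hxB : x ∈ B
  · simp [hxB]
  · simp [hxB, hx hxB]

/-- For g in `L²` with compact support and φ smooth, ∫ φ T'g = ∫ (Tφ) g. Here Tφ is already known
pointwise on the set carrying g, and Fubini moves the kernel to g. Passing to the transpose is what
removes the smoothness of the argument. -/
theorem HasSmoothKernel.hasKernel_transpose [Finite G] {K : 𝔼 → 𝔼 → 𝕜} {C ε : ℝ}
    (hK : KernelBounds G K C ε)
    {T T' : Lp 𝕜 2 (volume : Measure 𝔼) →L[𝕜] Lp 𝕜 2 (volume : Measure 𝔼)}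
    (h : HasSmoothKernel G T K) (hT : IsTranspose T T') :
    HasKernel G T' (fun x y => K y x) := by
  intro g B hB hgB
  have hg := integrable_of_compact_support hB hgB
  have hU := isOpen_forall_orbitDist_ne (G := G) hB
  set U : Set 𝔼 := {x : 𝔼 | ∀ y ∈ B, orbitDist G x y ≠ 0} with hUdef
  have hpot := hK.swap.continuousOn_potential hB hg hgB
  have hloc : LocallyIntegrableOn (fun y => T' g y - ∫ x, K x y * g x) U volume :=
    ((locallyIntegrable_L2 (T' g)).locallyIntegrableOn U).sub
      (hpot.locallyIntegrableOn hU.measurableSet)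
  have key := hU.ae_eq_zero_of_integral_contDiff_smul_eq_zero hloc ?_
  · filter_upwards [key] with x hx hxU
    exact sub_eq_zero.1 (hx hxU)
  intro φ hφ hφc hφU
  have hv := MemLp.coeFn_toLp (memLp_ofReal_of_contDiff (𝕜 := 𝕜) hφ hφc 2)
  set v := (memLp_ofReal_of_contDiff (𝕜 := 𝕜) hφ hφc 2).toLp with hvdef
  have h1 := h.apply_smooth hK hφ hφc hv
  have hsep : ∀ x ∈ B, ∀ y ∈ tsupport φ, orbitDist G x y ≠ 0 := fun x hx y hy => by
    rw [orbitDist_comm]; exact hφU hy x hx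
  have hint : Integrable (fun z : 𝔼 × 𝔼 => K z.1 z.2 * (φ z.2 : 𝕜) * g z.1)
      (volume.prod volume) :=
    hK.integrable_prod hB hφc hsep (integrable_ofReal_of_contDiff hφ hφc)
      (Eventually.of_forall fun y => ofReal_eq_zero_of_notMem_tsupport) hg hgB
  have hswap := integral_integral_swap (f := fun x y => K x y * (φ y : 𝕜) * g x) hint
  have hint2 : Integrable (fun y => (φ y : 𝕜) * ∫ x, K x y * g x) := by
    have := hint.integral_prod_right
    refine this.congr (Eventually.of_forall fun y => ?_)
    simp only
    rw [← integral_const_mul]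
    congr 1
    ext x
    ring
  have hTv : Integrable (fun y => (φ y : 𝕜) * T' g y) := by
    refine (integrable_mul_L2 v (T' g)).congr ?_
    filter_upwards [hv] with x hx
    rw [hx]
  calc ∫ y, φ y • (T' g y - ∫ x, K x y * g x)
      = ∫ y, ((φ y : 𝕜) * T' g y - (φ y : 𝕜) * ∫ x, K x y * g x) := by
        refine integral_congr_ae (Eventually.of_forall fun x => ?_)
        simp only [RCLike.real_smul_eq_coe_mul]
        ring
    _ = 0 := by
        rw [integral_sub hTv hint2, sub_eq_zero]
        calc ∫ y, (φ y : 𝕜) * T' g y = ∫ y, v y * T' g y := by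
              refine integral_congr_ae ?_
              filter_upwards [hv] with x hx
              rw [hx]
          _ = ∫ x, T v x * g x := (hT v g).symm
          _ = ∫ x, ∫ y, K x y * (φ y : 𝕜) * g x := by
              refine integral_congr_ae ?_
              filter_upwards [h1, hgB] with x hx hxB
              rw [integral_mul_const]
              by_cases hx' : x ∈ B
              · rw [hx (hsep x hx')]
              · rw [hxB hx', mul_zero, mul_zero]
          _ = ∫ y, ∫ x, K x y * (φ y : 𝕜) * g x := hswap
          _ = _ := by
              refine integral_congr_ae (Eventually.of_forall fun y => ?_)
              simp only
              rw [← integral_const_mul]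
              congr 1
              ext x
              ring

/-- The previous argument is applied to the transpose, whose transpose is T again. -/
theorem HasSmoothKernel.hasKernel [Finite G] {K : 𝔼 → 𝔼 → 𝕜} {C ε : ℝ}
    (hK : KernelBounds G K C ε)
    {T : Lp 𝕜 2 (volume : Measure 𝔼) →L[𝕜] Lp 𝕜 2 (volume : Measure 𝔼)}
    (h : HasSmoothKernel G T K) : HasKernel G T K := by
  obtain ⟨T', hT'⟩ := exists_isTranspose T
  exact (h.transpose hK hT').hasKernel_transpose hK.swap hT'.symm

/-! ### The Calderón–Zygmund decomposition -/

/-- Vitali's covering lemma after a reduction to finitely many balls by compactness. The balls need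
not be centred at the points that index them, as required for the uncentred maximal function. -/
theorem exists_finset_pairwiseDisjoint_closedBall {A : Set 𝔼} (hA : IsCompact A) (c : 𝔼 → 𝔼)
    (r : 𝔼 → ℝ) (hc : ∀ x ∈ A, x ∈ Metric.ball (c x) (r x)) :
    ∃ s : Finset 𝔼, ↑s ⊆ A ∧
      ((s : Set 𝔼).PairwiseDisjoint fun x => Metric.closedBall (c x) (r x)) ∧
      A ⊆ ⋃ x ∈ s, Metric.closedBall (c x) (5 * r x) := by
  obtain ⟨s₀, hcov⟩ := hA.elim_nhds_subcover' (fun x _ => Metric.ball (c x) (r x))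
    (fun x hx => Metric.isOpen_ball.mem_nhds (hc x hx))
  classical
  set s₁ : Finset 𝔼 := s₀.image Subtype.val with hs₁
  have hs₁A : ∀ x ∈ s₁, x ∈ A := by
    intro x hx
    obtain ⟨y, -, rfl⟩ := Finset.mem_image.1 hx
    exact y.2
  obtain ⟨R, hR⟩ : ∃ R, ∀ x ∈ (s₁ : Set 𝔼), r x ≤ R := by
    obtain ⟨R, hR⟩ := (s₁.finite_toSet.image r).bddAbove
    exact ⟨R, fun x hx => hR (Set.mem_image_of_mem r hx)⟩
  obtain ⟨u, hu, hdisj, hu'⟩ := Vitali.exists_disjoint_subfamily_covering_enlargement_closedBall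
    (s₁ : Set 𝔼) c r R hR 5 (by norm_num)
  have hufin : u.Finite := s₁.finite_toSet.subset hu
  refine ⟨hufin.toFinset, ?_, by simpa using hdisj, ?_⟩
  · intro x hx
    exact hs₁A x (hu (by simpa using hx))
  · intro x hx
    obtain ⟨y, hy, hxy⟩ := Set.mem_iUnion₂.1 (hcov hx)
    obtain ⟨z, hz, hyz⟩ := hu' y.1 (by simp only [hs₁, Finset.coe_image]; exact ⟨y, hy, rfl⟩)
    exact Set.mem_iUnion₂.2 ⟨z, by simpa using hz, hyz (Metric.ball_subset_closedBall hxy)⟩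

/-- The set where the maximal function of `F` exceeds `t`. -/
def maximalSet (F : EuclideanSpace ℝ (Fin N) → ℝ≥0∞) (t : ℝ≥0∞) :
    Set (EuclideanSpace ℝ (Fin N)) :=
  {x | ∃ (y : EuclideanSpace ℝ (Fin N)) (r : ℝ), x ∈ Metric.ball y r ∧
    t * volume (Metric.closedBall y r) < ∫⁻ z in Metric.closedBall y r, F z}

theorem isOpen_maximalSet (F : 𝔼 → ℝ≥0∞) (t : ℝ≥0∞) : IsOpen (maximalSet F t) := by
  have : maximalSet F t = ⋃ (y : 𝔼) (r : ℝ)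
      (_ : t * volume (Metric.closedBall y r) < ∫⁻ z in Metric.closedBall y r, F z),
      Metric.ball y r := by
    ext x
    simp only [maximalSet, Set.mem_ofPred_eq, Set.mem_iUnion, exists_prop]
    exact exists₂_congr fun _ _ => and_comm
  rw [this]
  exact isOpen_iUnion fun _ => isOpen_iUnion fun _ => isOpen_iUnion fun _ => Metric.isOpen_ball

/-- Weak type (1,1) of the maximal function. By inner regularity it suffices to bound compact
subsets; a finite disjoint Vitali family costs the factor 5^N, and on its balls the integral of F
exceeds t times the volume. -/
theorem volume_maximalSet_le (F : 𝔼 → ℝ≥0∞) {t : ℝ≥0∞} (ht : t ≠ 0) (ht' : t ≠ ∞) :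
    volume (maximalSet F t) ≤ ENNReal.ofReal (5 ^ N) * ((∫⁻ x, F x) / t) := by
  rw [(isOpen_maximalSet F t).measure_eq_iSup_isCompact]
  refine iSup₂_le fun A hAsub => iSup_le fun hA => ?_
  choose! c r hcr hlt using (fun x (hx : x ∈ A) => hAsub hx)
  obtain ⟨s, hsA, hdisj, hcov⟩ := exists_finset_pairwiseDisjoint_closedBall hA c r hcr
  calc volume A ≤ volume (⋃ x ∈ s, Metric.closedBall (c x) (5 * r x)) := measure_mono hcov
    _ ≤ ∑ x ∈ s, volume (Metric.closedBall (c x) (5 * r x)) := measure_biUnion_finset_le _ _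
    _ ≤ ∑ x ∈ s, ENNReal.ofReal (5 ^ N) * ((∫⁻ z in Metric.closedBall (c x) (r x), F z) / t) := by
        refine Finset.sum_le_sum fun x hx => ?_
        have hr : 0 ≤ r x := (Metric.pos_of_mem_ball (hcr x (hsA hx))).le
        rw [volume_closedBall_mul (c x) (c x) hr (by norm_num)]
        refine mul_le_mul_right ?_ _
        rw [ENNReal.le_div_iff_mul_le (Or.inl ht) (Or.inl ht'), mul_comm]
        exact (hlt x (hsA hx)).le
    _ = ENNReal.ofReal (5 ^ N) * ((∑ x ∈ s, ∫⁻ z in Metric.closedBall (c x) (r x), F z) / t) := by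
        simp_rw [div_eq_mul_inv]
        rw [Finset.sum_mul, Finset.mul_sum]
    _ ≤ _ := by
        rw [← lintegral_biUnion_finset hdisj (fun x _ => measurableSet_closedBall)]
        gcongr
        exact Measure.restrict_le_self

/-- Lebesgue differentiation: off the set, the means of F over all balls centred at x are at most t,
and almost everywhere they converge to F(x). -/
theorem ae_le_of_notMem_maximalSet {F : 𝔼 → ℝ≥0∞} (hF : AEMeasurable F)
    (hF' : ∫⁻ x, F x ≠ ∞) (t : ℝ≥0∞) : ∀ᵐ x, x ∉ maximalSet F t → F x ≤ t := by
  have h := (IsUnifLocDoublingMeasure.vitaliFamily (volume : Measure 𝔼) 1).ae_tendsto_lintegral_div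
    hF hF'
  filter_upwards [h] with x hx hxt
  have hlim : Tendsto (fun n : ℕ => 1 / ((n : ℝ) + 1)) atTop (𝓝[>] 0) :=
    tendsto_nhdsWithin_iff.2 ⟨tendsto_one_div_add_atTop_nhds_zero_nat,
      Eventually.of_forall fun n => by simp only [Set.mem_Ioi]; positivity⟩
  have h2 := hx.comp (IsUnifLocDoublingMeasure.tendsto_closedBall_filterAt
    (volume : Measure 𝔼) (K := 1) (fun _ : ℕ => x) (fun n : ℕ => 1 / ((n : ℝ) + 1)) hlim
    (Eventually.of_forall fun n => Metric.mem_closedBall_self (by positivity)))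
  refine le_of_tendsto h2 (Eventually.of_forall fun n => ?_)
  simp only [Function.comp]
  have hn : 0 < 1 / ((n : ℝ) + 1) := by positivity
  refine ENNReal.div_le_of_le_mul ?_
  by_contra! hlt
  exact hxt ⟨x, _, Metric.mem_ball_self hn, hlt⟩

/-- A measurable partition of unity subordinate to finitely many sets. -/
theorem exists_weights {ι : Type*} (s : Finset ι) (A : ι → Set 𝔼)
    (hA : ∀ j ∈ s, MeasurableSet (A j)) :
    ∃ w : ι → 𝔼 → ℝ, (∀ j ∈ s, Measurable (w j)) ∧ (∀ j x, 0 ≤ w j x) ∧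
      (∀ j ∈ s, ∀ x, w j x ≤ 1) ∧
      (∀ j x, x ∉ A j → w j x = 0) ∧
      (∀ x, x ∈ ⋃ j ∈ s, A j → ∑ j ∈ s, w j x = 1) ∧
      (∀ x, x ∉ ⋃ j ∈ s, A j → ∑ j ∈ s, w j x = 0) := by
  set n : 𝔼 → ℝ := fun x => ∑ i ∈ s, (A i).indicator 1 x with hn
  have hn0 : ∀ x, 0 ≤ n x := fun x =>
    Finset.sum_nonneg fun i _ => Set.indicator_nonneg (fun _ _ => zero_le_one) x
  have h01 : ∀ j x, 0 ≤ (A j).indicator (1 : 𝔼 → ℝ) x := fun j x =>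
    Set.indicator_nonneg (fun _ _ => zero_le_one) x
  have hle : ∀ j ∈ s, ∀ x, (A j).indicator (1 : 𝔼 → ℝ) x ≤ n x := fun j hj x =>
    Finset.single_le_sum (f := fun i => (A i).indicator (1 : 𝔼 → ℝ) x) (fun i _ => h01 i x) hj
  refine ⟨fun j x => (A j).indicator 1 x * (n x)⁻¹, fun j hj => ?_, fun j x => ?_,
    fun j hj x => ?_, fun j x hx => ?_, fun x hx => ?_, fun x hx => ?_⟩
  · have h1 : Measurable n := Finset.measurable_sum s fun i hi => measurable_one.indicator (hA i hi)
    exact (measurable_one.indicator (hA j hj)).mul h1.inv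
  · exact mul_nonneg (h01 j x) (inv_nonneg.2 (hn0 x))
  · exact mul_inv_le_one_of_le₀ (hle j hj x) (hn0 x)
  · simp [hx]
  · rw [← Finset.sum_mul]
    obtain ⟨j, hj, hxj⟩ := Set.mem_iUnion₂.1 hx
    have : 1 ≤ n x := by simpa [hxj] using hle j hj x
    exact mul_inv_cancel₀ (by positivity : n x ≠ 0)
  · refine Finset.sum_eq_zero fun j hj => ?_
    have : x ∉ A j := fun h => hx (Set.mem_iUnion₂.2 ⟨j, hj, h⟩)
    simp [this]

theorem volume_univ_eq_top (hN : 1 ≤ N) : volume (Set.univ : Set 𝔼) = ∞ := by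
  have : Nonempty (Fin N) := ⟨⟨0, hN⟩⟩
  have : Nontrivial 𝔼 := inferInstance
  exact measure_univ_of_isAddLeftInvariant _

/-- Finitely many Whitney balls exhausting an open set of finite measure up to a small set. -/
theorem exists_finset_whitney_balls (hN : 1 ≤ N) {Ω : Set 𝔼} (hΩ : IsOpen Ω)
    (hΩfin : volume Ω ≠ ∞) {δ : ℝ≥0∞} (hδ : δ ≠ 0) :
    ∃ (s : Finset 𝔼) (ρ : 𝔼 → ℝ), (∀ j ∈ s, 0 < ρ j) ∧
      ((s : Set 𝔼).PairwiseDisjoint fun j => Metric.closedBall j (ρ j)) ∧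
      (∀ j ∈ s, Metric.closedBall j (5 * ρ j) ⊆ Ω) ∧
      volume (Ω \ ⋃ j ∈ s, Metric.closedBall j (5 * ρ j)) < δ ∧
      ∀ j ∈ s, ∃ p ∈ Metric.ball j (20 * ρ j), p ∉ Ω := by
  have hne : (Ωᶜ).Nonempty := by
    rw [Set.nonempty_compl]
    rintro rfl
    exact hΩfin (volume_univ_eq_top hN)
  obtain ⟨A, hAΩ, hA, hAδ⟩ := hΩ.measurableSet.exists_isCompact_sdiff_lt hΩfin hδ
  -- With a tenth of the distance to the complement, the fivefold ball still lies in Ω, while the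
  -- twentyfold ball reaches beyond Ω.
  set ρ : 𝔼 → ℝ := fun x => Metric.infDist x Ωᶜ / 10 with hρ
  have hpos : ∀ x ∈ Ω, 0 < ρ x := fun x hx => by
    have : 0 < Metric.infDist x Ωᶜ :=
      (hΩ.isClosed_compl.notMem_iff_infDist_pos hne).1 (by simpa using hx)
    simp only [hρ]
    positivity
  obtain ⟨s, hsA, hdisj, hcov⟩ := exists_finset_pairwiseDisjoint_closedBall hA (fun x => x) ρ
    (fun x hx => Metric.mem_ball_self (hpos x (hAΩ hx)))
  refine ⟨s, ρ, fun j hj => hpos j (hAΩ (hsA hj)), hdisj, fun j hj x hx => ?_, ?_,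
    fun j hj => ?_⟩
  · by_contra hxΩ
    have h1 : Metric.infDist j Ωᶜ ≤ dist j x := Metric.infDist_le_dist_of_mem hxΩ
    have h2 := hpos j (hAΩ (hsA hj))
    rw [Metric.mem_closedBall, dist_comm] at hx
    simp only [hρ] at h2 hx
    linarith
  · exact (measure_mono (Set.sdiff_subset_sdiff_right hcov)).trans_lt hAδ
  · have h2 := hpos j (hAΩ (hsA hj))
    have : Metric.infDist j Ωᶜ < 20 * ρ j := by
      simp only [hρ] at h2 ⊢
      linarith
    obtain ⟨p, hp, hjp⟩ := (Metric.infDist_lt_iff hne).1 this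
    exact ⟨p, by rwa [Metric.mem_ball, dist_comm], hp⟩

/-- The maximal set Ω at height t is exhausted by finitely many balls up to a set on which f has
small `L²` norm; that remainder is e. Finiteness keeps the sum of bad pieces inside the domain of an
operator on `L²` without any convergence question. The fivefold balls may overlap without control,
so f is split by a partition of unity, which preserves the total `L¹` norm, and the mean of each
piece is spread as a constant over the small ball. The small balls are disjoint, so these constants
do not accumulate in the good part g. -/
theorem exists_calderonZygmund_decomposition (hN : 1 ≤ N) {f : 𝔼 → 𝕜} (hf1 : Integrable f)
    (hf2 : MemLp f 2) {t : ℝ≥0∞} (ht : t ≠ 0) (ht' : t ≠ ∞) {η : ℝ≥0∞} (hη : η ≠ 0) :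
    ∃ (s : Finset 𝔼) (ρ : 𝔼 → ℝ) (g e : 𝔼 → 𝕜) (b : 𝔼 → 𝔼 → 𝕜),
      (∀ x, f x = g x + e x + ∑ j ∈ s, b j x) ∧ MemLp g 2 ∧ MemLp e 2 ∧
      (∀ j ∈ s, MemLp (b j) 2) ∧ (∀ j ∈ s, Integrable (b j)) ∧ (∀ j ∈ s, 0 < ρ j) ∧
      (∀ j ∈ s, ∀ y ∉ Metric.closedBall j (5 * ρ j), b j y = 0) ∧ (∀ j ∈ s, ∫ y, b j y = 0) ∧
      ∑ j ∈ s, ∫⁻ y, ‖b j y‖ₑ ≤ 2 * ∫⁻ y, ‖f y‖ₑ ∧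
      ∑ j ∈ s, volume (Metric.closedBall j (ρ j)) ≤
        ENNReal.ofReal (5 ^ N) * ((∫⁻ y, ‖f y‖ₑ) / t) ∧
      (∀ᵐ y, ‖g y‖ₑ ≤ ENNReal.ofReal (20 ^ N) * t) ∧
      ∫⁻ y, ‖g y‖ₑ ≤ ∫⁻ y, ‖f y‖ₑ ∧ ∫⁻ y, ‖e y‖ₑ ^ 2 ≤ η := by
  set I : ℝ≥0∞ := ∫⁻ y, ‖f y‖ₑ with hI
  have hIfin : I ≠ ∞ := hf1.2.ne
  set Ω : Set 𝔼 := maximalSet (fun y => ‖f y‖ₑ) t with hΩdef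
  have hΩ : IsOpen Ω := isOpen_maximalSet _ _
  have hΩle : volume Ω ≤ ENNReal.ofReal (5 ^ N) * (I / t) := volume_maximalSet_le _ ht ht'
  have hΩfin : volume Ω ≠ ∞ :=
    ne_top_of_le_ne_top (ENNReal.mul_ne_top ENNReal.ofReal_ne_top (ENNReal.div_ne_top hIfin ht)) hΩle
  have hf2fin : ∫⁻ y, ‖f y‖ₑ ^ 2 ≠ ∞ := by
    have := (lintegral_rpow_enorm_lt_top_of_eLpNorm_lt_top (by norm_num) (by norm_num) hf2.2).ne
    simpa using this
  -- Absolute continuity of the integral of |f|²: this δ is the measure of Ω that may be left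
  -- uncovered.
  obtain ⟨δ, hδ, hδη⟩ := exists_pos_setLIntegral_lt_of_measure_lt hf2fin hη
  obtain ⟨s, ρ, hρ, hdisj, hsub, hvol, hout⟩ := exists_finset_whitney_balls hN hΩ hΩfin hδ.ne'
  set U : Set 𝔼 := ⋃ j ∈ s, Metric.closedBall j (5 * ρ j) with hU
  have hUΩ : U ⊆ Ω := Set.iUnion₂_subset hsub
  have hUm : MeasurableSet U := Finset.measurableSet_biUnion s fun _ _ => measurableSet_closedBall
  obtain ⟨w, hwm, hw0, hw1, hwB, hwU, hwU'⟩ :=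
    exists_weights s (fun j : 𝔼 => Metric.closedBall j (5 * ρ j))
      (fun _ _ => measurableSet_closedBall)
  -- the localized pieces and their integrals
  set φ : 𝔼 → 𝔼 → 𝕜 := fun j y => (w j y : 𝕜) * f y with hφ
  have hφle : ∀ j ∈ s, ∀ y, ‖φ j y‖ ≤ ‖f y‖ := fun j hj y => by
    simp only [hφ, norm_mul, RCLike.norm_ofReal, abs_of_nonneg (hw0 j y)]
    exact mul_le_of_le_one_left (norm_nonneg _) (hw1 j hj y)
  have hφm : ∀ j ∈ s, AEStronglyMeasurable (φ j) := fun j hj =>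
    (RCLike.continuous_ofReal.measurable.comp (hwm j hj)).aestronglyMeasurable.mul hf1.1
  have hφ1 : ∀ j ∈ s, Integrable (φ j) := fun j hj =>
    hf1.mono (hφm j hj) (Eventually.of_forall (hφle j hj))
  have hφ2 : ∀ j ∈ s, MemLp (φ j) 2 := fun j hj =>
    hf2.mono (hφm j hj) (Eventually.of_forall (hφle j hj))
  have hφsum : ∀ y, ∑ j ∈ s, φ j y = U.indicator f y := fun y => by
    simp only [hφ]
    rw [← Finset.sum_mul, ← RCLike.ofReal_sum]
    by_cases hy : y ∈ U
    · rw [hwU y hy, Set.indicator_of_mem hy]; simp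
    · rw [hwU' y hy, Set.indicator_of_notMem hy]; simp
  have hφe : ∀ j y, ‖φ j y‖ₑ = ENNReal.ofReal (w j y) * ‖f y‖ₑ := fun j y => by
    simp only [hφ, enorm_mul]
    congr 1
    rw [← ofReal_norm, RCLike.norm_ofReal, abs_of_nonneg (hw0 j y)]
  have hφI : ∑ j ∈ s, ∫⁻ y, ‖φ j y‖ₑ = ∫⁻ y in U, ‖f y‖ₑ := by
    rw [← lintegral_finsetSum' s fun j hj => (hφm j hj).enorm, ← lintegral_indicator hUm]
    refine lintegral_congr fun y => ?_
    simp only [hφe]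
    rw [← Finset.sum_mul, ← ENNReal.ofReal_sum_of_nonneg fun j _ => hw0 j y]
    by_cases hy : y ∈ U
    · rw [hwU y hy, Set.indicator_of_mem hy]; simp
    · rw [hwU' y hy, Set.indicator_of_notMem hy]; simp
  have hUI : ∫⁻ y in U, ‖f y‖ₑ ≤ I := setLIntegral_le_lintegral _ _
  -- the averages
  set B : 𝔼 → Set 𝔼 := fun j => Metric.closedBall j (ρ j) with hB
  have hBm : ∀ j, MeasurableSet (B j) := fun j => measurableSet_closedBall
  have hBfin : ∀ j, volume (B j) ≠ ∞ := fun j => measure_closedBall_lt_top.ne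
  have hB0 : ∀ j ∈ s, volume (B j) ≠ 0 := fun j hj =>
    (Metric.measure_closedBall_pos volume j (hρ j hj)).ne'
  have hBΩ : ∀ j ∈ s, B j ⊆ Ω := fun j hj =>
    (Metric.closedBall_subset_closedBall (by linarith [hρ j hj])).trans (hsub j hj)
  -- The constant is normalized by the volume of the small ball, although the piece itself lives on
  -- the fivefold ball.
  set c : 𝔼 → 𝕜 := fun j => ((volume.real (B j) : ℝ) : 𝕜)⁻¹ * ∫ y, φ j y with hc
  have hBr : ∀ j ∈ s, ((volume.real (B j) : ℝ) : 𝕜) ≠ 0 := fun j hj => by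
    rw [Ne, RCLike.ofReal_eq_zero, measureReal_eq_zero_iff (hBfin j)]
    exact hB0 j hj
  have hcB : ∀ j ∈ s, ‖c j‖ₑ * volume (B j) ≤ ∫⁻ y, ‖φ j y‖ₑ := fun j hj => by
    have : ‖c j‖ₑ * volume (B j) = ‖∫ y, φ j y‖ₑ := by
      have e1 : volume (B j) = ‖((volume.real (B j) : ℝ) : 𝕜)‖ₑ := by
        rw [← ofReal_norm, RCLike.norm_ofReal, abs_of_nonneg measureReal_nonneg,
          ofReal_measureReal (hBfin j)]
      rw [e1, ← enorm_mul]
      congr 1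
      simp only [hc]
      field_simp [hBr j hj]
    rw [this]
    exact enorm_integral_le_lintegral_enorm _
  have hcle : ∀ j ∈ s, ‖c j‖ₑ ≤ ENNReal.ofReal (20 ^ N) * t := fun j hj => by
    rw [← ENNReal.mul_le_mul_iff_left (hB0 j hj) (hBfin j)]
    -- The twentyfold ball contains a point outside the maximal set, so the mean of |f| over it is
    -- at most t; comparing volumes gives 20^N.
    obtain ⟨p, hp, hpΩ⟩ := hout j hj
    calc ‖c j‖ₑ * volume (B j) ≤ ∫⁻ y, ‖φ j y‖ₑ := hcB j hj
      _ ≤ ∫⁻ y, (Metric.closedBall j (20 * ρ j)).indicator (fun y => ‖f y‖ₑ) y := by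
          refine lintegral_mono fun y => ?_
          by_cases hy : y ∈ Metric.closedBall j (20 * ρ j)
          · rw [Set.indicator_of_mem hy]
            exact enorm_le_iff_norm_le.2 (hφle j hj y)
          · have hy' : y ∉ Metric.closedBall j (5 * ρ j) := fun h =>
              hy (Metric.closedBall_subset_closedBall (by linarith [hρ j hj]) h)
            simp [hφ, hwB j y hy']
      _ = ∫⁻ y in Metric.closedBall j (20 * ρ j), ‖f y‖ₑ :=
          lintegral_indicator measurableSet_closedBall _
      _ ≤ t * volume (Metric.closedBall j (20 * ρ j)) := by
          by_contra! hlt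
          exact hpΩ ⟨j, _, hp, hlt⟩
      _ = ENNReal.ofReal (20 ^ N) * t * volume (B j) := by
          rw [volume_closedBall_mul j j (hρ j hj).le (by norm_num)]
          ring
  have hind1 : ∀ j, Integrable ((B j).indicator fun _ => c j) := fun j =>
    (integrable_indicator_iff (hBm j)).2 (integrableOn_const (hBfin j))
  have hind2 : ∀ j, MemLp ((B j).indicator fun _ => c j) 2 := fun j =>
    memLp_indicator_const 2 (hBm j) (c j) (Or.inr (hBfin j))
  have hindI : ∀ j, ∫⁻ y, ‖(B j).indicator (fun _ => c j) y‖ₑ = ‖c j‖ₑ * volume (B j) := fun j => by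
    simp_rw [enorm_indicator_eq_indicator_enorm]
    rw [lintegral_indicator_const (hBm j)]
  set b : 𝔼 → 𝔼 → 𝕜 := fun j y => φ j y - (B j).indicator (fun _ => c j) y with hb
  set g : 𝔼 → 𝕜 := fun y => (Ωᶜ).indicator f y + ∑ j ∈ s, (B j).indicator (fun _ => c j) y with hg
  set e : 𝔼 → 𝕜 := (Ω \ U).indicator f with he
  have hΩm := hΩ.measurableSet
  refine ⟨s, ρ, g, e, b, fun x => ?_, ?_, hf2.indicator (hΩm.diff hUm), fun j hj => ?_,
    fun j hj => ?_, hρ, fun j hj y hy => ?_, fun j hj => ?_, ?_, ?_, ?_, ?_, ?_⟩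
  · simp only [hg, he, hb, Finset.sum_sub_distrib, hφsum]
    by_cases hx : x ∈ Ω
    · by_cases hxU : x ∈ U <;> simp [hx, hxU]
    · have hxU : x ∉ U := fun h => hx (hUΩ h)
      simp [hx, hxU]
  · exact (hf2.indicator hΩm.compl).add (memLp_finsetSum s fun j _ => hind2 j)
  · exact (hφ2 j hj).sub (hind2 j)
  · exact (hφ1 j hj).sub (hind1 j)
  · have hy' : y ∉ B j := fun h =>
      hy (Metric.closedBall_subset_closedBall (by linarith [hρ j hj]) h)
    simp [hb, hφ, hwB j y hy, hy']
  · simp only [hb]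
    rw [integral_sub (hφ1 j hj) (hind1 j), integral_indicator (hBm j), setIntegral_const,
      RCLike.real_smul_eq_coe_mul]
    simp only [hc]
    rw [← mul_assoc, mul_inv_cancel₀ (hBr j hj), one_mul, sub_self]
  · calc ∑ j ∈ s, ∫⁻ y, ‖b j y‖ₑ ≤ ∑ j ∈ s, 2 * ∫⁻ y, ‖φ j y‖ₑ := by
          refine Finset.sum_le_sum fun j hj => ?_
          calc ∫⁻ y, ‖b j y‖ₑ ≤ ∫⁻ y, (‖φ j y‖ₑ + ‖(B j).indicator (fun _ => c j) y‖ₑ) :=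
                lintegral_mono fun y => enorm_sub_le
            _ = (∫⁻ y, ‖φ j y‖ₑ) + ‖c j‖ₑ * volume (B j) := by
                rw [lintegral_add_left' (hφm j hj).enorm, hindI]
            _ ≤ 2 * ∫⁻ y, ‖φ j y‖ₑ := by
                rw [two_mul]; exact add_le_add le_rfl (hcB j hj)
      _ = 2 * ∫⁻ y in U, ‖f y‖ₑ := by rw [← Finset.mul_sum, hφI]
      _ ≤ 2 * I := by gcongr
  · rw [← measure_biUnion_finset hdisj fun j _ => hBm j]
    exact (measure_mono (Set.iUnion₂_subset hBΩ)).trans hΩle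
  · filter_upwards [ae_le_of_notMem_maximalSet hf1.1.enorm hIfin t] with y hy
    have h20 : (1 : ℝ≥0∞) ≤ ENNReal.ofReal (20 ^ N) := by
      rw [← ENNReal.ofReal_one]
      exact ENNReal.ofReal_le_ofReal (one_le_pow₀ (by norm_num))
    simp only [hg]
    by_cases hyΩ : y ∈ Ω
    · rw [Set.indicator_of_notMem (by simpa using hyΩ), zero_add]
      by_cases hyB : ∃ j ∈ s, y ∈ B j
      · obtain ⟨j, hj, hyj⟩ := hyB
        rw [Finset.sum_eq_single j, Set.indicator_of_mem hyj]
        · exact hcle j hj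
        · intro i hi hij
          refine Set.indicator_of_notMem (fun hyi => ?_) _
          exact Set.disjoint_left.1 (hdisj hi hj hij) hyi hyj
        · exact fun h => absurd hj h
      · push Not at hyB
        rw [Finset.sum_eq_zero fun j hj => Set.indicator_of_notMem (hyB j hj) _]
        simp
    · rw [Set.indicator_of_mem (by simpa using hyΩ),
        Finset.sum_eq_zero fun j hj => Set.indicator_of_notMem (fun h => hyΩ (hBΩ j hj h)) _,
        add_zero]
      exact (hy hyΩ).trans (le_mul_of_one_le_left zero_le h20)
  · calc ∫⁻ y, ‖g y‖ₑ ≤ ∫⁻ y, ((Ωᶜ).indicator (fun y => ‖f y‖ₑ) y +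
            ∑ j ∈ s, ‖(B j).indicator (fun _ => c j) y‖ₑ) := by
          refine lintegral_mono fun y => (enorm_add_le _ _).trans ?_
          rw [enorm_indicator_eq_indicator_enorm]
          exact add_le_add le_rfl (enorm_sum_le _ _)
      _ = (∫⁻ y in Ωᶜ, ‖f y‖ₑ) + ∑ j ∈ s, ‖c j‖ₑ * volume (B j) := by
          rw [lintegral_add_left' (hf1.1.enorm.indicator hΩm.compl),
            lintegral_indicator hΩm.compl, lintegral_finsetSum' s
              fun j _ => (hind1 j).1.enorm]
          simp_rw [hindI]
      _ ≤ (∫⁻ y in Ωᶜ, ‖f y‖ₑ) + ∫⁻ y in U, ‖f y‖ₑ := by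
          rw [← hφI]
          exact add_le_add le_rfl (Finset.sum_le_sum hcB)
      _ ≤ (∫⁻ y in Ωᶜ, ‖f y‖ₑ) + ∫⁻ y in Ω, ‖f y‖ₑ :=
          add_le_add le_rfl (lintegral_mono_set hUΩ)
      _ = I := by rw [add_comm]; exact lintegral_add_compl _ hΩm
  · have : ∀ y, ‖e y‖ₑ ^ 2 = (Ω \ U).indicator (fun y => ‖f y‖ₑ ^ 2) y := fun y => by
      by_cases hy : y ∈ Ω \ U
      · simp only [he, Set.indicator_of_mem hy]
      · simp only [he, Set.indicator_of_notMem hy]; simp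
    simp_rw [this]
    rw [lintegral_indicator (hΩm.diff hUm)]
    exact (hδη _ hvol).le

/-! ### The weak type estimate -/

theorem lintegral_enorm_sq_eq (v : Lp 𝕜 2 (volume : Measure 𝔼)) :
    ∫⁻ x, ‖v x‖ₑ ^ 2 = ‖v‖ₑ ^ 2 := by
  rw [Lp.enorm_def]
  have h := eLpNorm_nnreal_pow_eq_lintegral (μ := (volume : Measure 𝔼)) (f := v) (p := 2)
    (by norm_num)
  simpa using h.symm

theorem lintegral_enorm_sq_apply_le
    (T : Lp 𝕜 2 (volume : Measure 𝔼) →L[𝕜] Lp 𝕜 2 (volume : Measure 𝔼))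
    (v : Lp 𝕜 2 (volume : Measure 𝔼)) :
    ∫⁻ x, ‖T v x‖ₑ ^ 2 ≤ ‖T‖ₑ ^ 2 * ∫⁻ x, ‖v x‖ₑ ^ 2 := by
  rw [lintegral_enorm_sq_eq, lintegral_enorm_sq_eq, ← mul_pow]
  gcongr
  exact T.le_opENorm v

theorem meas_ge_enorm_apply_le
    (T : Lp 𝕜 2 (volume : Measure 𝔼) →L[𝕜] Lp 𝕜 2 (volume : Measure 𝔼))
    (v : Lp 𝕜 2 (volume : Measure 𝔼)) {s : ℝ≥0∞} (hs : s ≠ 0) (hs' : s ≠ ∞) :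
    volume {x | s ≤ ‖T v x‖ₑ} ≤ ‖T‖ₑ ^ 2 * (∫⁻ x, ‖v x‖ₑ ^ 2) / s ^ 2 := by
  have h : {x | s ≤ ‖T v x‖ₑ} = {x | s ^ 2 ≤ ‖T v x‖ₑ ^ 2} := by
    ext x
    exact (ENNReal.pow_le_pow_left_iff two_ne_zero).symm
  rw [h]
  refine (meas_ge_le_lintegral_div ((Lp.aestronglyMeasurable (T v)).enorm.pow_const 2)
    (pow_ne_zero 2 hs) (ENNReal.pow_ne_top hs')).trans ?_
  gcongr
  exact lintegral_enorm_sq_apply_le T v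

/-- Cancellation bounds T b(x) by C r^ε d(x,x₀)^(-N-ε) ‖b‖₁, and integrating over d(x,x₀) ≥ 2r
absorbs the factor r^ε. The excluded region is an orbit ball, since T b may be singular near every
image of x₀. -/
theorem HasKernel.exists_lintegral_far_le [Finite G] {K : 𝔼 → 𝔼 → 𝕜} {C ε : ℝ}
    (hK : KernelBounds G K C ε)
    {T : Lp 𝕜 2 (volume : Measure 𝔼) →L[𝕜] Lp 𝕜 2 (volume : Measure 𝔼)}
    (hT : HasKernel G T K) :
    ∃ A : ℝ≥0∞, A ≠ ∞ ∧ ∀ (b : Lp 𝕜 2 (volume : Measure 𝔼)) (x₀ : 𝔼) (r : ℝ), 0 < r →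
      (∀ᵐ y, y ∉ Metric.closedBall x₀ r → b y = 0) → ∫ y, b y = 0 →
      ∫⁻ x in {x | 2 * r ≤ orbitDist G x x₀}, ‖T b x‖ₑ ≤ A * ∫⁻ y, ‖b y‖ₑ := by
  obtain ⟨A, hA, hdecay⟩ := exists_lintegral_orbitDist_rpow_le (G := G) hK.pos
  have hε := hK.pos
  have hC := hK.nonneg
  refine ⟨ENNReal.ofReal C * A, ENNReal.mul_ne_top ENNReal.ofReal_ne_top hA,
    fun b x₀ r hr hb hb0 => ?_⟩
  have hbint := integrable_of_compact_support (isCompact_closedBall x₀ r) hb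
  have hm : MeasurableSet {x : 𝔼 | 2 * r ≤ orbitDist G x x₀} :=
    measurableSet_le measurable_const (continuous_orbitDist_left x₀).measurable
  calc ∫⁻ x in {x | 2 * r ≤ orbitDist G x x₀}, ‖T b x‖ₑ
      ≤ ∫⁻ x in {x | 2 * r ≤ orbitDist G x x₀},
          (ENNReal.ofReal (C * r ^ ε) * ∫⁻ y, ‖b y‖ₑ) *
            ENNReal.ofReal (1 / orbitDist G x x₀ ^ (N + ε)) := by
        refine setLIntegral_mono_ae' hm ?_
        filter_upwards [hT b _ (isCompact_closedBall x₀ r) hb] with x hx hx2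
        have hx2 : 2 * r ≤ orbitDist G x x₀ := hx2
        have h0 : 0 ≤ orbitDist G x x₀ := orbitDist_nonneg G _ _
        have hx3 := hx fun y hy h0 => by
          rw [Metric.mem_closedBall, dist_eq_norm] at hy
          have h1 := orbitDist_triangle (G := G) x y x₀
          have h2 := orbitDist_le_norm_sub (G := G) y x₀
          linarith
        rw [hx3, ← ofReal_norm]
        refine (ENNReal.ofReal_le_ofReal
          (hK.norm_potential_le_of_integral_eq_zero hr hx2 hbint hb hb0)).trans (le_of_eq ?_)
        rw [ENNReal.ofReal_mul (by positivity), ENNReal.ofReal_mul (by positivity),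
          ofReal_integral_norm_eq_lintegral_enorm hbint]
        ring
    _ = (ENNReal.ofReal (C * r ^ ε) * ∫⁻ y, ‖b y‖ₑ) *
          ∫⁻ x in {x | 2 * r ≤ orbitDist G x x₀},
            ENNReal.ofReal (1 / orbitDist G x x₀ ^ (N + ε)) := by
        refine lintegral_const_mul' _ _ (ENNReal.mul_ne_top ENNReal.ofReal_ne_top hbint.2.ne)
    _ ≤ (ENNReal.ofReal (C * r ^ ε) * ∫⁻ y, ‖b y‖ₑ) *
          (A * ENNReal.ofReal ((2 * r) ^ (-ε))) := by
        gcongr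
        exact hdecay x₀ (2 * r) (by positivity)
    _ = ENNReal.ofReal C * A * (∫⁻ y, ‖b y‖ₑ) * ENNReal.ofReal (r ^ ε * (2 * r) ^ (-ε)) := by
        rw [ENNReal.ofReal_mul hC, ENNReal.ofReal_mul (by positivity : 0 ≤ r ^ ε)]
        ring
    _ ≤ ENNReal.ofReal C * A * (∫⁻ y, ‖b y‖ₑ) * 1 := by
        gcongr
        rw [ENNReal.ofReal_le_one, Real.rpow_neg (by positivity)]
        refine mul_inv_le_one_of_le₀ ?_ (by positivity)
        exact Real.rpow_le_rpow hr.le (by linarith) hε.le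
    _ = _ := mul_one _

set_option maxHeartbeats 2000000 in
-- With the decomposition at height t, the four constants come from the exceptional orbit balls, the
-- good part, the small `L²` remainder and the far part of the bad pieces. The value t is shared
-- equally among the last three, which gives 9 = 3² for the two `L²` terms and 6 = 3 · 2 for the bad
-- pieces, whose total `L¹` norm is at most twice that of u.
theorem HasKernel.exists_weak_type [Finite G] (hN : 1 ≤ N) {K : 𝔼 → 𝔼 → 𝕜} {C ε : ℝ}
    (hK : KernelBounds G K C ε)
    {T : Lp 𝕜 2 (volume : Measure 𝔼) →L[𝕜] Lp 𝕜 2 (volume : Measure 𝔼)}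
    (hT : HasKernel G T K) :
    ∃ A : ℝ≥0∞, A ≠ ∞ ∧ ∀ u : Lp 𝕜 2 (volume : Measure 𝔼), Integrable (fun x => u x) →
      ∀ t : ℝ≥0∞, t ≠ 0 → t ≠ ∞ →
        volume {x | t ≤ ‖T u x‖ₑ} ≤ A * ((∫⁻ x, ‖u x‖ₑ) / t) := by
  obtain ⟨A, hA, hfar⟩ := hT.exists_lintegral_far_le hK
  set a₁ : ℝ≥0∞ := Nat.card G * (ENNReal.ofReal (10 ^ N) * ENNReal.ofReal (5 ^ N)) with ha₁
  set a₂ : ℝ≥0∞ := ‖T‖ₑ ^ 2 * (9 * ENNReal.ofReal (20 ^ N)) with ha₂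
  set a₃ : ℝ≥0∞ := ‖T‖ₑ ^ 2 * 9 with ha₃
  set a₄ : ℝ≥0∞ := A * 6 with ha₄
  refine ⟨a₁ + a₂ + a₃ + a₄, ?_, fun u hu t ht ht' => ?_⟩
  · simp only [ha₁, ha₂, ha₃, ha₄]
    finiteness
  set I : ℝ≥0∞ := ∫⁻ x, ‖u x‖ₑ with hI
  have hIfin : I ≠ ∞ := hu.2.ne
  -- The case u = 0 is separate because the tolerance for the remainder, chosen next, must be
  -- nonzero.
  rcases eq_or_ne I 0 with hI0 | hI0
  · have hu0 : u = 0 := by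
      refine Lp.ext ?_
      rw [hI, lintegral_eq_zero_iff' hu.1.enorm] at hI0
      filter_upwards [hI0, Lp.coeFn_zero 𝕜 2 (volume : Measure 𝔼)] with x h1 h2
      rw [h2]
      simpa using h1
    have hTu : ∀ᵐ x, ¬ (t ≤ ‖T u x‖ₑ) := by
      rw [hu0, map_zero]
      filter_upwards [Lp.coeFn_zero 𝕜 2 (volume : Measure 𝔼)] with x h2
      rw [h2]
      simpa using ht
    have : volume {x | t ≤ ‖T u x‖ₑ} = 0 := by
      rw [ae_iff] at hTu
      simpa using hTu
    rw [this]
    exact zero_le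
  -- With remainder of squared `L²` norm at most I t, Chebyshev's inequality at height t/3 again
  -- yields a multiple of I/t.
  have hη : I * t ≠ 0 := mul_ne_zero hI0 ht
  obtain ⟨s, ρ, g, e, b, hsum, hg2, he2, hb2, hb1, hρ, hbB, hb0, hbI, hvol, hgt, hgI, heη⟩ :=
    exists_calderonZygmund_decomposition hN hu (Lp.memLp u) ht ht' hη
  have hg' := hg2.coeFn_toLp
  have he' := he2.coeFn_toLp
  set g' := hg2.toLp g with hg'def
  set e' := he2.toLp e with he'def
  obtain ⟨b', hb'⟩ : ∃ b' : 𝔼 → Lp 𝕜 2 (volume : Measure 𝔼), ∀ j ∈ s, b' j =ᵐ[volume] b j := by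
    classical
    refine ⟨fun j => if h : j ∈ s then (hb2 j h).toLp (b j) else 0, fun j hj => ?_⟩
    simp only [hj, dif_pos]
    exact (hb2 j hj).coeFn_toLp
  have hb'ae : ∀ᵐ x, ∀ j ∈ s, b' j x = b j x := (Finset.eventually_all s).2 hb'
  have hu' : u = g' + e' + ∑ j ∈ s, b' j := by
    refine Lp.ext ?_
    filter_upwards [hg', he', hb'ae, Lp.coeFn_fun_finsetSum s b', Lp.coeFn_add g' e',
      Lp.coeFn_add (g' + e') (∑ j ∈ s, b' j)] with x h1 h2 h3 h4 h5 h6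
    rw [h6, Pi.add_apply, h5, Pi.add_apply, h1, h2, h4, hsum x]
    congr 1
    exact Finset.sum_congr rfl fun j hj => (h3 j hj).symm
  have hTu : ∀ᵐ x, T u x = T g' x + T e' x + ∑ j ∈ s, T (b' j) x := by
    have e1 : T u = T g' + T e' + ∑ j ∈ s, T (b' j) := by
      rw [hu', map_add, map_add, map_sum]
    rw [e1]
    filter_upwards [Lp.coeFn_fun_finsetSum s (fun j => T (b' j)), Lp.coeFn_add (T g') (T e'),
      Lp.coeFn_add (T g' + T e') (∑ j ∈ s, T (b' j))] with x h4 h5 h6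
    rw [h6, Pi.add_apply, h5, Pi.add_apply, h4]
  set t' : ℝ≥0∞ := t / 3 with ht'def
  have ht'0 : t' ≠ 0 := (ENNReal.div_pos ht (by norm_num)).ne'
  have ht'1 : t' ≠ ∞ := ENNReal.div_ne_top ht' (by norm_num)
  have h3t : t = t' + t' + t' := (ENNReal.add_thirds t).symm
  have hdiv : ∀ a : ℝ≥0∞, a / t' = 3 * (a / t) := fun a => by
    rw [ht'def, ENNReal.div_eq_inv_mul (a := a) (b := t / 3), ENNReal.inv_div (by simp) (by simp),
      ENNReal.div_eq_inv_mul, ENNReal.div_eq_inv_mul]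
    ring
  have hdiv2 : ∀ a : ℝ≥0∞, a * t / t' ^ 2 = 9 * (a / t) := fun a => by
    have e1 : a * t / t' ^ 2 = (a * t / t') / t' := by
      rw [pow_two, div_eq_mul_inv, div_eq_mul_inv, div_eq_mul_inv,
        ENNReal.mul_inv (Or.inl ht'0) (Or.inl ht'1), mul_assoc (a * t)]
    rw [e1, hdiv, hdiv]
    have e2 : a * t / t = a := ENNReal.mul_div_cancel_right ht ht'
    rw [e2, mul_div_assoc, ← mul_assoc]
    norm_num
  -- The bad piece lives on a ball of radius 5ρ, and the far estimate starts at twice that radius.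
  set Ω' : Set 𝔼 := ⋃ j ∈ s, orbitBall G j (10 * ρ j) with hΩ'
  have hΩ'm : MeasurableSet Ω' :=
    Finset.measurableSet_biUnion s fun j _ => (isClosed_orbitBall j _).measurableSet
  set W : Set 𝔼 := {x | x ∉ Ω' ∧ t' ≤ ‖∑ j ∈ s, T (b' j) x‖ₑ} with hW
  have hsub : ∀ᵐ x, x ∈ {x | t ≤ ‖T u x‖ₑ} →
      x ∈ Ω' ∪ {x | t' ≤ ‖T g' x‖ₑ} ∪ {x | t' ≤ ‖T e' x‖ₑ} ∪ W := by
    filter_upwards [hTu] with x hx hxt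
    by_contra hcon
    simp only [Set.mem_union, Set.mem_ofPred_eq, not_or, not_le, hW, not_and] at hcon
    obtain ⟨⟨⟨h1, h2⟩, h3⟩, h4⟩ := hcon
    have hxt : t ≤ ‖T u x‖ₑ := hxt
    rw [hx] at hxt
    refine absurd hxt (not_le.2 ?_)
    calc _ ≤ ‖T g' x‖ₑ + ‖T e' x‖ₑ + ‖∑ j ∈ s, T (b' j) x‖ₑ :=
          (enorm_add_le _ _).trans (add_le_add (enorm_add_le _ _) le_rfl)
      _ < t' + t' + t' := ENNReal.add_lt_add (ENNReal.add_lt_add h2 h3) (h4 h1)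
      _ = t := h3t.symm
  have hv1 : volume Ω' ≤ a₁ * (I / t) := by
    calc volume Ω' ≤ ∑ j ∈ s, volume (orbitBall G j (10 * ρ j)) := measure_biUnion_finset_le _ _
      _ ≤ ∑ j ∈ s, Nat.card G * (ENNReal.ofReal (10 ^ N) * volume (Metric.closedBall j (ρ j))) := by
          refine Finset.sum_le_sum fun j hj => ?_
          rw [← volume_closedBall_mul j j (hρ j hj).le (by norm_num)]
          exact volume_orbitBall_le j _
      _ = Nat.card G * (ENNReal.ofReal (10 ^ N) *
            ∑ j ∈ s, volume (Metric.closedBall j (ρ j))) := by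
          rw [Finset.mul_sum, Finset.mul_sum]
      _ ≤ Nat.card G * (ENNReal.ofReal (10 ^ N) * (ENNReal.ofReal (5 ^ N) * (I / t))) := by gcongr
      _ = a₁ * (I / t) := by rw [ha₁]; ring
  have hv2 : volume {x | t' ≤ ‖T g' x‖ₑ} ≤ a₂ * (I / t) := by
    refine (meas_ge_enorm_apply_le T g' ht'0 ht'1).trans ?_
    have hg3 : ∫⁻ x, ‖g' x‖ₑ ^ 2 ≤ ENNReal.ofReal (20 ^ N) * I * t := by
      calc ∫⁻ x, ‖g' x‖ₑ ^ 2 ≤ ∫⁻ x, ENNReal.ofReal (20 ^ N) * t * ‖g x‖ₑ := by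
            refine lintegral_mono_ae ?_
            filter_upwards [hg', hgt] with x h1 h2
            rw [h1, pow_two]
            gcongr
        _ = ENNReal.ofReal (20 ^ N) * t * ∫⁻ x, ‖g x‖ₑ :=
            lintegral_const_mul' _ _ (ENNReal.mul_ne_top ENNReal.ofReal_ne_top ht')
        _ ≤ ENNReal.ofReal (20 ^ N) * t * I := by gcongr
        _ = _ := by ring
    calc ‖T‖ₑ ^ 2 * (∫⁻ x, ‖g' x‖ₑ ^ 2) / t' ^ 2
        ≤ ‖T‖ₑ ^ 2 * (ENNReal.ofReal (20 ^ N) * I * t) / t' ^ 2 := by gcongr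
      _ = ‖T‖ₑ ^ 2 * (9 * (ENNReal.ofReal (20 ^ N) * I / t)) := by rw [mul_div_assoc, hdiv2]
      _ = a₂ * (I / t) := by rw [ha₂, mul_div_assoc]; ring
  have hv3 : volume {x | t' ≤ ‖T e' x‖ₑ} ≤ a₃ * (I / t) := by
    refine (meas_ge_enorm_apply_le T e' ht'0 ht'1).trans ?_
    have he3 : ∫⁻ x, ‖e' x‖ₑ ^ 2 ≤ I * t := by
      refine (lintegral_congr_ae ?_).trans_le heη
      filter_upwards [he'] with x h1
      rw [h1]
    calc ‖T‖ₑ ^ 2 * (∫⁻ x, ‖e' x‖ₑ ^ 2) / t' ^ 2 ≤ ‖T‖ₑ ^ 2 * (I * t) / t' ^ 2 := by gcongr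
      _ = a₃ * (I / t) := by rw [mul_div_assoc, hdiv2, ha₃]; ring
  have hv4 : volume W ≤ a₄ * (I / t) := by
    have hmeas : AEMeasurable (fun x => ‖∑ j ∈ s, T (b' j) x‖ₑ) (volume.restrict Ω'ᶜ) :=
      (Finset.aestronglyMeasurable_fun_sum s
        fun j _ => Lp.aestronglyMeasurable (T (b' j))).enorm.restrict
    have hWeq : volume W = (volume.restrict Ω'ᶜ) {x | t' ≤ ‖∑ j ∈ s, T (b' j) x‖ₑ} := by
      rw [Measure.restrict_apply' hΩ'm.compl]
      congr 1
      ext x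
      simp only [hW, Set.mem_ofPred_eq, Set.mem_inter_iff, Set.mem_compl_iff]
      exact and_comm
    rw [hWeq]
    calc _ ≤ (∫⁻ x in Ω'ᶜ, ‖∑ j ∈ s, T (b' j) x‖ₑ) / t' :=
          meas_ge_le_lintegral_div hmeas ht'0 ht'1
      _ ≤ (∫⁻ x in Ω'ᶜ, ∑ j ∈ s, ‖T (b' j) x‖ₑ) / t' := by
          gcongr with x
          exact enorm_sum_le _ _
      _ = (∑ j ∈ s, ∫⁻ x in Ω'ᶜ, ‖T (b' j) x‖ₑ) / t' := by
          rw [lintegral_finsetSum' s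
            fun j _ => (Lp.aestronglyMeasurable (T (b' j))).enorm.restrict]
      _ ≤ (∑ j ∈ s, A * ∫⁻ x, ‖b j x‖ₑ) / t' := by
          gcongr with j hj
          have hj0 := hρ j hj
          have hae : ∀ᵐ y, y ∉ Metric.closedBall j (5 * ρ j) → b' j y = 0 := by
            filter_upwards [hb' j hj] with y hy hyB
            rw [hy, hbB j hj y hyB]
          have hint : ∫ y, b' j y = 0 := by
            rw [integral_congr_ae (hb' j hj), hb0 j hj]
          have h1 := hfar (b' j) j (5 * ρ j) (by positivity) hae hint
          have h2 : ∫⁻ x, ‖b' j x‖ₑ = ∫⁻ x, ‖b j x‖ₑ := by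
            refine lintegral_congr_ae ?_
            filter_upwards [hb' j hj] with x hx
            rw [hx]
          rw [h2] at h1
          refine (lintegral_mono_set ?_).trans h1
          intro x hx
          have hx' : x ∉ orbitBall G j (10 * ρ j) := fun h => hx (Set.mem_iUnion₂.2 ⟨j, hj, h⟩)
          simp only [orbitBall, Set.mem_ofPred_eq, not_le] at hx' ⊢
          rw [orbitDist_comm]
          linarith
      _ ≤ A * (2 * I) / t' := by
          rw [← Finset.mul_sum]
          gcongr
      _ = a₄ * (I / t) := by
          rw [hdiv, ha₄, mul_div_assoc, mul_div_assoc]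
          ring
  calc volume {x | t ≤ ‖T u x‖ₑ}
      ≤ volume (Ω' ∪ {x | t' ≤ ‖T g' x‖ₑ} ∪ {x | t' ≤ ‖T e' x‖ₑ} ∪ W) := measure_mono_ae hsub
    _ ≤ volume Ω' + volume {x | t' ≤ ‖T g' x‖ₑ} + volume {x | t' ≤ ‖T e' x‖ₑ} + volume W :=
        (measure_union_le _ _).trans (add_le_add ((measure_union_le _ _).trans
          (add_le_add (measure_union_le _ _) le_rfl)) le_rfl)
    _ ≤ a₁ * (I / t) + a₂ * (I / t) + a₃ * (I / t) + a₄ * (I / t) := by gcongr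
    _ = _ := by ring

/-! ### Interpolation -/

theorem lintegral_Ioi_indicator_lt_rpow {p a : ℝ} (hp : 1 < p) (ha : 0 ≤ a) :
    ∫⁻ t in Set.Ioi (0 : ℝ), (Set.Iio a).indicator (fun t => ENNReal.ofReal (t ^ (p - 2))) t =
      ENNReal.ofReal (a ^ (p - 1) / (p - 1)) := by
  rw [lintegral_indicator measurableSet_Iio, Measure.restrict_restrict measurableSet_Iio,
    Set.inter_comm, Set.Ioi_inter_Iio, restrict_Ioo_eq_restrict_Ioc]
  have hint : IntegrableOn (fun t : ℝ => t ^ (p - 2)) (Set.Ioc 0 a) :=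
    (intervalIntegrable_iff_integrableOn_Ioc_of_le ha).1
      (intervalIntegral.intervalIntegrable_rpow' (by linarith))
  rw [← ofReal_integral_eq_lintegral_ofReal hint, ← intervalIntegral.integral_of_le ha,
    integral_rpow (Or.inl (by linarith))]
  · rw [Real.zero_rpow (by linarith), sub_zero, show p - 2 + 1 = p - 1 by ring]
  · filter_upwards [ae_restrict_mem measurableSet_Ioc] with t ht
    exact Real.rpow_nonneg ht.1.le _

theorem lintegral_Ioi_indicator_ge_rpow {p a : ℝ} (hp : p < 2) (ha : 0 < a) :
    ∫⁻ t in Set.Ioi (0 : ℝ), (Set.Ici a).indicator (fun t => ENNReal.ofReal (t ^ (p - 3))) t =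
      ENNReal.ofReal (a ^ (p - 2) / (2 - p)) := by
  have hset : Set.Ici a ∩ Set.Ioi 0 = Set.Ici a :=
    Set.inter_eq_left.2 fun t ht => ha.trans_le ht
  rw [lintegral_indicator measurableSet_Ici, Measure.restrict_restrict measurableSet_Ici, hset,
    ← restrict_Ioi_eq_restrict_Ici]
  have hint := integrableOn_Ioi_rpow_of_lt (show p - 3 < -1 by linarith) ha
  rw [← ofReal_integral_eq_lintegral_ofReal hint, integral_Ioi_rpow_of_lt (by linarith) ha]
  · congr 1
    rw [show p - 3 + 1 = -(2 - p) by ring, neg_div_neg_eq]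
    congr 2
    ring
  · filter_upwards [ae_restrict_mem measurableSet_Ioi] with t ht
    exact Real.rpow_nonneg (ha.trans ht).le _

set_option maxHeartbeats 2000000 in
/-- **Marcinkiewicz interpolation** between weak type `(1,1)` and strong type `(2,2)`. -/
theorem exists_strong_type_of_weak_type
    {T : Lp 𝕜 2 (volume : Measure 𝔼) →L[𝕜] Lp 𝕜 2 (volume : Measure 𝔼)} {A : ℝ≥0∞} (hA : A ≠ ∞)
    (hT : ∀ u : Lp 𝕜 2 (volume : Measure 𝔼), Integrable (fun x => u x) →
      ∀ t : ℝ≥0∞, t ≠ 0 → t ≠ ∞ → volume {x | t ≤ ‖T u x‖ₑ} ≤ A * ((∫⁻ x, ‖u x‖ₑ) / t))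
    {p : ℝ} (hp1 : 1 < p) (hp2 : p < 2) :
    ∃ A' : ℝ≥0∞, A' ≠ ∞ ∧ ∀ u : Lp 𝕜 2 (volume : Measure 𝔼),
      ∫⁻ x, ‖T u x‖ₑ ^ p ≤ A' * ∫⁻ x, ‖u x‖ₑ ^ p := by
  -- Both parts of u are tested at height t/2, whence 2 for the weak (1,1) bound and 4 for the `L²`
  -- bound.
  set a₁ : ℝ≥0∞ := 2 * A with ha₁
  set a₂ : ℝ≥0∞ := 4 * ‖T‖ₑ ^ 2 with ha₂
  refine ⟨ENNReal.ofReal p * (a₁ * ENNReal.ofReal (1 / (p - 1)) +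
    a₂ * ENNReal.ofReal (1 / (2 - p))), by simp only [ha₁, ha₂]; finiteness, fun u => ?_⟩
  have hum : Measurable fun x => ‖u x‖ := (Lp.stronglyMeasurable u).norm.measurable
  have hume : Measurable fun x => ‖u x‖ₑ := (Lp.stronglyMeasurable u).enorm
  have hu2 : ∫⁻ x, ‖u x‖ₑ ^ 2 ≠ ∞ := by
    rw [lintegral_enorm_sq_eq]
    finiteness
  -- the distribution function estimate
  have hdist : ∀ t : ℝ, 0 < t → volume {x | t ≤ ‖T u x‖} ≤
      a₁ * ((∫⁻ x in {x | t < ‖u x‖}, ‖u x‖ₑ) / ENNReal.ofReal t) +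
      a₂ * ((∫⁻ x in {x | ‖u x‖ ≤ t}, ‖u x‖ₑ ^ 2) / ENNReal.ofReal t ^ 2) := by
    intro t ht
    have hm1 : MeasurableSet {x | t < ‖u x‖} := measurableSet_lt measurable_const hum
    have hm2 : MeasurableSet {x | ‖u x‖ ≤ t} := measurableSet_le hum measurable_const
    have hL1 : MemLp ({x | t < ‖u x‖}.indicator fun x => u x) 2 := (Lp.memLp u).indicator hm1
    have hL2 : MemLp ({x | ‖u x‖ ≤ t}.indicator fun x => u x) 2 := (Lp.memLp u).indicator hm2
    have hu1 := hL1.coeFn_toLp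
    have hu2' := hL2.coeFn_toLp
    set u₁ := hL1.toLp with hu₁
    set u₂ := hL2.toLp with hu₂
    have hI1 : ∫⁻ x, ‖u₁ x‖ₑ = ∫⁻ x in {x | t < ‖u x‖}, ‖u x‖ₑ := by
      rw [← lintegral_indicator hm1]
      refine lintegral_congr_ae ?_
      filter_upwards [hu1] with x hx
      rw [hx, enorm_indicator_eq_indicator_enorm]
    have hI2 : ∫⁻ x, ‖u₂ x‖ₑ ^ 2 = ∫⁻ x in {x | ‖u x‖ ≤ t}, ‖u x‖ₑ ^ 2 := by
      rw [← lintegral_indicator hm2]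
      refine lintegral_congr_ae ?_
      filter_upwards [hu2'] with x hx
      rw [hx]
      by_cases h : ‖u x‖ ≤ t <;> simp [h]
    have hsum : u = u₁ + u₂ := by
      refine Lp.ext ?_
      filter_upwards [hu1, hu2', Lp.coeFn_add u₁ u₂] with x h1 h2 h3
      rw [h3, Pi.add_apply, h1, h2]
      by_cases h : ‖u x‖ ≤ t
      · simp [h, not_lt.2 h]
      · simp [h, not_le.1 h]
    -- Where |u| > t one has |u| ≤ |u|²/t, so the high part of an `L²` function is integrable and
    -- the weak type bound applies to it.
    have hint : Integrable (fun x => u₁ x) := by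
      refine ⟨Lp.aestronglyMeasurable u₁, ?_⟩
      rw [HasFiniteIntegral, hI1]
      have h1 : ∫⁻ x in {x | t < ‖u x‖}, ‖u x‖ₑ ≤
          (ENNReal.ofReal t)⁻¹ * ∫⁻ x, ‖u x‖ₑ ^ 2 := by
        rw [← lintegral_const_mul _ (hume.pow_const 2)]
        refine (setLIntegral_mono' (g := fun x => (ENNReal.ofReal t)⁻¹ * ‖u x‖ₑ ^ 2) hm1
          fun x hx => ?_).trans (setLIntegral_le_lintegral _ _)
        have hx' : ENNReal.ofReal t ≤ ‖u x‖ₑ := by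
          rw [← ofReal_norm]
          exact ENNReal.ofReal_le_ofReal (le_of_lt hx)
        rw [pow_two, ← mul_assoc]
        refine le_mul_of_one_le_left zero_le ?_
        rw [← ENNReal.inv_mul_cancel (ENNReal.ofReal_pos.2 ht).ne' ENNReal.ofReal_ne_top]
        gcongr
      refine h1.trans_lt (ENNReal.mul_lt_top ?_ hu2.lt_top)
      rw [ENNReal.inv_lt_top]
      exact ENNReal.ofReal_pos.2 ht
    set s : ℝ≥0∞ := ENNReal.ofReal t / 2 with hs
    have ht0 : ENNReal.ofReal t ≠ 0 := (ENNReal.ofReal_pos.2 ht).ne'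
    have hs0 : s ≠ 0 := (ENNReal.div_pos ht0 (by norm_num)).ne'
    have hs1 : s ≠ ∞ := ENNReal.div_ne_top ENNReal.ofReal_ne_top (by norm_num)
    have hsinv : s⁻¹ = 2 * (ENNReal.ofReal t)⁻¹ := by
      rw [hs, ENNReal.inv_div (by simp) (by simp), div_eq_mul_inv]
    have hsub : ∀ᵐ x, x ∈ {x | t ≤ ‖T u x‖} → x ∈ {x | s ≤ ‖T u₁ x‖ₑ} ∪ {x | s ≤ ‖T u₂ x‖ₑ} := by
      have e1 : T u = T u₁ + T u₂ := by rw [hsum, map_add]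
      rw [e1]
      filter_upwards [Lp.coeFn_add (T u₁) (T u₂)] with x hx hxt
      by_contra hcon
      simp only [Set.mem_union, Set.mem_ofPred_eq, not_or, not_le] at hcon
      have hxt : t ≤ ‖(T u₁ + T u₂ : Lp 𝕜 2 (volume : Measure 𝔼)) x‖ := hxt
      rw [hx, Pi.add_apply] at hxt
      have h1 : ENNReal.ofReal t ≤ ‖T u₁ x + T u₂ x‖ₑ := by
        rw [← ofReal_norm]
        exact ENNReal.ofReal_le_ofReal hxt
      refine absurd h1 (not_le.2 ?_)
      calc _ ≤ ‖T u₁ x‖ₑ + ‖T u₂ x‖ₑ := enorm_add_le _ _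
        _ < s + s := ENNReal.add_lt_add hcon.1 hcon.2
        _ = ENNReal.ofReal t := ENNReal.add_halves _
    refine (measure_mono_ae hsub).trans ((measure_union_le _ _).trans (add_le_add ?_ ?_))
    · refine (hT u₁ hint s hs0 hs1).trans (le_of_eq ?_)
      rw [hI1, ha₁, div_eq_mul_inv, div_eq_mul_inv, hsinv]
      ring
    · refine (meas_ge_enorm_apply_le T u₂ hs0 hs1).trans (le_of_eq ?_)
      rw [hI2, ha₂, div_eq_mul_inv, div_eq_mul_inv, ENNReal.inv_pow, ENNReal.inv_pow, hsinv]
      ring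
  -- layer cake and Tonelli
  have hTm : AEMeasurable fun x => ‖T u x‖ := (Lp.aestronglyMeasurable (T u)).norm.aemeasurable
  have hlayer := lintegral_rpow_eq_lintegral_meas_le_mul (volume : Measure 𝔼)
    (Eventually.of_forall fun x => norm_nonneg (T u x)) hTm (by linarith : 0 < p)
  have hnorm : ∀ v : 𝔼 → 𝕜, ∀ x, ENNReal.ofReal (‖v x‖ ^ p) = ‖v x‖ₑ ^ p := fun v x => by
    rw [← ofReal_norm, ENNReal.ofReal_rpow_of_nonneg (norm_nonneg _) (by linarith)]
  simp_rw [hnorm] at hlayer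
  rw [hlayer, mul_assoc]
  refine mul_le_mul_right ?_ _
  -- These kernels put the truncations of u at the moving height t into product form, so that
  -- Tonelli leaves the integrals of t^(p-2) over t < |u| and of t^(p-3) over t ≥ |u|; they converge
  -- because p > 1 and p < 2 respectively.
  set F₁ : ℝ → 𝔼 → ℝ≥0∞ := fun t x =>
    (Set.Iio ‖u x‖).indicator (fun t => ENNReal.ofReal (t ^ (p - 2))) t * ‖u x‖ₑ with hF₁
  set F₂ : ℝ → 𝔼 → ℝ≥0∞ := fun t x =>
    (Set.Ici ‖u x‖).indicator (fun t => ENNReal.ofReal (t ^ (p - 3))) t * ‖u x‖ₑ ^ 2 with hF₂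
  have hF₁m : Measurable (Function.uncurry F₁) := by
    have h1 : MeasurableSet {z : ℝ × 𝔼 | z.1 < ‖u z.2‖} :=
      measurableSet_lt measurable_fst (hum.comp measurable_snd)
    have h2 : Measurable fun z : ℝ × 𝔼 => ENNReal.ofReal (z.1 ^ (p - 2)) := by fun_prop
    have h3 := (h2.indicator h1).mul (hume.comp measurable_snd)
    convert h3 using 1
    ext z
    by_cases hz : z.1 < ‖u z.2‖ <;> simp [hF₁, Function.uncurry, hz]
  have hF₂m : Measurable (Function.uncurry F₂) := by
    have h1 : MeasurableSet {z : ℝ × 𝔼 | ‖u z.2‖ ≤ z.1} :=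
      measurableSet_le (hum.comp measurable_snd) measurable_fst
    have h2 : Measurable fun z : ℝ × 𝔼 => ENNReal.ofReal (z.1 ^ (p - 3)) := by fun_prop
    have h3 := (h2.indicator h1).mul ((hume.comp measurable_snd).pow_const 2)
    convert h3 using 1
    ext z
    by_cases hz : ‖u z.2‖ ≤ z.1 <;> simp [hF₂, Function.uncurry, hz]
  have hF₁t : Measurable fun t => ∫⁻ x, F₁ t x := hF₁m.lintegral_prod_right'
  have hF₂t : Measurable fun t => ∫⁻ x, F₂ t x := hF₂m.lintegral_prod_right'
  have hpt : ∀ t ∈ Set.Ioi (0 : ℝ), volume {x | t ≤ ‖T u x‖} * ENNReal.ofReal (t ^ (p - 1)) ≤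
      a₁ * (∫⁻ x, F₁ t x) + a₂ * ∫⁻ x, F₂ t x := by
    intro t ht
    have ht : 0 < t := ht
    have ht0 : ENNReal.ofReal t ≠ 0 := (ENNReal.ofReal_pos.2 ht).ne'
    have hm1 : MeasurableSet {x | t < ‖u x‖} := measurableSet_lt measurable_const hum
    have hm2 : MeasurableSet {x | ‖u x‖ ≤ t} := measurableSet_le hum measurable_const
    have e1 : ∫⁻ x, F₁ t x =
        ENNReal.ofReal (t ^ (p - 2)) * ∫⁻ x in {x | t < ‖u x‖}, ‖u x‖ₑ := by
      rw [← lintegral_const_mul' _ _ ENNReal.ofReal_ne_top, ← lintegral_indicator hm1]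
      refine lintegral_congr fun x => ?_
      by_cases hx : t < ‖u x‖ <;> simp [hF₁, hx]
    have e2 : ∫⁻ x, F₂ t x =
        ENNReal.ofReal (t ^ (p - 3)) * ∫⁻ x in {x | ‖u x‖ ≤ t}, ‖u x‖ₑ ^ 2 := by
      rw [← lintegral_const_mul' _ _ ENNReal.ofReal_ne_top, ← lintegral_indicator hm2]
      refine lintegral_congr fun x => ?_
      by_cases hx : ‖u x‖ ≤ t <;> simp [hF₂, hx]
    have e3 : ENNReal.ofReal (t ^ (p - 2)) = ENNReal.ofReal (t ^ (p - 1)) * (ENNReal.ofReal t)⁻¹ := by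
      rw [← ENNReal.ofReal_inv_of_pos ht, ← ENNReal.ofReal_mul (by positivity),
        ← Real.rpow_neg_one, ← Real.rpow_add ht]
      congr 2
      ring
    have e4 : ENNReal.ofReal (t ^ (p - 3)) =
        ENNReal.ofReal (t ^ (p - 1)) * (ENNReal.ofReal t ^ 2)⁻¹ := by
      rw [← ENNReal.ofReal_pow ht.le, ← ENNReal.ofReal_inv_of_pos (by positivity),
        ← ENNReal.ofReal_mul (by positivity), ← Real.rpow_natCast, ← Real.rpow_neg ht.le,
        ← Real.rpow_add ht]
      congr 2
      push_cast
      ring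
    calc _ ≤ (a₁ * ((∫⁻ x in {x | t < ‖u x‖}, ‖u x‖ₑ) / ENNReal.ofReal t) +
        a₂ * ((∫⁻ x in {x | ‖u x‖ ≤ t}, ‖u x‖ₑ ^ 2) / ENNReal.ofReal t ^ 2)) *
          ENNReal.ofReal (t ^ (p - 1)) := by
          gcongr
          exact hdist t ht
      _ = _ := by
          rw [e1, e2, e3, e4, div_eq_mul_inv, div_eq_mul_inv]
          ring
  calc ∫⁻ t in Set.Ioi 0, volume {x | t ≤ ‖T u x‖} * ENNReal.ofReal (t ^ (p - 1))
      ≤ ∫⁻ t in Set.Ioi 0, (a₁ * (∫⁻ x, F₁ t x) + a₂ * ∫⁻ x, F₂ t x) :=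
        setLIntegral_mono' measurableSet_Ioi hpt
    _ = a₁ * (∫⁻ t in Set.Ioi 0, ∫⁻ x, F₁ t x) + a₂ * ∫⁻ t in Set.Ioi 0, ∫⁻ x, F₂ t x := by
        rw [lintegral_add_left (hF₁t.const_mul _), lintegral_const_mul _ hF₁t,
          lintegral_const_mul _ hF₂t]
    _ = a₁ * (∫⁻ x, ∫⁻ t in Set.Ioi 0, F₁ t x) + a₂ * ∫⁻ x, ∫⁻ t in Set.Ioi 0, F₂ t x := by
        rw [lintegral_lintegral_swap hF₁m.aemeasurable, lintegral_lintegral_swap hF₂m.aemeasurable]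
    _ ≤ a₁ * (∫⁻ x, ENNReal.ofReal (1 / (p - 1)) * ‖u x‖ₑ ^ p) +
          a₂ * ∫⁻ x, ENNReal.ofReal (1 / (2 - p)) * ‖u x‖ₑ ^ p := by
        gcongr with x x
        · simp only [hF₁]
          rw [lintegral_mul_const' _ _ enorm_ne_top,
            lintegral_Ioi_indicator_lt_rpow hp1 (norm_nonneg _), ← hnorm, ← ofReal_norm,
            ← ENNReal.ofReal_mul (by have := norm_nonneg (u x); have : 0 < p - 1 := by linarith
                                     positivity),
            ← ENNReal.ofReal_mul (by have : 0 < p - 1 := by linarith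
                                     positivity)]
          refine ENNReal.ofReal_le_ofReal (le_of_eq ?_)
          rcases (norm_nonneg (u x)).eq_or_lt with h0 | h0
          · rw [← h0, Real.zero_rpow (by linarith : p ≠ 0)]
            simp
          · rw [Real.rpow_sub_one h0.ne']
            field_simp
        · simp only [hF₂]
          rw [lintegral_mul_const' _ _ (by finiteness)]
          rcases (norm_nonneg (u x)).eq_or_lt with h0 | h0
          -- The t-integral need not be finite here, but it is multiplied by ‖u x‖ₑ² = 0, and ∞ · 0
          -- = 0.
          · have : ‖u x‖ₑ = 0 := by rw [← ofReal_norm, ← h0, ENNReal.ofReal_zero]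
            rw [this]
            simp
          · rw [lintegral_Ioi_indicator_ge_rpow hp2 h0, ← hnorm, ← ofReal_norm,
              ← ENNReal.ofReal_pow h0.le,
              ← ENNReal.ofReal_mul (by have : 0 < 2 - p := by linarith
                                       positivity),
              ← ENNReal.ofReal_mul (by have : 0 < 2 - p := by linarith
                                       positivity)]
            refine ENNReal.ofReal_le_ofReal (le_of_eq ?_)
            rw [Real.rpow_sub h0, Real.rpow_ofNat]
            field_simp
    _ = _ := by
        rw [lintegral_const_mul' _ _ ENNReal.ofReal_ne_top,
          lintegral_const_mul' _ _ ENNReal.ofReal_ne_top]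
        ring

/-! ### Duality -/

/-- Transfer of a strong type estimate to the transpose and the conjugate exponent. -/
theorem IsTranspose.strong_type
    {T T' : Lp 𝕜 2 (volume : Measure 𝔼) →L[𝕜] Lp 𝕜 2 (volume : Measure 𝔼)}
    (hTT' : IsTranspose T T') {p q : ℝ} (hpq : p.HolderConjugate q) (hp : 2 < p) {A : ℝ≥0∞}
    (hA : ∀ u : Lp 𝕜 2 (volume : Measure 𝔼), ∫⁻ x, ‖T' u x‖ₑ ^ q ≤ A * ∫⁻ x, ‖u x‖ₑ ^ q)
    (u : Lp 𝕜 2 (volume : Measure 𝔼)) :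
    ∫⁻ x, ‖T u x‖ₑ ^ p ≤ A ^ (p / q) * ∫⁻ x, ‖u x‖ₑ ^ p := by
  have hp0 : 0 < p := by linarith
  have hq0 : 0 < q := hpq.symm.pos
  set h : 𝔼 → 𝕜 := fun x => T u x with hh
  have hhm : StronglyMeasurable h := Lp.stronglyMeasurable (T u)
  set U : ℝ≥0∞ := ∫⁻ x, ‖u x‖ₑ ^ p with hU
  -- the estimate on a set where `h` is bounded
  have key : ∀ n : ℕ, ∫⁻ x in {x | ‖h x‖ ≤ n}, ‖h x‖ₑ ^ p ≤ A ^ (p / q) * U := by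
    intro n
    have hSm : MeasurableSet {x | ‖h x‖ ≤ n} :=
      measurableSet_le hhm.norm.measurable measurable_const
    set S : Set 𝔼 := {x | ‖h x‖ ≤ n} with hS
    set J : ℝ≥0∞ := ∫⁻ x in S, ‖h x‖ₑ ^ p with hJ
    have hrpow : ∀ x, ‖h x‖ₑ ^ p = ‖h x‖ₑ ^ (p - 2) * ‖h x‖ₑ ^ 2 := fun x => by
      rw [← ENNReal.rpow_ofNat, ← ENNReal.rpow_add_of_nonneg _ _ (by linarith) (by norm_num)]
      congr 1
      ring
    -- Truncating to |h| ≤ n makes J finite a priori, as |h|^p ≤ n^(p-2) |h|² and h is in `L²`.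
    -- Finiteness is needed to divide by a power of J below.
    have hJfin : J ≠ ∞ := by
      have h1 : J ≤ ENNReal.ofReal ((n : ℝ) ^ (p - 2)) * ∫⁻ x, ‖h x‖ₑ ^ 2 := by
        rw [← lintegral_const_mul' _ _ ENNReal.ofReal_ne_top]
        refine (setLIntegral_mono' (g := fun x => ENNReal.ofReal ((n : ℝ) ^ (p - 2)) * ‖h x‖ₑ ^ 2)
          hSm fun x hx => ?_).trans (setLIntegral_le_lintegral _ _)
        have hx : ‖h x‖ ≤ n := hx
        rw [hrpow, ← ENNReal.ofReal_rpow_of_nonneg (by positivity) (by linarith)]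
        refine mul_le_mul_left (ENNReal.rpow_le_rpow ?_ (by linarith)) _
        rw [← ofReal_norm]
        exact ENNReal.ofReal_le_ofReal hx
      refine ne_top_of_le_ne_top (ENNReal.mul_ne_top ENNReal.ofReal_ne_top ?_) h1
      rw [lintegral_enorm_sq_eq]
      finiteness
    -- the test function
    set g : 𝔼 → 𝕜 := S.indicator fun x => star (h x) * ((‖h x‖ ^ (p - 2) : ℝ) : 𝕜) with hg
    have hgm : StronglyMeasurable g := by
      refine StronglyMeasurable.indicator ?_ hSm
      have h1 : Measurable fun x => ‖h x‖ ^ (p - 2) := by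
        have := hhm.norm.measurable
        fun_prop
      exact hhm.star.mul (RCLike.continuous_ofReal.measurable.comp h1).stronglyMeasurable
    have hgnorm : ∀ x ∈ S, ‖g x‖ = ‖h x‖ ^ (p - 1) := fun x hx => by
      simp only [hg, Set.indicator_of_mem hx, norm_mul, norm_star, RCLike.norm_ofReal]
      rw [abs_of_nonneg (by positivity)]
      rcases (norm_nonneg (h x)).eq_or_lt with h0 | h0
      · rw [← h0, zero_mul, Real.zero_rpow (by linarith)]
      · rw [← Real.rpow_one_add' (norm_nonneg _) (by linarith)]
        congr 1
        ring
    have hg2 : MemLp g 2 := by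
      refine MemLp.of_le_mul (c := (n : ℝ) ^ (p - 2)) (Lp.memLp (T u)) hgm.aestronglyMeasurable
        (Eventually.of_forall fun x => ?_)
      by_cases hx : x ∈ S
      · have hx' : ‖h x‖ ≤ n := hx
        simp only [hg, Set.indicator_of_mem hx, norm_mul, norm_star, RCLike.norm_ofReal]
        rw [abs_of_nonneg (by positivity), mul_comm]
        gcongr
      · simp only [hg, Set.indicator_of_notMem hx, norm_zero]
        positivity
    have hg' := hg2.coeFn_toLp
    set g' := hg2.toLp with hg'def
    -- The extremal choice for Hölder's inequality: |g| = |h|^(p-1) on S, and (p-1)q = p.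
    have hgq : ∫⁻ x, ‖g' x‖ₑ ^ q = J := by
      rw [hJ, ← lintegral_indicator hSm]
      refine lintegral_congr_ae ?_
      filter_upwards [hg'] with x hx
      rw [hx]
      by_cases hxS : x ∈ S
      · rw [Set.indicator_of_mem hxS, ← ofReal_norm, hgnorm x hxS,
          ENNReal.ofReal_rpow_of_nonneg (by positivity) hq0.le, ← Real.rpow_mul (norm_nonneg _),
          hpq.sub_one_mul_conj, ← ENNReal.ofReal_rpow_of_nonneg (norm_nonneg _) hp0.le,
          ofReal_norm]
      · rw [Set.indicator_of_notMem hxS]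
        simp [hg, hxS, hq0]
    have hleft : J = ‖∫ x, T u x * g' x‖ₑ := by
      have e1 : ∫ x, T u x * g' x = ∫ x, ((S.indicator (fun x => ‖h x‖ ^ p) x : ℝ) : 𝕜) := by
        refine integral_congr_ae ?_
        filter_upwards [hg'] with x hx
        rw [hx]
        by_cases hxS : x ∈ S
        · simp only [hg, Set.indicator_of_mem hxS]
          have e2 : T u x = h x := rfl
          rw [e2, ← mul_assoc, RCLike.star_def, RCLike.mul_conj, ← RCLike.ofReal_pow,
            ← RCLike.ofReal_mul, ← Real.rpow_ofNat,
            ← Real.rpow_add_of_nonneg (norm_nonneg _) (by norm_num) (by linarith)]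
          congr 2
          ring
        · simp [hg, hxS]
      rw [e1, integral_ofReal, ← ofReal_norm, RCLike.norm_ofReal,
        abs_of_nonneg (integral_nonneg fun x => Set.indicator_nonneg (fun _ _ => by positivity) x),
        integral_eq_lintegral_of_nonneg_ae
          (Eventually.of_forall fun x => Set.indicator_nonneg (fun _ _ => by positivity) x)]
      · have e3 : ∫⁻ x, ENNReal.ofReal (S.indicator (fun x => ‖h x‖ ^ p) x) = J := by
          rw [hJ, ← lintegral_indicator hSm]
          refine lintegral_congr fun x => ?_
          by_cases hxS : x ∈ S
          · rw [Set.indicator_of_mem hxS, Set.indicator_of_mem hxS,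
              ← ENNReal.ofReal_rpow_of_nonneg (norm_nonneg _) hp0.le, ofReal_norm]
          · simp [hxS]
        rw [e3, ENNReal.ofReal_toReal hJfin]
      · have h1 : Measurable fun x => ‖h x‖ ^ p := by
          have := hhm.norm.measurable
          fun_prop
        exact (h1.indicator hSm).aestronglyMeasurable
    have hJle : J ≤ U ^ (1 / p) * (A * J) ^ (1 / q) := by
      calc J = ‖∫ x, u x * T' g' x‖ₑ := by rw [hleft, hTT' u g']
        _ ≤ ∫⁻ x, ‖u x * T' g' x‖ₑ := enorm_integral_le_lintegral_enorm _
        _ = ∫⁻ x, ((fun x => ‖u x‖ₑ) * fun x => ‖T' g' x‖ₑ) x := by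
            simp only [enorm_mul, Pi.mul_apply]
        _ ≤ (∫⁻ x, ‖u x‖ₑ ^ p) ^ (1 / p) * (∫⁻ x, ‖T' g' x‖ₑ ^ q) ^ (1 / q) :=
            ENNReal.lintegral_mul_le_Lp_mul_Lq _ hpq (Lp.aestronglyMeasurable u).enorm
              (Lp.aestronglyMeasurable (T' g')).enorm
        _ ≤ U ^ (1 / p) * (A * J) ^ (1 / q) := by
            have h1 := hA g'
            rw [hgq] at h1
            gcongr
    rcases eq_or_ne J 0 with hJ0 | hJ0
    · rw [hJ0]
      exact zero_le
    -- Division of J ≤ U^(1/p) (A J)^(1/q) by J^(1/q), using 1/p + 1/q = 1.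
    have hJ1 : J ^ (1 / p) ≤ U ^ (1 / p) * A ^ (1 / q) := by
      have e1 : J = J ^ (1 / p) * J ^ (1 / q) := by
        rw [← ENNReal.rpow_add _ _ hJ0 hJfin, one_div, one_div, hpq.inv_add_inv_eq_one,
          ENNReal.rpow_one]
      rw [ENNReal.mul_rpow_of_nonneg _ _ (by positivity), ← mul_assoc] at hJle
      nth_rewrite 1 [e1] at hJle
      refine (ENNReal.mul_le_mul_iff_left ?_ ?_).1 hJle
      · exact (ENNReal.rpow_pos (pos_iff_ne_zero.2 hJ0) hJfin).ne'
      · exact ENNReal.rpow_ne_top_of_nonneg (by positivity) hJfin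
    calc J = (J ^ (1 / p)) ^ p := by
          rw [← ENNReal.rpow_mul, one_div_mul_cancel hp0.ne', ENNReal.rpow_one]
      _ ≤ (U ^ (1 / p) * A ^ (1 / q)) ^ p := by gcongr
      _ = A ^ (p / q) * U := by
          rw [ENNReal.mul_rpow_of_nonneg _ _ hp0.le, ← ENNReal.rpow_mul, ← ENNReal.rpow_mul,
            one_div_mul_cancel hp0.ne', ENNReal.rpow_one, one_div_mul_eq_div, mul_comm]
  -- The bound does not depend on n, and the truncation is removed by monotone convergence.
  have hmono : Monotone fun n : ℕ => {x | ‖h x‖ ≤ n} := fun m n hmn x hx =>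
    le_trans (show ‖h x‖ ≤ m from hx) (by exact_mod_cast hmn)
  have hunion : ⋃ n : ℕ, {x | ‖h x‖ ≤ n} = Set.univ := by
    refine Set.eq_univ_of_forall fun x => ?_
    obtain ⟨n, hn⟩ := exists_nat_ge ‖h x‖
    exact Set.mem_iUnion.2 ⟨n, hn⟩
  have hlim : ∫⁻ x, ‖h x‖ₑ ^ p = ⨆ n : ℕ, ∫⁻ x in {x | ‖h x‖ ≤ n}, ‖h x‖ₑ ^ p := by
    rw [← setLIntegral_univ, ← hunion]
    exact setLIntegral_iUnion_of_directed _ hmono.directed_le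
  rw [hlim]
  exact iSup_le key

/-- Interpolation for p < 2, the `L²` bound at p = 2, and for p > 2 interpolation for the transpose
at the conjugate exponent, which lies below 2, followed by duality. -/
theorem HasSmoothKernel.exists_strong_type [Finite G] (hN : 1 ≤ N) {K : 𝔼 → 𝔼 → 𝕜} {C ε : ℝ}
    (hK : KernelBounds G K C ε)
    {T : Lp 𝕜 2 (volume : Measure 𝔼) →L[𝕜] Lp 𝕜 2 (volume : Measure 𝔼)}
    (hT : HasSmoothKernel G T K) {p : ℝ} (hp : 1 < p) :
    ∃ A : ℝ≥0∞, A ≠ ∞ ∧ ∀ u : Lp 𝕜 2 (volume : Measure 𝔼),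
      ∫⁻ x, ‖T u x‖ₑ ^ p ≤ A * ∫⁻ x, ‖u x‖ₑ ^ p := by
  rcases lt_trichotomy p 2 with h2 | rfl | h2
  · obtain ⟨A, hA, h⟩ := (hT.hasKernel hK).exists_weak_type hN hK
    exact exists_strong_type_of_weak_type hA h hp h2
  · refine ⟨‖T‖ₑ ^ 2, by finiteness, fun u => ?_⟩
    simpa using lintegral_enorm_sq_apply_le T u
  · obtain ⟨T', hT'⟩ := exists_isTranspose T
    obtain ⟨A, hA, h⟩ := (hT.hasKernel_transpose hK hT').exists_weak_type hN hK.swap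
    have hpq : p.HolderConjugate (Real.conjExponent p) := Real.HolderConjugate.conjExponent hp
    have hq : Real.conjExponent p < 2 := by
      rw [Real.conjExponent, div_lt_iff₀ (by linarith)]
      linarith
    obtain ⟨A', hA', h'⟩ := exists_strong_type_of_weak_type hA h hpq.symm.lt hq
    exact ⟨A' ^ (p / Real.conjExponent p),
      ENNReal.rpow_ne_top_of_nonneg (div_nonneg (by linarith) hpq.symm.nonneg) hA',
      hT'.strong_type hpq h2 h'⟩

/-! ### Bounded functions and `BMO` -/

/-- Smoothness in the first variable gives the integrand r^ε d(x₀,y)^(-N-ε), whose integral over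
d(x₀,y) ≥ R is of order (r/R)^ε. Used with x₀ = 0 and R = j for convergence, and with R = 2r for
mean oscillation. -/
theorem KernelBounds.exists_tail_bound [Finite G] {K : 𝔼 → 𝔼 → 𝕜} {C ε : ℝ}
    (hK : KernelBounds G K C ε) :
    ∃ D : ℝ, 0 ≤ D ∧ ∀ (x x₀ : 𝔼) (r R M : ℝ) (f : 𝔼 → 𝕜) (A : Set 𝔼), 0 < r → 2 * r ≤ R →
      orbitDist G x₀ x ≤ r → MeasurableSet A → (∀ y ∈ A, R ≤ orbitDist G x₀ y) →
      AEStronglyMeasurable f → (∀ᵐ y, ‖f y‖ ≤ M) → 0 ≤ M →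
      IntegrableOn (fun y => (K x y - K x₀ y) * f y) A ∧
        ‖∫ y in A, (K x y - K x₀ y) * f y‖ ≤ D * M * (r / R) ^ ε := by
  obtain ⟨A', hA', hdecay⟩ := exists_lintegral_orbitDist_rpow_le (G := G) hK.pos
  have hε := hK.pos
  have hC := hK.nonneg
  refine ⟨C * A'.toReal, by positivity, fun x x₀ r R M f A hr hrR hx hA hAR hf hfM hM => ?_⟩
  have hR : 0 < R := by linarith
  have hA0 : ∀ y ∈ A, orbitDist G x₀ y ≠ 0 := fun y hy => (hR.trans_le (hAR y hy)).ne'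
  have hA1 : ∀ y ∈ A, orbitDist G x y ≠ 0 := fun y hy => by
    have h1 := orbitDist_triangle (G := G) x₀ x y
    have h2 := hAR y hy
    exact (by linarith : 0 < orbitDist G x y).ne'
  have hmeas : AEStronglyMeasurable (fun y => (K x y - K x₀ y) * f y) (volume.restrict A) :=
    ((hK.aestronglyMeasurable_right x hA hA1).sub
      (hK.aestronglyMeasurable_right x₀ hA hA0)).mul hf.restrict
  have hle : ∫⁻ y in A, ‖(K x y - K x₀ y) * f y‖ₑ ≤
      ENNReal.ofReal (C * A'.toReal * M * (r / R) ^ ε) := by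
    calc ∫⁻ y in A, ‖(K x y - K x₀ y) * f y‖ₑ
        ≤ ∫⁻ y in A, ENNReal.ofReal (C * r ^ ε * M) *
            ENNReal.ofReal (1 / orbitDist G y x₀ ^ (N + ε)) := by
          refine setLIntegral_mono_ae' hA ?_
          filter_upwards [hfM] with y hy hyA
          have h0 : 0 ≤ orbitDist G x₀ y := orbitDist_nonneg G _ _
          have h1 := hAR y hyA
          have h2 : 0 ≤ orbitDist G x₀ x := orbitDist_nonneg G _ _
          rw [← ENNReal.ofReal_mul (by positivity), ← ofReal_norm]
          refine ENNReal.ofReal_le_ofReal ?_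
          rw [norm_mul, norm_sub_rev, orbitDist_comm y x₀]
          calc ‖K x₀ y - K x y‖ * ‖f y‖
              ≤ (C * (orbitDist G x₀ x ^ ε / orbitDist G x₀ y ^ (N + ε))) * M := by
                refine mul_le_mul (hK.smooth_left x₀ x y (hA0 y hyA) (by linarith)) hy
                  (norm_nonneg _) (by positivity)
            _ ≤ (C * (r ^ ε / orbitDist G x₀ y ^ (N + ε))) * M := by gcongr
            _ = C * r ^ ε * M * (1 / orbitDist G x₀ y ^ (N + ε)) := by ring
      _ = ENNReal.ofReal (C * r ^ ε * M) *
            ∫⁻ y in A, ENNReal.ofReal (1 / orbitDist G y x₀ ^ (N + ε)) :=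
          lintegral_const_mul' _ _ ENNReal.ofReal_ne_top
      _ ≤ ENNReal.ofReal (C * r ^ ε * M) * (A' * ENNReal.ofReal (R ^ (-ε))) := by
          gcongr
          refine (lintegral_mono_set fun y hy => ?_).trans (hdecay x₀ R hR)
          have := hAR y hy
          rwa [orbitDist_comm] at this
      _ = ENNReal.ofReal (C * A'.toReal * M * (r / R) ^ ε) := by
          rw [← ENNReal.ofReal_toReal hA', ← ENNReal.ofReal_mul ENNReal.toReal_nonneg,
            ← ENNReal.ofReal_mul (by positivity), ENNReal.toReal_ofReal ENNReal.toReal_nonneg,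
            Real.div_rpow hr.le hR.le, Real.rpow_neg hR.le]
          congr 1
          ring
  refine ⟨⟨hmeas, hle.trans_lt ENNReal.ofReal_lt_top⟩, ?_⟩
  rw [← ENNReal.ofReal_le_ofReal_iff (by positivity), ofReal_norm]
  exact (enorm_integral_le_lintegral_enorm _).trans hle

/-- The constant `∫_{1 ≤ d(0,y) ≤ j} K(0,y) f(y) dy`. -/
def originPotential (G : Subgroup (EuclideanSpace ℝ (Fin N) ≃ₗᵢ[ℝ] EuclideanSpace ℝ (Fin N)))
    (K : EuclideanSpace ℝ (Fin N) → EuclideanSpace ℝ (Fin N) → 𝕜)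
    (f : EuclideanSpace ℝ (Fin N) → 𝕜) (j : ℕ) : 𝕜 :=
  ∫ y in {y | 1 ≤ orbitDist G 0 y ∧ orbitDist G 0 y ≤ j}, K 0 y * f y

/-- The difference equals the integral of (K(x,y) - K(0,y)) f(y) over the shell j < |y| ≤ k, because
d(0,y) = |y|. The tail bound then gives a rate in j that does not depend on k. -/
theorem HasKernel.exists_norm_sub_le [Finite G] {K : 𝔼 → 𝔼 → 𝕜} {C ε : ℝ}
    (hK : KernelBounds G K C ε)
    {T : Lp 𝕜 2 (volume : Measure 𝔼) →L[𝕜] Lp 𝕜 2 (volume : Measure 𝔼)}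
    (hT : HasKernel G T K) :
    ∃ D : ℝ, 0 ≤ D ∧ ∀ (f : 𝔼 → 𝕜) (M : ℝ), AEStronglyMeasurable f → (∀ᵐ y, ‖f y‖ ≤ M) → 0 ≤ M →
      ∀ F : ℕ → Lp 𝕜 2 (volume : Measure 𝔼),
      (∀ j, F j =ᵐ[volume] (Metric.closedBall 0 (j : ℝ)).indicator f) →
      ∀ (j k : ℕ) (r : ℝ), 0 < r → 2 * r ≤ j → 1 ≤ j → j ≤ k → ∀ᵐ x, ‖x‖ ≤ r →
        ‖(T (F k) x - originPotential G K f k) - (T (F j) x - originPotential G K f j)‖ ≤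
          D * M * (r / j) ^ ε := by
  obtain ⟨D, hD, htail⟩ := hK.exists_tail_bound
  refine ⟨D, hD, fun f M hf hfM hM F hF j k r hr hrj hj hjk => ?_⟩
  have hj' : (1 : ℝ) ≤ j := by exact_mod_cast hj
  have hjk' : (j : ℝ) ≤ k := by exact_mod_cast hjk
  set A : Set 𝔼 := {y | (j : ℝ) < ‖y‖ ∧ ‖y‖ ≤ k} with hA
  have hAm : MeasurableSet A :=
    (measurableSet_lt measurable_const measurable_norm).inter
      (measurableSet_le measurable_norm measurable_const)
  have hSm : ∀ i : ℕ, MeasurableSet {y : 𝔼 | 1 ≤ orbitDist G 0 y ∧ orbitDist G 0 y ≤ i} := by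
    intro i
    simp only [orbitDist_zero_left]
    exact (measurableSet_le measurable_const measurable_norm).inter
      (measurableSet_le measurable_norm measurable_const)
  have hSint : ∀ i : ℕ, IntegrableOn (fun y => K 0 y * f y)
      {y : 𝔼 | 1 ≤ orbitDist G 0 y ∧ orbitDist G 0 y ≤ i} := by
    intro i
    have h1 : ∀ y ∈ {y : 𝔼 | 1 ≤ orbitDist G 0 y ∧ orbitDist G 0 y ≤ i}, orbitDist G 0 y ≠ 0 :=
      fun y hy => (zero_lt_one.trans_le hy.1).ne'
    refine IntegrableOn.of_bound ?_ ?_ (C * (1 / 1 ^ N) * M) ?_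
    · refine lt_of_le_of_lt (measure_mono fun y hy => ?_)
        (measure_closedBall_lt_top (x := (0 : 𝔼)) (r := i))
      have := hy.2
      rw [orbitDist_zero_left] at this
      simpa using this
    · exact (hK.aestronglyMeasurable_right 0 (hSm i) h1).mul hf.restrict
    · filter_upwards [ae_restrict_mem (hSm i), ae_restrict_of_ae hfM] with y hy hyM
      rw [norm_mul]
      exact mul_le_mul (hK.norm_le_of_le one_pos hy.1) hyM (norm_nonneg _)
        (by have := hK.nonneg; positivity)
  have hSk : {y : 𝔼 | 1 ≤ orbitDist G 0 y ∧ orbitDist G 0 y ≤ k} =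
      {y : 𝔼 | 1 ≤ orbitDist G 0 y ∧ orbitDist G 0 y ≤ j} ∪ A := by
    ext y
    simp only [hA, orbitDist_zero_left, Set.mem_ofPred_eq, Set.mem_union]
    constructor
    · rintro ⟨h1, h2⟩
      rcases le_or_gt ‖y‖ j with h | h
      · exact Or.inl ⟨h1, h⟩
      · exact Or.inr ⟨h, h2⟩
    · rintro (⟨h1, h2⟩ | ⟨h1, h2⟩)
      · exact ⟨h1, h2.trans hjk'⟩
      · exact ⟨by linarith, h2⟩
  have hAint : IntegrableOn (fun y => K 0 y * f y) A :=
    (hSint k).mono_set (hSk ▸ Set.subset_union_right)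
  have hc : originPotential G K f k - originPotential G K f j = ∫ y in A, K 0 y * f y := by
    rw [originPotential, originPotential, hSk, setIntegral_union ?_ hAm (hSint j) hAint,
      add_sub_cancel_left]
    rw [Set.disjoint_left]
    rintro y ⟨-, h1⟩ ⟨h2, -⟩
    rw [orbitDist_zero_left] at h1
    exact absurd h1 (not_le.2 h2)
  have hu : (F k - F j : Lp 𝕜 2 (volume : Measure 𝔼)) =ᵐ[volume] A.indicator f := by
    filter_upwards [hF k, hF j, Lp.coeFn_sub (F k) (F j)] with y h1 h2 h3
    rw [h3, Pi.sub_apply, h1, h2]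
    by_cases hyj : ‖y‖ ≤ j
    · have hyk : ‖y‖ ≤ k := hyj.trans hjk'
      simp [hA, hyj, hyk, not_lt.2 hyj]
    · by_cases hyk : ‖y‖ ≤ k <;> simp [hA, hyj, hyk, not_le.1 hyj]
  -- The shell is open on its inner side, so it is enlarged to a compact set; this still avoids the
  -- orbit of x, as |x| ≤ j/2.
  have hB : IsCompact (Metric.closedBall (0 : 𝔼) k ∩ {y | (j : ℝ) ≤ ‖y‖}) :=
    (isCompact_closedBall _ _).inter_right (isClosed_le continuous_const continuous_norm)
  have hker := hT (F k - F j) _ hB (by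
    filter_upwards [hu] with y hy hyB
    rw [hy]
    refine Set.indicator_of_notMem (fun hyA => hyB ⟨?_, hyA.1.le⟩) _
    simpa using hyA.2)
  rw [map_sub] at hker
  filter_upwards [hker, Lp.coeFn_sub (T (F k)) (T (F j))] with x hx hx' hxr
  have h1 := hx fun y hy h0 => by
    have h2 := orbitDist_triangle (G := G) 0 x y
    rw [orbitDist_zero_left, orbitDist_zero_left] at h2
    have h3 : (j : ℝ) ≤ ‖y‖ := hy.2
    linarith
  obtain ⟨ht1, ht2⟩ := htail x 0 r j M f A hr hrj (by rwa [orbitDist_zero_left]) hAm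
    (fun y hy => by rw [orbitDist_zero_left]; exact hy.1.le) hf hfM hM
  have hKx : IntegrableOn (fun y => K x y * f y) A := by
    refine (ht1.add hAint).congr_fun (fun y _ => ?_) hAm
    simp only [Pi.add_apply]
    ring
  have e1 : T (F k) x - T (F j) x = ∫ y in A, K x y * f y := by
    rw [hx', Pi.sub_apply] at h1
    rw [h1, ← integral_indicator hAm]
    refine integral_congr_ae ?_
    filter_upwards [hu] with y hy
    rw [hy]
    by_cases hyA : y ∈ A <;> simp [hyA]
  have e2 : (T (F k) x - originPotential G K f k) - (T (F j) x - originPotential G K f j) =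
      ∫ y in A, (K x y - K 0 y) * f y := by
    rw [sub_sub_sub_comm, e1, hc, ← integral_sub hKx hAint]
    simp_rw [sub_mul]
  rw [e2]
  exact ht2

/-- `β` is almost everywhere locally uniformly Cauchy, with an explicit rate. -/
def LocallyUniformlyCauchyAE (β : ℕ → EuclideanSpace ℝ (Fin N) → 𝕜) (D ε : ℝ) : Prop :=
  ∀ (j k : ℕ) (r : ℝ), 0 < r → 2 * r ≤ j → 1 ≤ j → j ≤ k →
    ∀ᵐ x, ‖x‖ ≤ r → ‖β k x - β j x‖ ≤ D * (r / j) ^ ε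

theorem tendsto_mul_div_rpow_atTop (D r : ℝ) {ε : ℝ} (hε : 0 < ε) :
    Tendsto (fun j : ℕ => D * (r / (j : ℝ)) ^ ε) atTop (𝓝 0) := by
  have h1 : Tendsto (fun j : ℕ => r / (j : ℝ)) atTop (𝓝 0) :=
    tendsto_const_div_atTop_nhds_zero_nat r
  have h2 := (h1.rpow_const (Or.inr hε.le)).const_mul D
  simpa [Real.zero_rpow hε.ne'] using h2

namespace LocallyUniformlyCauchyAE

variable {β : ℕ → EuclideanSpace ℝ (Fin N) → 𝕜} {D ε : ℝ}

theorem exists_limit (hβ : LocallyUniformlyCauchyAE β D ε) (hε : 0 < ε)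
    (hm : ∀ j, AEStronglyMeasurable (β j)) :
    ∃ b : 𝔼 → 𝕜, AEStronglyMeasurable b ∧ ∀ᵐ x, Tendsto (fun j => β j x) atTop (𝓝 (b x)) := by
  have key : ∀ᵐ x, ∃ l, Tendsto (fun j => β j x) atTop (𝓝 l) := by
    -- Only integer radii are used, so that the exceptional null sets form a countable family.
    have h : ∀ᵐ x, ∀ (j k n : ℕ), 1 ≤ n → 2 * n ≤ j → j ≤ k → ‖x‖ ≤ n →
        ‖β k x - β j x‖ ≤ D * ((n : ℝ) / j) ^ ε := by
      refine ae_all_iff.2 fun j => ae_all_iff.2 fun k => ae_all_iff.2 fun n => ?_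
      by_cases hn : 1 ≤ n ∧ 2 * n ≤ j ∧ j ≤ k
      · obtain ⟨h1, h2, h3⟩ := hn
        filter_upwards [hβ j k n (by exact_mod_cast h1) (by exact_mod_cast h2) (by omega) h3]
          with x hx _ _ _ hxn
        exact hx hxn
      · exact Eventually.of_forall fun x h1 h2 h3 => absurd ⟨h1, h2, h3⟩ hn
    filter_upwards [h] with x hx
    obtain ⟨n, hn⟩ := exists_nat_ge (max ‖x‖ 1)
    have hn1 : 1 ≤ n := by exact_mod_cast (le_max_right _ _).trans hn
    have hxn : ‖x‖ ≤ n := (le_max_left _ _).trans hn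
    refine cauchySeq_tendsto_of_complete (Metric.cauchySeq_iff'.2 fun δ hδ => ?_)
    have hlim := tendsto_mul_div_rpow_atTop D n hε
    obtain ⟨j, hj1, hj2⟩ := ((hlim.eventually_lt_const hδ).and
      (eventually_ge_atTop (2 * n))).exists
    refine ⟨j, fun k hk => ?_⟩
    rw [dist_eq_norm]
    exact (hx j k n hn1 hj2 hk hxn).trans_lt hj1
  classical
  refine ⟨fun x => if h : ∃ l, Tendsto (fun j => β j x) atTop (𝓝 l) then h.choose else 0, ?_, ?_⟩
  · refine aestronglyMeasurable_of_tendsto_ae atTop hm ?_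
    filter_upwards [key] with x hx
    rw [dif_pos hx]
    exact hx.choose_spec
  · filter_upwards [key] with x hx
    rw [dif_pos hx]
    exact hx.choose_spec

theorem norm_sub_limit_le (hβ : LocallyUniformlyCauchyAE β D ε) {b : 𝔼 → 𝕜}
    (hb : ∀ᵐ x, Tendsto (fun j => β j x) atTop (𝓝 (b x))) {j : ℕ} {r : ℝ} (hr : 0 < r)
    (hrj : 2 * r ≤ j) (hj : 1 ≤ j) :
    ∀ᵐ x, ‖x‖ ≤ r → ‖β j x - b x‖ ≤ D * (r / j) ^ ε := by
  have h : ∀ᵐ x, ∀ k : ℕ, j ≤ k → ‖x‖ ≤ r → ‖β k x - β j x‖ ≤ D * (r / j) ^ ε := by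
    refine ae_all_iff.2 fun k => ?_
    by_cases hk : j ≤ k
    · filter_upwards [hβ j k r hr hrj hj hk] with x hx _ hxr
      exact hx hxr
    · exact Eventually.of_forall fun x h => absurd h hk
  filter_upwards [h, hb] with x hx hbx hxr
  rw [norm_sub_rev]
  refine le_of_tendsto (hbx.sub_const (β j x)).norm ?_
  filter_upwards [eventually_ge_atTop j] with k hk
  exact hx k hk hxr

theorem tendsto_eLpNorm_sub (hβ : LocallyUniformlyCauchyAE β D ε) (hε : 0 < ε) {b : 𝔼 → 𝕜}
    (hb : ∀ᵐ x, Tendsto (fun j => β j x) atTop (𝓝 (b x))) (r : ℝ) :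
    Tendsto (fun j => eLpNorm (fun x => β j x - b x) ∞ (volume.restrict (Metric.closedBall 0 r)))
      atTop (𝓝 0) := by
  obtain ⟨n, hn⟩ := exists_nat_ge (max r 1)
  have hn1 : 1 ≤ n := by exact_mod_cast (le_max_right _ _).trans hn
  have hrn : r ≤ n := (le_max_left _ _).trans hn
  have hlim : Tendsto (fun j : ℕ => ENNReal.ofReal (D * ((n : ℝ) / j) ^ ε)) atTop (𝓝 0) := by
    have := (ENNReal.continuous_ofReal.tendsto 0).comp (tendsto_mul_div_rpow_atTop D n hε)
    rw [ENNReal.ofReal_zero] at this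
    exact this
  refine tendsto_of_tendsto_of_tendsto_of_le_of_le' tendsto_const_nhds hlim
    (Eventually.of_forall fun _ => zero_le) ?_
  filter_upwards [eventually_ge_atTop (2 * n)] with j hj
  rw [eLpNorm_exponent_top]
  refine eLpNormEssSup_le_of_ae_bound ?_
  rw [ae_restrict_iff' measurableSet_closedBall]
  filter_upwards [hβ.norm_sub_limit_le hb (by exact_mod_cast hn1 : (0 : ℝ) < n)
    (by exact_mod_cast hj : 2 * (n : ℝ) ≤ j) (by omega)] with x hx hxr
  exact hx ((mem_closedBall_zero_iff.1 hxr).trans hrn)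

theorem locallyIntegrable_limit (hβ : LocallyUniformlyCauchyAE β D ε)
    (hint : ∀ j, LocallyIntegrable (β j)) {b : 𝔼 → 𝕜} (hbm : AEStronglyMeasurable b)
    (hb : ∀ᵐ x, Tendsto (fun j => β j x) atTop (𝓝 (b x))) : LocallyIntegrable b := by
  refine locallyIntegrable_iff.2 fun A hA => ?_
  obtain ⟨R, hR⟩ := hA.isBounded.subset_closedBall 0
  obtain ⟨n, hn⟩ := exists_nat_ge (max R 1)
  have hn1 : 1 ≤ n := by exact_mod_cast (le_max_right _ _).trans hn
  have hRn : R ≤ n := (le_max_left _ _).trans hn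
  refine IntegrableOn.mono_set (t := Metric.closedBall (0 : 𝔼) n) ?_
    (hR.trans (Metric.closedBall_subset_closedBall hRn))
  -- The index 2n is the first for which the rate applies on the ball of radius n; there β differs
  -- from its limit by a bounded function.
  have h1 : IntegrableOn (β (2 * n)) (Metric.closedBall 0 n) :=
    (hint (2 * n)).integrableOn_isCompact (isCompact_closedBall _ _)
  have h2 : IntegrableOn (fun x => β (2 * n) x - b x) (Metric.closedBall 0 n) := by
    refine IntegrableOn.of_bound measure_closedBall_lt_top
      ((hint (2 * n)).aestronglyMeasurable.sub hbm).restrict (D * ((n : ℝ) / (2 * n : ℕ)) ^ ε) ?_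
    rw [ae_restrict_iff' measurableSet_closedBall]
    filter_upwards [hβ.norm_sub_limit_le hb (by exact_mod_cast hn1 : (0 : ℝ) < n)
      (by push_cast; exact le_rfl : 2 * (n : ℝ) ≤ (2 * n : ℕ)) (by omega)] with x hx hxr
    exact hx (mem_closedBall_zero_iff.1 hxr)
  refine (h1.sub h2).congr (Eventually.of_forall fun x => ?_)
  simp

end LocallyUniformlyCauchyAE

/-! ### Mean oscillation of the limit -/

theorem lintegral_enorm_sub_average_le {b : 𝔼 → 𝕜} {B : Set 𝔼} (hB : volume B ≠ 0)
    (hB' : volume B ≠ ∞) (hb : IntegrableOn b B) (a : 𝕜) :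
    ∫⁻ y in B, ‖b y - ⨍ z in B, b z‖ₑ ≤ 2 * ∫⁻ y in B, ‖b y - a‖ₑ := by
  have hba : IntegrableOn (fun y => b y - a) B := hb.sub (integrableOn_const hB')
  have hmean : ⨍ z in B, b z - a = (⨍ z in B, b z) - a := by
    rw [setAverage_eq, setAverage_eq, integral_sub hb (integrableOn_const hB'), smul_sub,
      setIntegral_const, smul_smul, inv_mul_cancel₀, one_smul]
    rw [Ne, measureReal_eq_zero_iff hB']
    exact hB
  have h1 : ‖a - ⨍ z in B, b z‖ₑ * volume B ≤ ∫⁻ y in B, ‖b y - a‖ₑ := by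
    rw [← enorm_neg, neg_sub, ← hmean, setAverage_eq, enorm_smul, mul_right_comm]
    have e1 : ‖(volume.real B)⁻¹‖ₑ * volume B = 1 := by
      have h0 : 0 < volume.real B := ENNReal.toReal_pos hB hB'
      rw [Real.enorm_of_nonneg (by positivity), ENNReal.ofReal_inv_of_pos h0,
        ofReal_measureReal hB', ENNReal.inv_mul_cancel hB hB']
    rw [e1, one_mul]
    exact enorm_integral_le_lintegral_enorm _
  calc ∫⁻ y in B, ‖b y - ⨍ z in B, b z‖ₑ
      ≤ ∫⁻ y in B, (‖b y - a‖ₑ + ‖a - ⨍ z in B, b z‖ₑ) := by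
        refine lintegral_mono fun y => ?_
        rw [← sub_add_sub_cancel (b y) a]
        exact enorm_add_le _ _
    _ = (∫⁻ y in B, ‖b y - a‖ₑ) + ‖a - ⨍ z in B, b z‖ₑ * volume B := by
        rw [lintegral_add_left' hba.1.enorm, setLIntegral_const]
    _ ≤ _ := by
        rw [two_mul]
        gcongr

/-- A substitute for the Cauchy–Schwarz inequality on a ball: it converts an `L²` bound of size
M²|B| into an `L¹` bound of size M|B|. -/
theorem enorm_le_add_enorm_sq_div {M : ℝ≥0∞} (hM : M ≠ 0) (hM' : M ≠ ∞) (z : 𝕜) :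
    ‖z‖ₑ ≤ M + M⁻¹ * ‖z‖ₑ ^ 2 := by
  rcases le_total ‖z‖ₑ M with h | h
  · exact h.trans le_self_add
  · refine le_add_left ?_
    rw [pow_two, ← mul_assoc]
    refine le_mul_of_one_le_left zero_le ?_
    rw [← ENNReal.inv_mul_cancel hM hM']
    gcongr

set_option maxHeartbeats 1000000 in
-- On B(x₀,r) the limit is compared with a constant in three steps: b differs from a suitable
-- truncation by D₁M, the part of f outside the orbit ball of radius 2r oscillates by at most D₂M
-- about its potential at x₀, and the part inside is handled by the `L²` bound and the volume of the
-- orbit ball, which gives 1 + q. Replacing the constant by the mean costs the factor 2.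
theorem HasKernel.exists_bmoNorm_le [Finite G] {K : 𝔼 → 𝔼 → 𝕜} {C ε : ℝ}
    (hK : KernelBounds G K C ε)
    {T : Lp 𝕜 2 (volume : Measure 𝔼) →L[𝕜] Lp 𝕜 2 (volume : Measure 𝔼)}
    (hT : HasKernel G T K) :
    ∃ Q : ℝ, 0 ≤ Q ∧ ∀ (f : 𝔼 → 𝕜) (M : ℝ), AEStronglyMeasurable f → (∀ᵐ y, ‖f y‖ ≤ M) → 0 < M →
      ∀ F : ℕ → Lp 𝕜 2 (volume : Measure 𝔼),
      (∀ j, F j =ᵐ[volume] (Metric.closedBall 0 (j : ℝ)).indicator f) →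
      ∀ b : 𝔼 → 𝕜, LocallyIntegrable b →
      (∀ᵐ x, Tendsto (fun j => T (F j) x - originPotential G K f j) atTop (𝓝 (b x))) →
      bmoNorm b ≤ ENNReal.ofReal (Q * M) := by
  obtain ⟨D₁, hD₁, hcauchy⟩ := hT.exists_norm_sub_le hK
  obtain ⟨D₂, hD₂, htail⟩ := hK.exists_tail_bound
  have hε := hK.pos
  set q : ℝ := ‖T‖ ^ 2 * (Nat.card G * 2 ^ N) with hq
  refine ⟨2 * (D₁ + D₂ + (1 + q)), by positivity, fun f M hf hfM hM F hF b hb hblim => ?_⟩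
  have hβ : LocallyUniformlyCauchyAE (fun j x => T (F j) x - originPotential G K f j)
      (D₁ * M) ε := fun j k r hr hrj hj hjk =>
    hcauchy f M hf hfM hM.le F hF j k r hr hrj hj hjk
  refine iSup_le fun x₀ => iSup_le fun r => iSup_le fun hr => ?_
  set B : Set 𝔼 := Metric.ball x₀ r with hB
  have hB0 : volume B ≠ 0 := (Metric.measure_ball_pos volume x₀ hr).ne'
  have hB1 : volume B ≠ ∞ := measure_ball_lt_top.ne
  have hBm : MeasurableSet B := measurableSet_ball
  have hbB : IntegrableOn b B :=
    (hb.integrableOn_isCompact (isCompact_closedBall x₀ r)).mono_set Metric.ball_subset_closedBall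
  obtain ⟨n, hn⟩ := exists_nat_ge (max (‖x₀‖ + r) 1)
  have hn1 : 1 ≤ n := by exact_mod_cast (le_max_right _ _).trans hn
  have hxn : ‖x₀‖ + r ≤ n := (le_max_left _ _).trans hn
  have hBn : ∀ x ∈ B, ‖x‖ ≤ n := fun x hx => by
    have h1 : ‖x - x₀‖ < r := by simpa [hB, dist_eq_norm] using hx
    have h2 := norm_add_le x₀ (x - x₀)
    rw [add_sub_cancel] at h2
    linarith
  -- B lies in the ball of radius n, so at index 2n the distance to the limit is at most D₁M (1/2)^ε
  -- there, whatever the position and size of B.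
  set j : ℕ := 2 * n with hj
  -- splitting of the truncated function
  set O : Set 𝔼 := orbitBall G x₀ (2 * r) with hO
  have hOm : MeasurableSet O := (isClosed_orbitBall x₀ _).measurableSet
  have hL1 : MemLp (O.indicator fun x => F j x) 2 := (Lp.memLp (F j)).indicator hOm
  have hL2 : MemLp (Oᶜ.indicator fun x => F j x) 2 := (Lp.memLp (F j)).indicator hOm.compl
  have hF1 := hL1.coeFn_toLp
  have hF2 := hL2.coeFn_toLp
  set F₁ := hL1.toLp with hF₁def
  set F₂ := hL2.toLp with hF₂def
  have hsum : F j = F₁ + F₂ := by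
    refine Lp.ext ?_
    filter_upwards [hF1, hF2, Lp.coeFn_add F₁ F₂] with x h1 h2 h3
    rw [h3, Pi.add_apply, h1, h2]
    by_cases hx : x ∈ O <;> simp [hx]
  have hFM : ∀ᵐ y, ‖F j y‖ ≤ M := by
    filter_upwards [hF j, hfM] with y h1 h2
    rw [h1]
    exact (norm_indicator_le_norm_self f y).trans h2
  -- the far part
  have hF2M : ∀ᵐ y, ‖F₂ y‖ ≤ M := by
    filter_upwards [hF2, hFM] with y h1 h2
    rw [h1]
    exact (norm_indicator_le_norm_self _ y).trans h2
  set E : Set 𝔼 := Metric.closedBall (0 : 𝔼) j ∩ {y | 2 * r ≤ orbitDist G x₀ y} with hE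
  have hEc : IsCompact E := (isCompact_closedBall _ _).inter_right
    (isClosed_le continuous_const (continuous_orbitDist_right x₀))
  have hEd : ∀ y ∈ E, 2 * r ≤ orbitDist G x₀ y := fun y hy => hy.2
  have hF2E : ∀ᵐ y, y ∉ E → F₂ y = 0 := by
    filter_upwards [hF2, hF j] with y h1 h2 hyE
    rw [h1]
    by_cases hy : y ∈ O
    · simp [hy]
    · rw [Set.indicator_of_mem (by simpa using hy), h2]
      refine Set.indicator_of_notMem (fun hy' => hyE ⟨hy', ?_⟩) _
      simp only [hO, orbitBall, Set.mem_ofPred_eq, not_le] at hy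
      exact hy.le
  have hF2int := integrable_of_compact_support hEc hF2E
  have hindE : ∀ x, ∫ y, K x y * F₂ y = ∫ y in E, K x y * F₂ y := fun x => by
    rw [← integral_indicator hEc.measurableSet]
    refine integral_congr_ae ?_
    filter_upwards [hF2E] with y hy
    by_cases hyE : y ∈ E <;> simp [hyE, hy]
  set a : 𝕜 := ∫ y, K x₀ y * F₂ y with ha
  have hfar : ∀ᵐ x, x ∈ B → ‖T F₂ x - a‖ ≤ D₂ * M := by
    filter_upwards [hT F₂ E hEc hF2E] with x hx hxB
    have hxr : orbitDist G x₀ x ≤ r := by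
      refine (orbitDist_le_norm_sub _ _).trans ?_
      rw [norm_sub_rev, ← dist_eq_norm]
      exact (Metric.mem_ball.1 hxB).le
    have hxE : ∀ y ∈ E, r ≤ orbitDist G x y := fun y hy => by
      have h1 := orbitDist_triangle (G := G) x₀ x y
      have h2 := hEd y hy
      linarith
    have hx1 := hx fun y hy => (hr.trans_le (hxE y hy)).ne'
    obtain ⟨-, h2⟩ := htail x x₀ r (2 * r) M (fun y => F₂ y) E hr le_rfl hxr hEc.measurableSet hEd
      (Lp.aestronglyMeasurable F₂) hF2M hM.le
    have hi1 := hK.integrable_mul hEc.measurableSet hr hxE hF2int hF2E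
    have hi2 := hK.integrable_mul hEc.measurableSet (by positivity : 0 < 2 * r) hEd hF2int hF2E
    have e1 : T F₂ x - a = ∫ y in E, (K x y - K x₀ y) * F₂ y := by
      rw [hx1, ha, hindE, hindE, ← integral_sub hi1.integrableOn hi2.integrableOn]
      simp_rw [sub_mul]
    rw [e1]
    refine h2.trans (mul_le_of_le_one_right (by positivity) ?_)
    refine Real.rpow_le_one (by positivity) ?_ hε.le
    rw [div_le_one (by positivity)]
    linarith
  -- the local part
  set m : ℝ≥0∞ := ENNReal.ofReal M with hm
  have hm0 : m ≠ 0 := (ENNReal.ofReal_pos.2 hM).ne'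
  have hm1 : m ≠ ∞ := ENNReal.ofReal_ne_top
  have hvolO : volume O ≤ ENNReal.ofReal (Nat.card G * 2 ^ N) * volume B := by
    have e1 : volume (Metric.closedBall x₀ r) = volume B :=
      by rw [volume_closedBall_eq x₀ hr.le, hB, volume_ball_eq x₀ hr]
    refine (volume_orbitBall_le x₀ _).trans (le_of_eq ?_)
    rw [volume_closedBall_mul x₀ x₀ hr.le (by norm_num), e1, ENNReal.ofReal_mul (by positivity),
      ENNReal.ofReal_natCast, mul_assoc]
  have hlocal : ∫⁻ x in B, ‖T F₁ x‖ₑ ≤ ENNReal.ofReal ((1 + q) * M) * volume B := by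
    have h1 : ∫⁻ x, ‖F₁ x‖ₑ ^ 2 ≤ m ^ 2 * volume O := by
      rw [← setLIntegral_const, ← lintegral_indicator hOm]
      refine lintegral_mono_ae ?_
      filter_upwards [hF1, hFM] with y h1 h2
      rw [h1]
      by_cases hy : y ∈ O
      · rw [Set.indicator_of_mem hy, Set.indicator_of_mem hy, ← ofReal_norm]
        exact pow_le_pow_left₀ zero_le (ENNReal.ofReal_le_ofReal h2) 2
      · simp [hy]
    calc ∫⁻ x in B, ‖T F₁ x‖ₑ ≤ ∫⁻ x in B, (m + m⁻¹ * ‖T F₁ x‖ₑ ^ 2) :=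
          lintegral_mono fun x => enorm_le_add_enorm_sq_div hm0 hm1 _
      _ = m * volume B + m⁻¹ * ∫⁻ x in B, ‖T F₁ x‖ₑ ^ 2 := by
          rw [lintegral_add_left measurable_const, setLIntegral_const,
            lintegral_const_mul' _ _ (ENNReal.inv_ne_top.2 hm0)]
      _ ≤ m * volume B + m⁻¹ * (‖T‖ₑ ^ 2 * (m ^ 2 *
            (ENNReal.ofReal (Nat.card G * 2 ^ N) * volume B))) := by
          gcongr
          refine (setLIntegral_le_lintegral _ _).trans ((lintegral_enorm_sq_apply_le T F₁).trans ?_)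
          gcongr
          exact h1.trans (by gcongr)
      _ = (m⁻¹ * m) * m * (‖T‖ₑ ^ 2 * ENNReal.ofReal (Nat.card G * 2 ^ N)) * volume B +
            m * volume B := by ring
      _ = ENNReal.ofReal ((1 + q) * M) * volume B := by
          rw [ENNReal.inv_mul_cancel hm0 hm1, one_mul, ← ofReal_norm,
            ← ENNReal.ofReal_pow (norm_nonneg _), ← ENNReal.ofReal_mul (by positivity), ← hq, hm,
            ← ENNReal.ofReal_mul hM.le, ← add_mul, ← ENNReal.ofReal_add (by positivity) hM.le]
          congr 2
          ring
  -- conclusion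
  have hosc : ∫⁻ x in B, ‖b x - (a - originPotential G K f j)‖ₑ ≤
      ENNReal.ofReal ((D₁ + D₂ + (1 + q)) * M) * volume B := by
    have hpt : ∀ᵐ x, x ∈ B → ‖b x - (a - originPotential G K f j)‖ₑ ≤
        ENNReal.ofReal (D₁ * M + D₂ * M) + ‖T F₁ x‖ₑ := by
      have hTsum : T (F j) = T F₁ + T F₂ := by rw [hsum, map_add]
      filter_upwards [hfar, hβ.norm_sub_limit_le hblim (by exact_mod_cast hn1 : (0 : ℝ) < n)
        (by rw [hj]; push_cast; exact le_rfl) (by omega : 1 ≤ j), Lp.coeFn_add (T F₁) (T F₂)]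
        with x h1 h2 h3 hxB
      have h1 := h1 hxB
      have h2 := (h2 (hBn x hxB)).trans (mul_le_of_le_one_right (by positivity)
        (Real.rpow_le_one (by positivity) (by
          have h0 : (1 : ℝ) ≤ n := by exact_mod_cast hn1
          rw [hj]
          push_cast
          rw [div_le_one (by positivity)]
          linarith) hε.le))
      rw [hTsum, h3, Pi.add_apply] at h2
      rw [← ofReal_norm (T F₁ x), ← ENNReal.ofReal_add (by positivity) (norm_nonneg _),
        ← ofReal_norm]
      refine ENNReal.ofReal_le_ofReal ?_
      have e1 : b x - (a - originPotential G K f j) =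
          -(T F₁ x + T F₂ x - originPotential G K f j - b x) + (T F₂ x - a) + T F₁ x := by ring
      rw [e1]
      refine (norm_add₃_le).trans ?_
      rw [norm_neg]
      linarith
    calc ∫⁻ x in B, ‖b x - (a - originPotential G K f j)‖ₑ
        ≤ ∫⁻ x in B, (ENNReal.ofReal (D₁ * M + D₂ * M) + ‖T F₁ x‖ₑ) :=
          setLIntegral_mono_ae' hBm hpt
      _ = ENNReal.ofReal (D₁ * M + D₂ * M) * volume B + ∫⁻ x in B, ‖T F₁ x‖ₑ := by
          rw [lintegral_add_left measurable_const, setLIntegral_const]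
      _ ≤ ENNReal.ofReal (D₁ * M + D₂ * M) * volume B +
            ENNReal.ofReal ((1 + q) * M) * volume B := by gcongr
      _ = _ := by
          rw [← add_mul, ← ENNReal.ofReal_add (by positivity) (by positivity)]
          congr 2
          ring
  refine ENNReal.div_le_of_le_mul ?_
  refine (lintegral_enorm_sub_average_le hB0 hB1 hbB (a - originPotential G K f j)).trans ?_
  calc 2 * ∫⁻ x in B, ‖b x - (a - originPotential G K f j)‖ₑ
      ≤ 2 * (ENNReal.ofReal ((D₁ + D₂ + (1 + q)) * M) * volume B) := by gcongr
    _ = ENNReal.ofReal (2 * (D₁ + D₂ + (1 + q)) * M) * volume B := by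
        rw [mul_assoc 2, ENNReal.ofReal_mul (by norm_num : (0 : ℝ) ≤ 2), ENNReal.ofReal_ofNat,
          mul_assoc]

/-! ### Finiteness of the reflection group -/

theorem rootReflection_apply_of_inner_eq_zero {α x : 𝔼} (h : inner ℝ α x = 0) :
    rootReflection α x = x := by
  rw [rootReflection_apply, h]
  simp

/-- Every element of the group permutes R and fixes the orthogonal complement of the span of R
pointwise, both properties being inherited from the reflections. By linearity it is determined by
its permutation of the finite set R. -/
theorem IsNormalizedRootSystem.finite_reflectionGroup {R : Set (EuclideanSpace ℝ (Fin N))}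
    (hR : IsNormalizedRootSystem R) : Finite (reflectionGroup R) := by
  have himage : ∀ σ ∈ reflectionGroup R, (fun x => σ x) '' R = R := by
    intro σ hσ
    induction hσ using Subgroup.closure_induction with
    | mem σ h =>
      obtain ⟨α, hα, rfl⟩ := h
      exact hR.reflection_image α hα
    | one => simp
    | mul σ τ _ _ h1 h2 =>
      conv_rhs => rw [← h1, ← h2]
      rw [Set.image_image]
      rfl
    | inv σ _ h =>
      conv_lhs => rw [← h]
      rw [Set.image_image]
      simp
  have hfix : ∀ σ ∈ reflectionGroup R, ∀ x ∈ (Submodule.span ℝ R)ᗮ, σ x = x := by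
    intro σ hσ
    induction hσ using Subgroup.closure_induction with
    | mem σ h =>
      obtain ⟨α, hα, rfl⟩ := h
      intro x hx
      exact rootReflection_apply_of_inner_eq_zero
        ((Submodule.mem_orthogonal _ _).1 hx α (Submodule.subset_span hα))
    | one => exact fun _ _ => rfl
    | mul σ τ _ _ h1 h2 =>
      intro x hx
      rw [LinearIsometryEquiv.coe_mul, Function.comp_apply, h2 x hx, h1 x hx]
    | inv σ _ h =>
      intro x hx
      conv_lhs => rw [← h x hx]
      exact σ.symm_apply_apply x
  have : Finite R := hR.finite
  have hmaps : ∀ (σ : reflectionGroup R) (α : R), σ.1 α.1 ∈ R := fun σ α => by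
    refine (himage σ.1 σ.2).subset ?_
    exact ⟨α.1, α.2, rfl⟩
  refine Finite.of_injective (fun (σ : reflectionGroup R) (α : R) => (⟨σ.1 α.1, hmaps σ α⟩ : R)) ?_
  intro σ τ h
  have hspan : Set.EqOn (σ.1.toLinearEquiv : 𝔼 →ₗ[ℝ] 𝔼) (τ.1.toLinearEquiv : 𝔼 →ₗ[ℝ] 𝔼)
      (Submodule.span ℝ R : Set 𝔼) := by
    refine LinearMap.eqOn_span fun α hα => ?_
    exact congrArg Subtype.val (congrFun h ⟨α, hα⟩)
  refine Subtype.ext (LinearIsometryEquiv.ext fun x => ?_)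
  obtain ⟨y, hy, z, hz, rfl⟩ := (Submodule.span ℝ R).exists_add_mem_mem_orthogonal x
  have h1 : σ.1 y = τ.1 y := hspan hy
  rw [map_add, map_add, h1, hfix σ.1 σ.2 z hz, hfix τ.1 τ.2 z hz]

/-! ### Averages over the group -/

variable (G) in
/-- The mean of `g` over the orbits of `G`. -/
def groupAverage (g : EuclideanSpace ℝ (Fin N) → 𝕜) (x : EuclideanSpace ℝ (Fin N)) : 𝕜 :=
  (Nat.card G : 𝕜)⁻¹ * ∑ᶠ σ : G, g (σ.1 x)

theorem groupAverage_apply_of_mem [Finite G] (g : 𝔼 → 𝕜)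
    {τ : EuclideanSpace ℝ (Fin N) ≃ₗᵢ[ℝ] EuclideanSpace ℝ (Fin N)} (hτ : τ ∈ G) (x : 𝔼) :
    groupAverage G g (τ x) = groupAverage G g x := by
  unfold groupAverage
  congr 1
  exact finsum_comp_equiv (Equiv.mulRight (⟨τ, hτ⟩ : G)) (f := fun σ : G => g (σ.1 x))

theorem groupAverage_sub [Finite G] (g : 𝔼 → 𝕜) (x y : 𝔼) :
    groupAverage G g x - groupAverage G g y =
      (Nat.card G : 𝕜)⁻¹ * ∑ᶠ σ : G, (g (σ.1 x) - g (σ.1 y)) := by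
  rw [groupAverage, groupAverage, ← mul_sub, finsum_sub_distrib (Set.toFinite _) (Set.toFinite _)]

theorem groupAverage_eq_zero {g : 𝔼 → 𝕜} {x : 𝔼} (h : ∀ σ ∈ G, g (σ x) = 0) :
    groupAverage G g x = 0 := by
  have : ∀ σ : G, g (σ.1 x) = 0 := fun σ => h σ.1 σ.2
  simp [groupAverage, this]

theorem continuous_groupAverage [Finite G] {g : 𝔼 → 𝕜} (hg : Continuous g) :
    Continuous (groupAverage G g) := by
  have := Fintype.ofFinite G
  unfold groupAverage
  simp_rw [finsum_eq_sum_of_fintype]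
  exact continuous_const.mul (continuous_finsetSum _ fun σ _ => hg.comp σ.1.continuous)

theorem hasCompactSupport_groupAverage {g : 𝔼 → 𝕜} (hg : HasCompactSupport g) :
    HasCompactSupport (groupAverage G g) := by
  obtain ⟨R, hR⟩ := hg.isBounded.subset_closedBall 0
  refine HasCompactSupport.intro (isCompact_closedBall 0 R) fun x hx => ?_
  refine groupAverage_eq_zero fun σ _ => image_eq_zero_of_notMem_tsupport fun h => hx ?_
  have := hR h
  simpa using this

/-- The average takes the same value at y and at the point τ(y) nearest to x, so orbit distance may
be replaced by Euclidean distance. The Lipschitz bound serves for d ≤ 1, where d ≤ d^η, and the sup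
bound for d ≥ 1. -/
theorem groupAverage_mem_holderC [Finite G] {g : 𝔼 → 𝕜} {η : ℝ} (hη : 0 < η)
    (hη1 : η ≤ 1) (hg : Continuous g) (hgc : HasCompactSupport g) {L : ℝ} (hL : 0 ≤ L)
    (hgL : ∀ x y, ‖g x - g y‖ ≤ L * ‖x - y‖) : groupAverage G g ∈ HolderC 𝕜 G η := by
  have := Fintype.ofFinite G
  refine ⟨continuous_groupAverage hg, hasCompactSupport_groupAverage hgc, ?_⟩
  obtain ⟨M, hM⟩ := hgc.exists_bound_of_continuous hg
  have hM0 : 0 ≤ M := (norm_nonneg _).trans (hM 0)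
  refine ⟨L + 2 * M, by positivity, fun x y => ?_⟩
  obtain ⟨τ, hτ, hd⟩ := exists_orbitDist_eq (G := G) x y
  have hd0 : 0 ≤ orbitDist G x y := orbitDist_nonneg G _ _
  have hrot : ∀ σ : G, ‖g (σ.1 x) - g (σ.1 (τ y))‖ ≤ (L + 2 * M) * orbitDist G x y ^ η := by
    intro σ
    rcases le_total (orbitDist G x y) 1 with h | h
    · calc ‖g (σ.1 x) - g (σ.1 (τ y))‖ ≤ L * ‖σ.1 x - σ.1 (τ y)‖ := hgL _ _
        _ = L * orbitDist G x y := by rw [← map_sub, σ.1.norm_map, hd]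
        _ ≤ L * orbitDist G x y ^ η := by
            gcongr
            simpa using Real.rpow_le_rpow_of_exponent_ge_of_imp hd0 h hη1 (fun _ h => by linarith)
        _ ≤ _ := by gcongr; linarith
    · calc ‖g (σ.1 x) - g (σ.1 (τ y))‖ ≤ M + M := norm_sub_le_of_le (hM _) (hM _)
        _ ≤ (L + 2 * M) * 1 := by linarith
        _ ≤ _ := by gcongr; exact Real.one_le_rpow h hη.le
  rw [← groupAverage_apply_of_mem g hτ y, groupAverage_sub]
  have hc : (0 : ℝ) < Nat.card G := by exact_mod_cast Nat.card_pos
  rw [norm_mul, norm_inv, RCLike.norm_natCast, inv_mul_le_iff₀ hc, finsum_eq_sum_of_fintype]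
  refine (norm_sum_le_of_le _ fun σ _ => hrot σ).trans ?_
  simp [Nat.card_eq_fintype_card]

/-- Each σ preserves the measure and w, so all terms of the average have the same integral. -/
theorem integral_mul_groupAverage [Finite G] {w g : 𝔼 → 𝕜} (hw : AEInvariant G w)
    (h : Integrable (fun x => w x * g x)) :
    ∫ x, w x * groupAverage G g x = ∫ x, w x * g x := by
  have := Fintype.ofFinite G
  have hc : (Nat.card G : 𝕜) ≠ 0 := by exact_mod_cast Nat.card_pos.ne'
  have hae : ∀ σ : G, (fun x => w (σ.1 x) * g (σ.1 x)) =ᵐ[volume] fun x => w x * g (σ.1 x) := by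
    intro σ
    filter_upwards [hw σ.1 σ.2] with x hx
    rw [hx]
  have hi : ∀ σ : G, Integrable (fun x => w x * g (σ.1 x)) := fun σ =>
    (σ.1.measurePreserving.integrable_comp_of_integrable h).congr (hae σ)
  have hint : ∀ σ : G, ∫ x, w x * g (σ.1 x) = ∫ x, w x * g x := fun σ => by
    rw [← integral_congr_ae (hae σ)]
    exact σ.1.measurePreserving.integral_comp σ.1.toHomeomorph.measurableEmbedding
      (fun x => w x * g x)
  calc ∫ x, w x * groupAverage G g x
      = ∫ x, (Nat.card G : 𝕜)⁻¹ * ∑ σ : G, w x * g (σ.1 x) := by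
        refine integral_congr_ae (Eventually.of_forall fun x => ?_)
        simp only [groupAverage, finsum_eq_sum_of_fintype, ← Finset.mul_sum]
        ring
    _ = ∫ x, w x * g x := by
        rw [integral_const_mul, integral_finsetSum _ fun σ _ => hi σ]
        simp_rw [hint]
        rw [Finset.sum_const, Finset.card_univ, ← Nat.card_eq_fintype_card, nsmul_eq_mul,
          inv_mul_cancel_left₀ hc]

/-! ### Orbit saturations, and kernel integrals of averaged functions -/

variable (G) in
/-- The union of the orbits of the points of `A`. -/
def orbitSaturation (A : Set (EuclideanSpace ℝ (Fin N))) : Set (EuclideanSpace ℝ (Fin N)) :=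
  ⋃ σ : G, (fun x => σ.1 x) '' A

theorem isCompact_orbitSaturation [Finite G] {A : Set 𝔼} (hA : IsCompact A) :
    IsCompact (orbitSaturation G A) :=
  isCompact_iUnion fun σ => hA.image σ.1.continuous

theorem mem_orbitSaturation {A : Set 𝔼} {x : 𝔼} :
    x ∈ orbitSaturation G A ↔ ∃ σ ∈ G, σ x ∈ A := by
  simp only [orbitSaturation, Set.mem_iUnion, Set.mem_image]
  constructor
  · rintro ⟨σ, y, hy, rfl⟩
    refine ⟨σ.1⁻¹, G.inv_mem σ.2, ?_⟩
    have : σ.1⁻¹ (σ.1 y) = y := σ.1.symm_apply_apply y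
    rwa [this]
  · rintro ⟨σ, hσ, h⟩
    exact ⟨⟨σ⁻¹, G.inv_mem hσ⟩, σ x, h, σ.symm_apply_apply x⟩

theorem apply_mem_orbitSaturation {A : Set 𝔼}
    {τ : EuclideanSpace ℝ (Fin N) ≃ₗᵢ[ℝ] EuclideanSpace ℝ (Fin N)} (hτ : τ ∈ G) {x : 𝔼} :
    τ x ∈ orbitSaturation G A ↔ x ∈ orbitSaturation G A := by
  rw [mem_orbitSaturation, mem_orbitSaturation]
  constructor
  · rintro ⟨σ, hσ, h⟩
    exact ⟨σ * τ, G.mul_mem hσ hτ, h⟩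
  · rintro ⟨σ, hσ, h⟩
    refine ⟨σ * τ⁻¹, G.mul_mem hσ (G.inv_mem hτ), ?_⟩
    have : (σ * τ⁻¹) (τ x) = σ x := congrArg σ (τ.symm_apply_apply x)
    rwa [this]

theorem groupAverage_eq_zero_of_notMem {g : 𝔼 → 𝕜} {A : Set 𝔼} (hg : ∀ x, x ∉ A → g x = 0) {x : 𝔼}
    (hx : x ∉ orbitSaturation G A) : groupAverage G g x = 0 :=
  groupAverage_eq_zero fun _ hσ => hg _ fun h => hx (mem_orbitSaturation.2 ⟨_, hσ, h⟩)

theorem orbitDist_ne_zero_of_mem_orbitSaturation [Finite G] {A B : Set 𝔼}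
    (h : ∀ x ∈ A, ∀ y ∈ B, orbitDist G x y ≠ 0) :
    ∀ x ∈ orbitSaturation G A, ∀ y ∈ orbitSaturation G B, orbitDist G x y ≠ 0 := by
  intro x hx y hy
  obtain ⟨σ, hσ, hx⟩ := mem_orbitSaturation.1 hx
  obtain ⟨τ, hτ, hy⟩ := mem_orbitSaturation.1 hy
  rw [← orbitDist_apply_left hσ, ← orbitDist_apply_right hτ]
  exact h _ hx _ hy

/-- The kernel is invariant in each variable off the singular set, so averaging can be removed first
from f at fixed x, then from g. -/
theorem KernelBounds.integral_groupAverage [Finite G] {K : 𝔼 → 𝔼 → 𝕜} {C ε : ℝ}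
    (hK : KernelBounds G K C ε) {A B : Set 𝔼} (hA : IsCompact A) (hB : IsCompact B)
    (hAB : ∀ x ∈ A, ∀ y ∈ B, orbitDist G x y ≠ 0) {f g : 𝔼 → 𝕜}
    (hf : Integrable f) (hfB : ∀ y, y ∉ B → f y = 0)
    (hg : Integrable g) (hgA : ∀ x, x ∉ A → g x = 0) :
    ∫ x, ∫ y, K x y * groupAverage G f y * groupAverage G g x =
      ∫ x, ∫ y, K x y * f y * g x := by
  have hsep := orbitDist_ne_zero_of_mem_orbitSaturation (G := G) hAB
  have hB' := isCompact_orbitSaturation (G := G) hB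
  have hsubB : B ⊆ orbitSaturation G B := fun y hy => mem_orbitSaturation.2 ⟨1, G.one_mem, hy⟩
  have hsubA : A ⊆ orbitSaturation G A := fun y hy => mem_orbitSaturation.2 ⟨1, G.one_mem, hy⟩
  have hinner : ∀ x ∈ orbitSaturation G A,
      ∫ y, K x y * groupAverage G f y = ∫ y, K x y * f y := by
    intro x hx
    -- The invariance of K(x,·) is available only off the orbit of x, so the weight is cut off to an
    -- invariant set away from it that carries both f and its average.
    set w : 𝔼 → 𝕜 := (orbitSaturation G B).indicator fun y => K x y with hw
    have hwinv : AEInvariant G w := by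
      intro σ hσ
      refine Eventually.of_forall fun y => ?_
      by_cases hy : y ∈ orbitSaturation G B
      · simp only [hw]
        rw [Set.indicator_of_mem hy, Set.indicator_of_mem ((apply_mem_orbitSaturation hσ).2 hy)]
        refine hK.apply_right ?_ (hsep x hx y hy)
        rw [orbitDist_comm]
        exact orbitDist_apply_self G hσ y
      · simp only [hw]
        rw [Set.indicator_of_notMem hy,
          Set.indicator_of_notMem (mt (apply_mem_orbitSaturation hσ).1 hy)]
    have e1 : ∀ y, K x y * f y = w y * f y := fun y => by
      by_cases hy : y ∈ orbitSaturation G B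
      · simp [hw, hy]
      · simp [hfB y fun h => hy (hsubB h)]
    have e2 : ∀ y, K x y * groupAverage G f y = w y * groupAverage G f y := fun y => by
      by_cases hy : y ∈ orbitSaturation G B
      · simp [hw, hy]
      · simp [groupAverage_eq_zero_of_notMem hfB hy]
    obtain ⟨δ, hδ, hδB⟩ := exists_pos_le_orbitDist hB' (hsep x hx)
    have hint := hK.integrable_mul hB'.measurableSet hδ hδB hf
      (Eventually.of_forall fun y hy => hfB y fun h => hy (hsubB h))
    simp_rw [e1] at hint
    simp_rw [e1, e2]
    exact integral_mul_groupAverage hwinv hint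
  set u : 𝔼 → 𝕜 := (orbitSaturation G A).indicator fun x => ∫ y, K x y * f y with hu
  have huinv : AEInvariant G u := by
    intro σ hσ
    refine Eventually.of_forall fun x => ?_
    by_cases hx : x ∈ orbitSaturation G A
    · simp only [hu]
      rw [Set.indicator_of_mem hx, Set.indicator_of_mem ((apply_mem_orbitSaturation hσ).2 hx)]
      refine integral_congr_ae (Eventually.of_forall fun y => ?_)
      by_cases hy : y ∈ B
      · simp only
        rw [hK.apply_left (x := x) (x' := σ x) ?_ (hsep x hx y (hsubB hy))]
        rw [orbitDist_comm]
        exact orbitDist_apply_self G hσ x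
      · simp [hfB y hy]
    · simp only [hu]
      rw [Set.indicator_of_notMem hx,
        Set.indicator_of_notMem (mt (apply_mem_orbitSaturation hσ).1 hx)]
  have hprod := (hK.integrable_prod hA hB hAB hf (Eventually.of_forall hfB) hg
    (Eventually.of_forall hgA)).integral_prod_left
  have e1 : ∀ x, ∫ y, K x y * f y * g x = u x * g x := fun x => by
    rw [integral_mul_const]
    by_cases hx : x ∈ orbitSaturation G A
    · simp [hu, hx]
    · simp [hgA x fun h => hx (hsubA h)]
  have e2 : ∀ x, ∫ y, K x y * groupAverage G f y * groupAverage G g x =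
      u x * groupAverage G g x := fun x => by
    rw [integral_mul_const]
    by_cases hx : x ∈ orbitSaturation G A
    · simp [hu, hx, hinner x hx]
    · simp [groupAverage_eq_zero_of_notMem hgA hx]
  simp only [e1] at hprod
  simp_rw [e1, e2]
  exact integral_mul_groupAverage huinv hprod

/-! ### The closed subspace of invariant functions -/

/-- The common fixed points of the isometries f ↦ f ∘ σ. Closedness gives completeness, hence the
orthogonal projection for p = 2 and a complete target for extensions. -/
theorem isClosed_LpG (p : ℝ≥0∞) [Fact (1 ≤ p)] :
    IsClosed (LpG 𝕜 G p : Set (Lp 𝕜 p (volume : Measure 𝔼))) := by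
  have h : (LpG 𝕜 G p : Set (Lp 𝕜 p (volume : Measure 𝔼))) =
      ⋂ σ : G, {f | Lp.compMeasurePreserving σ.1 σ.1.measurePreserving f = f} := by
    ext f
    simp only [Set.mem_iInter, Set.mem_ofPred_eq, SetLike.mem_coe]
    constructor
    · intro hf σ
      exact Lp.ext ((Lp.coeFn_compMeasurePreserving f σ.1.measurePreserving).trans (hf σ.1 σ.2))
    · intro hf σ hσ
      have h1 := Lp.coeFn_compMeasurePreserving f σ.measurePreserving
      rw [hf ⟨σ, hσ⟩] at h1
      exact h1.symm
  rw [h]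
  exact isClosed_iInter fun σ => isClosed_eq
    (Lp.isometry_compMeasurePreserving σ.1.measurePreserving).continuous continuous_id

instance (p : ℝ≥0∞) [Fact (1 ≤ p)] : CompleteSpace (LpG 𝕜 G p) :=
  (isClosed_LpG p).completeSpace_coe

theorem LpG.ext {p : ℝ≥0∞} {f g : LpG 𝕜 G p} (h : f.1 =ᵐ[volume] g.1) : f = g :=
  Subtype.ext (Lp.ext h)

theorem coeFn_toLpG {η : ℝ} (hη : 0 < η) (p : ℝ≥0∞) (f : HolderC 𝕜 G η) :
    (HolderC.toLpG hη p f).1 =ᵐ[volume] f.1 :=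
  MemLp.coeFn_toLp (f.2.1.memLp_of_hasCompactSupport f.2.2.1)

/-! ### Extension of an operator on invariant functions to all of `L²` -/

/-- The operator `S` of `L²_G`, composed with the orthogonal projection of `L²` onto `L²_G`. -/
def extendByProjection (S : LpG 𝕜 G 2 →L[𝕜] LpG 𝕜 G 2) :
    Lp 𝕜 2 (volume : Measure (EuclideanSpace ℝ (Fin N))) →L[𝕜]
      Lp 𝕜 2 (volume : Measure (EuclideanSpace ℝ (Fin N))) :=
  (LpG 𝕜 G 2).subtypeL ∘L S ∘L (LpG 𝕜 G 2).orthogonalProjectionOnto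

theorem extendByProjection_coe (S : LpG 𝕜 G 2 →L[𝕜] LpG 𝕜 G 2) (f : LpG 𝕜 G 2) :
    extendByProjection S f.1 = (S f).1 := by
  simp [extendByProjection]

/-- Averaging is the orthogonal projection: u and its average have the same integral against the
conjugate of any invariant function. -/
theorem orthogonalProjectionOnto_eq [Finite G] {u : Lp 𝕜 2 (volume : Measure 𝔼)} {f : LpG 𝕜 G 2}
    (h : f.1 =ᵐ[volume] groupAverage G u) : (LpG 𝕜 G 2).orthogonalProjectionOnto u = f := by
  refine Subtype.ext ?_
  rw [Submodule.coe_orthogonalProjectionOnto_apply]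
  refine Submodule.eq_starProjection_of_mem_of_inner_eq_zero f.2 fun w hw => ?_
  rw [inner_eq_zero_symm, inner_sub_right, sub_eq_zero, L2.inner_def, L2.inner_def]
  set w' : 𝔼 → 𝕜 := fun x => (starRingEnd 𝕜) (w x) with hw'
  have hinv : AEInvariant G w' := by
    intro σ hσ
    filter_upwards [hw σ hσ] with x hx
    simp only [hw', hx]
  have hint : Integrable (fun x => w' x * u x) := by
    refine (L2.integrable_inner (𝕜 := 𝕜) w u).congr (Eventually.of_forall fun x => ?_)
    simp only [RCLike.inner_apply, hw', mul_comm]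
  have h1 := integral_mul_groupAverage hinv hint
  calc ∫ x, inner 𝕜 (w x) (u x) = ∫ x, w' x * u x := by
        simp only [RCLike.inner_apply, hw', mul_comm]
    _ = ∫ x, w' x * groupAverage G u x := h1.symm
    _ = ∫ x, inner 𝕜 (w x) (f.1 x) := by
        refine integral_congr_ae ?_
        filter_upwards [h] with x hx
        rw [hx, RCLike.inner_apply, mul_comm]

theorem groupAverage_congr_ae [Finite G] {f g : 𝔼 → 𝕜} (h : f =ᵐ[volume] g) :
    groupAverage G f =ᵐ[volume] groupAverage G g := by
  have h1 : ∀ᵐ x, ∀ σ : G, f (σ.1 x) = g (σ.1 x) := ae_all_iff.2 fun σ =>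
    σ.1.measurePreserving.quasiMeasurePreserving.ae_eq_comp h
  filter_upwards [h1] with x hx
  simp only [groupAverage, hx]

theorem groupAverage_ofReal_mem_holderC [Finite G] {η : ℝ} (hη : 0 < η) (hη1 : η ≤ 1) {φ : 𝔼 → ℝ}
    (hφ : ContDiff ℝ ((⊤ : ℕ∞) : WithTop ℕ∞) φ) (hφc : HasCompactSupport φ) :
    groupAverage G (fun x => (φ x : 𝕜)) ∈ HolderC 𝕜 G η := by
  obtain ⟨L, hL⟩ := hφ.lipschitzWith_of_hasCompactSupport hφc (by simp)
  refine groupAverage_mem_holderC hη hη1 (RCLike.continuous_ofReal.comp hφ.continuous)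
    (hφc.comp_left (g := fun t : ℝ => (t : 𝕜)) RCLike.ofReal_zero) L.2 fun x y => ?_
  rw [← RCLike.ofReal_sub, RCLike.norm_ofReal, ← Real.dist_eq, ← dist_eq_norm]
  exact hL.dist_le_mul x y

/-- The averages of φ and ψ are admissible test functions for `T`, and they are supported on
saturations that remain separated, so the kernel formula applies to them. Averaging is removed from
the pairing because S P φ is invariant, and from the double integral because `K` is. -/
theorem IsSingularIntegral.hasSmoothKernel [Finite G] {η : ℝ} (hη : 0 < η) (hη1 : η ≤ 1)
    {T : HolderC 𝕜 G η →ₗ[𝕜] HolderDual 𝕜 G η} {K : 𝔼 → 𝔼 → 𝕜} (hT : IsSingularIntegral T K)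
    {S : LpG 𝕜 G 2 →L[𝕜] LpG 𝕜 G 2} (hS : IsLpExtension hη T 2 S) :
    HasSmoothKernel G (extendByProjection S) K := by
  obtain ⟨C, ε, hK⟩ := hT.kernel.exists_kernelBounds
  intro φ ψ hφ hψ hφc hψc hsep u v hu hv
  set f : HolderC 𝕜 G η :=
    ⟨groupAverage G fun x => (φ x : 𝕜), groupAverage_ofReal_mem_holderC hη hη1 hφ hφc⟩ with hf
  set g : HolderC 𝕜 G η :=
    ⟨groupAverage G fun x => (ψ x : 𝕜), groupAverage_ofReal_mem_holderC hη hη1 hψ hψc⟩ with hg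
  have hproj : (LpG 𝕜 G 2).orthogonalProjectionOnto u = HolderC.toLpG hη 2 f :=
    orthogonalProjectionOnto_eq ((coeFn_toLpG hη 2 f).trans (groupAverage_congr_ae hu).symm)
  have happly : extendByProjection S u = (S (HolderC.toLpG hη 2 f)).1 := by
    rw [← hproj]
    rfl
  have hsep' := orbitDist_ne_zero_of_mem_orbitSaturation hsep
  have hφ0 : ∀ y, y ∉ tsupport φ → (φ y : 𝕜) = 0 := fun y => ofReal_eq_zero_of_notMem_tsupport
  have hψ0 : ∀ y, y ∉ tsupport ψ → (ψ y : 𝕜) = 0 := fun y => ofReal_eq_zero_of_notMem_tsupport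
  have hint : Integrable (fun z : 𝔼 × 𝔼 => K z.1 z.2 * f.1 z.2 * g.1 z.1)
      (volume.prod volume) :=
    hK.integrable_prod (isCompact_orbitSaturation hψc) (isCompact_orbitSaturation hφc) hsep'
      (f.2.1.integrable_of_hasCompactSupport f.2.2.1)
      (Eventually.of_forall fun y => groupAverage_eq_zero_of_notMem hφ0)
      (g.2.1.integrable_of_hasCompactSupport g.2.2.1)
      (Eventually.of_forall fun y => groupAverage_eq_zero_of_notMem hψ0)
  have hSψ : Integrable (fun x => (S (HolderC.toLpG hη 2 f)).1 x * (ψ x : 𝕜)) := by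
    refine (integrable_mul_L2 (S (HolderC.toLpG hη 2 f)).1 v).congr ?_
    filter_upwards [hv] with x hx
    rw [hx]
  calc ∫ x, extendByProjection S u x * v x
      = ∫ x, (S (HolderC.toLpG hη 2 f)).1 x * (ψ x : 𝕜) := by
        refine integral_congr_ae ?_
        filter_upwards [hv] with x hx
        rw [hx, happly]
    _ = ∫ x, (S (HolderC.toLpG hη 2 f)).1 x * g.1 x :=
        (integral_mul_groupAverage (S (HolderC.toLpG hη 2 f)).2 hSψ).symm
    _ = (T f).1 g := (hS f g).symm
    _ = ∫ x, ∫ y, K x y * f.1 y * g.1 x := hT.integral_eq f g hint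
    _ = _ := hK.integral_groupAverage hψc hφc hsep (integrable_ofReal_of_contDiff hφ hφc) hφ0
        (integrable_ofReal_of_contDiff hψ hψc) hψ0

/-! ### Extension of operators of weak type `(1,1)` -/

section WeakType

variable {α : Type*} [MeasurableSpace α] {μ : Measure α}

/-- Fatou's lemma for sets: up to a null set, S lies in the increasing union of the tail
intersections of the E n. -/
theorem measure_le_of_ae_eventually_mem {S : Set α} {E : ℕ → Set α} {c : ℕ → ℝ≥0∞} {l : ℝ≥0∞}
    (hS : ∀ᵐ x ∂μ, x ∈ S → ∀ᶠ n in atTop, x ∈ E n) (hE : ∀ n, μ (E n) ≤ c n)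
    (hc : Tendsto c atTop (𝓝 l)) : μ S ≤ l := by
  have hmono : Monotone fun m : ℕ => ⋂ n ≥ m, E n := fun m m' h =>
    Set.biInter_subset_biInter_left fun n hn => le_trans h hn
  calc μ S ≤ μ (⋃ m : ℕ, ⋂ n ≥ m, E n) := by
        refine measure_mono_ae ?_
        filter_upwards [hS] with x hx hxS
        obtain ⟨m, hm⟩ := eventually_atTop.1 (hx hxS)
        exact Set.mem_iUnion.2 ⟨m, Set.mem_iInter₂.2 hm⟩
    _ = ⨆ m, μ (⋂ n ≥ m, E n) := hmono.measure_iUnion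
    _ ≤ l := by
        refine iSup_le fun m => ge_of_tendsto hc ?_
        filter_upwards [eventually_ge_atTop m] with n hn
        exact (measure_mono (Set.biInter_subset_of_mem hn)).trans (hE n)

/-- Where |h| ≥ t the approximants eventually exceed any s < t; then s is let tend to t. -/
theorem measure_le_norm_le_of_tendsto {g : ℕ → α → 𝕜} {h : α → 𝕜} {A r : ℝ} {ρ : ℕ → ℝ}
    (hgh : ∀ᵐ x ∂μ, Tendsto (fun n => g n x) atTop (𝓝 (h x)))
    (hg : ∀ n t, 0 < t → μ {x | t ≤ ‖g n x‖} ≤ ENNReal.ofReal (A * ρ n / t))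
    (hρ : Tendsto ρ atTop (𝓝 r)) {t : ℝ} (ht : 0 < t) :
    μ {x | t ≤ ‖h x‖} ≤ ENNReal.ofReal (A * r / t) := by
  have key : ∀ s, 0 < s → s < t → μ {x | t ≤ ‖h x‖} ≤ ENNReal.ofReal (A * r / s) := by
    intro s hs hst
    refine measure_le_of_ae_eventually_mem (E := fun n => {x | s ≤ ‖g n x‖}) ?_
      (fun n => hg n s hs) ?_
    · filter_upwards [hgh] with x hx hxt
      filter_upwards [hx.norm.eventually (lt_mem_nhds (hst.trans_le hxt))] with n hn
      exact hn.le
    · exact (ENNReal.continuous_ofReal.tendsto _).comp ((hρ.const_mul A).div_const s)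
  have hlim : Tendsto (fun s => ENNReal.ofReal (A * r / s)) (𝓝[<] t)
      (𝓝 (ENNReal.ofReal (A * r / t))) := by
    have h1 : ContinuousAt (fun s : ℝ => A * r / s) t :=
      continuousAt_const.div continuousAt_id ht.ne'
    exact ((ENNReal.continuous_ofReal.tendsto _).comp h1.tendsto).mono_left nhdsWithin_le_nhds
  refine ge_of_tendsto hlim ?_
  filter_upwards [self_mem_nhdsWithin, nhdsWithin_le_nhds (lt_mem_nhds ht)] with s hs hs0
  exact key s hs0 hs

variable {E D : Type*} [SeminormedAddCommGroup E] [NormedSpace 𝕜 E] [AddCommGroup D] [Module 𝕜 D]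
  {ι : D →ₗ[𝕜] E} {L : D →ₗ[𝕜] (α →ₘ[μ] 𝕜)} {A : ℝ}

/-- `h` is within the weak type bound of `L u` for all `u`. -/
def IsWeakLimit (ι : D →ₗ[𝕜] E) (L : D →ₗ[𝕜] (α →ₘ[μ] 𝕜)) (A : ℝ) (f : E) (h : α →ₘ[μ] 𝕜) :
    Prop :=
  ∀ (u : D) (t : ℝ), 0 < t → μ {x | t ≤ ‖h x - L u x‖} ≤ ENNReal.ofReal (A * ‖f - ι u‖ / t)

theorem coeFn_map_sub (u v : D) : L (u - v) =ᵐ[μ] fun x => L u x - L v x := by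
  rw [map_sub]
  exact AEEqFun.coeFn_sub _ _

theorem IsWeakLimit.of_map (hL : ∀ u t, 0 < t → μ {x | t ≤ ‖L u x‖} ≤ ENNReal.ofReal (A * ‖ι u‖ / t))
    (u : D) : IsWeakLimit ι L A (ι u) (L u) := by
  intro v t ht
  rw [← map_sub]
  refine (measure_mono_ae ?_).trans (hL (u - v) t ht)
  filter_upwards [coeFn_map_sub (L := L) u v] with x hx (hxt : t ≤ _)
  change t ≤ _
  rwa [hx]

/-- Approximating f and g within δ by elements of the dense range, the discrepancy exceeds t only on
a set of measure O(δ). This single statement yields uniqueness, additivity and homogeneity of the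
extension. -/
theorem IsWeakLimit.unique_smul_add (hι : DenseRange ι) (hA : 0 ≤ A) {f g : E} {c : 𝕜}
    {h k m : α →ₘ[μ] 𝕜}
    (hf : IsWeakLimit ι L A f h) (hg : IsWeakLimit ι L A g k)
    (hm : IsWeakLimit ι L A (c • f + g) m) : m = c • h + k := by
  -- It bounds the approximation error of c f + g in units of δ, and stays positive when c = 0.
  set a : ℝ := ‖c‖ + 1 with ha
  have ha0 : 0 < a := by positivity
  have key : ∀ t : ℝ, 0 < t → μ {x | t ≤ ‖m x - (c * h x + k x)‖} = 0 := by
    intro t ht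
    have hle : ∀ δ : ℝ, 0 < δ → μ {x | t ≤ ‖m x - (c * h x + k x)‖} ≤
        ENNReal.ofReal (A * (a * δ) / (t / 3)) + ENNReal.ofReal (A * δ / (t / (3 * a))) +
          ENNReal.ofReal (A * δ / (t / 3)) := by
      intro δ hδ
      have hδ' : 0 < δ := hδ
      obtain ⟨u, hu⟩ := hι.exists_dist_lt f hδ'
      obtain ⟨v, hv⟩ := hι.exists_dist_lt g hδ'
      rw [dist_eq_norm] at hu hv
      have hw : ‖c • f + g - ι (c • u + v)‖ ≤ a * δ := by
        have e : c • f + g - ι (c • u + v) = c • (f - ι u) + (g - ι v) := by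
          rw [map_add, map_smul, smul_sub]
          abel
        rw [e]
        refine (norm_add_le _ _).trans ?_
        rw [norm_smul, ha, add_mul, one_mul]
        gcongr
      have hLcoe : L (c • u + v) =ᵐ[μ] fun x => c * L u x + L v x := by
        rw [map_add, map_smul]
        filter_upwards [AEEqFun.coeFn_add (c • L u) (L v), AEEqFun.coeFn_smul c (L u)]
          with x h1 h2
        rw [h1, Pi.add_apply, h2, Pi.smul_apply, smul_eq_mul]
      calc μ {x | t ≤ ‖m x - (c * h x + k x)‖}
          ≤ μ ({x | t / 3 ≤ ‖m x - L (c • u + v) x‖} ∪ {x | t / (3 * a) ≤ ‖h x - L u x‖} ∪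
              {x | t / 3 ≤ ‖k x - L v x‖}) := by
            refine measure_mono_ae ?_
            filter_upwards [hLcoe] with x hx (hxt : t ≤ _)
            change (t / 3 ≤ _ ∨ t / (3 * a) ≤ _) ∨ t / 3 ≤ _
            by_contra! hcon
            obtain ⟨⟨h1, h2⟩, h3⟩ := hcon
            have e : m x - (c * h x + k x) = (m x - L (c • u + v) x) - c * (h x - L u x) -
                (k x - L v x) := by
              rw [hx]
              ring
            have h4 : ‖c * (h x - L u x)‖ ≤ t / 3 := by
              rw [norm_mul]
              calc ‖c‖ * ‖h x - L u x‖ ≤ a * (t / (3 * a)) := by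
                    gcongr
                    rw [ha]
                    linarith
                _ = t / 3 := by field_simp
            have h5 := norm_sub_le (m x - L (c • u + v) x - c * (h x - L u x)) (k x - L v x)
            have h6 := norm_sub_le (m x - L (c • u + v) x) (c * (h x - L u x))
            rw [← e] at h5
            linarith
        _ ≤ _ := by
            refine (measure_union_le _ _).trans (add_le_add ((measure_union_le _ _).trans
              (add_le_add ?_ ?_)) ?_)
            · refine (hm (c • u + v) (t / 3) (by positivity)).trans ?_
              gcongr
            · refine (hf u (t / (3 * a)) (by positivity)).trans ?_
              gcongr
            · refine (hg v (t / 3) (by positivity)).trans ?_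
              gcongr
    have hlim : Tendsto (fun δ : ℝ => ENNReal.ofReal (A * (a * δ) / (t / 3)) +
        ENNReal.ofReal (A * δ / (t / (3 * a))) + ENNReal.ofReal (A * δ / (t / 3)))
        (𝓝[>] 0) (𝓝 0) := by
      have hc : Continuous (fun δ : ℝ => ENNReal.ofReal (A * (a * δ) / (t / 3)) +
          ENNReal.ofReal (A * δ / (t / (3 * a))) + ENNReal.ofReal (A * δ / (t / 3))) := by
        have h1 : Continuous fun δ : ℝ => A * (a * δ) / (t / 3) := by fun_prop
        have h2 : Continuous fun δ : ℝ => A * δ / (t / (3 * a)) := by fun_prop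
        have h3 : Continuous fun δ : ℝ => A * δ / (t / 3) := by fun_prop
        exact ((ENNReal.continuous_ofReal.comp h1).add (ENNReal.continuous_ofReal.comp h2)).add
          (ENNReal.continuous_ofReal.comp h3)
      have := (hc.tendsto 0).mono_left (nhdsWithin_le_nhds (s := Set.Ioi 0))
      simpa using this
    exact le_antisymm (ge_of_tendsto hlim (eventually_nhdsWithin_of_forall hle)) zero_le
  have hall : ∀ᵐ x ∂μ, ∀ n : ℕ, ‖m x - (c * h x + k x)‖ < 1 / ((n : ℝ) + 1) := by
    refine ae_all_iff.2 fun n => ?_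
    rw [ae_iff]
    simpa using key (1 / ((n : ℝ) + 1)) (by positivity)
  refine AEEqFun.ext ?_
  filter_upwards [hall, AEEqFun.coeFn_add (c • h) k, AEEqFun.coeFn_smul c h] with x hx h1 h2
  rw [h1, Pi.add_apply, h2, Pi.smul_apply, smul_eq_mul, ← sub_eq_zero, ← norm_le_zero_iff]
  exact ge_of_tendsto' tendsto_one_div_add_atTop_nhds_zero_nat fun n => (hx n).le

/-- Approximants within 4^(-n) have images whose consecutive differences exceed 2^(-n) only on sets
of measure at most 2A · 2^(-n). By Borel–Cantelli the images converge almost everywhere, and the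
weak bound passes to the limit. The convergent sequence is kept in the conclusion because invariance
is later read off from it. -/
theorem IsWeakLimit.exists_of_denseRange (hι : DenseRange ι) (hA : 0 ≤ A)
    (hL : ∀ u t, 0 < t → μ {x | t ≤ ‖L u x‖} ≤ ENNReal.ofReal (A * ‖ι u‖ / t)) (f : E) :
    ∃ h, IsWeakLimit ι L A f h ∧
      ∃ u : ℕ → D, ∀ᵐ x ∂μ, Tendsto (fun n => L (u n) x) atTop (𝓝 (h x)) := by
  choose u hu using fun n : ℕ => hι.exists_dist_lt f (by positivity : (0 : ℝ) < (1 / 4) ^ n)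
  simp_rw [dist_eq_norm] at hu
  have hstep : ∀ n, ‖ι (u (n + 1) - u n)‖ ≤ 2 * (1 / 4) ^ n := by
    intro n
    have e : ι (u (n + 1) - u n) = (f - ι (u n)) - (f - ι (u (n + 1))) := by
      rw [map_sub]
      abel
    rw [e]
    refine (norm_sub_le _ _).trans ?_
    have h1 := (hu n).le
    have h2 := (hu (n + 1)).le
    have h3 : ((1 : ℝ) / 4) ^ (n + 1) ≤ (1 / 4) ^ n :=
      pow_le_pow_of_le_one (by norm_num) (by norm_num) (Nat.le_succ n)
    linarith
  have hsum : ∑' n, μ {x | (1 / 2 : ℝ) ^ n ≤ ‖L (u (n + 1) - u n) x‖} ≠ ∞ := by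
    have hgeo : Summable fun n : ℕ => A * 2 * (1 / 2 : ℝ) ^ n :=
      summable_geometric_two.mul_left _
    refine ne_top_of_le_ne_top hgeo.tsum_ofReal_ne_top (ENNReal.tsum_le_tsum fun n => ?_)
    refine (hL _ _ (by positivity)).trans (ENNReal.ofReal_le_ofReal ?_)
    rw [div_le_iff₀ (by positivity)]
    calc A * ‖ι (u (n + 1) - u n)‖ ≤ A * (2 * (1 / 4) ^ n) := by gcongr; exact hstep n
      _ = A * 2 * (1 / 2) ^ n * (1 / 2) ^ n := by
          rw [mul_assoc (A * 2), ← mul_pow]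
          norm_num
          ring
  have hconv : ∀ᵐ x ∂μ, ∃ l, Tendsto (fun n => L (u n) x) atTop (𝓝 l) := by
    filter_upwards [ae_eventually_notMem hsum,
      ae_all_iff.2 fun n => coeFn_map_sub (L := L) (u (n + 1)) (u n)] with x hx hx'
    refine cauchySeq_tendsto_of_complete (cauchySeq_of_summable_dist ?_)
    refine Summable.of_norm_bounded_eventually_nat summable_geometric_two ?_
    filter_upwards [hx] with n hn
    rw [Real.norm_of_nonneg dist_nonneg, dist_comm, dist_eq_norm, Nat.succ_eq_add_one, ← hx' n]
    exact (not_le.1 hn).le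
  obtain ⟨h, hm, hh⟩ : ∃ h : α → 𝕜, AEStronglyMeasurable h μ ∧
      ∀ᵐ x ∂μ, Tendsto (fun n => L (u n) x) atTop (𝓝 (h x)) := by
    classical
    let h : α → 𝕜 := fun x =>
      if hx : ∃ l, Tendsto (fun n => L (u n) x) atTop (𝓝 l) then hx.choose else 0
    have hh : ∀ᵐ x ∂μ, Tendsto (fun n => L (u n) x) atTop (𝓝 (h x)) := by
      filter_upwards [hconv] with x hx
      simp only [h, dif_pos hx]
      exact hx.choose_spec
    exact ⟨h, aestronglyMeasurable_of_tendsto_ae _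
      (fun n => (L (u n)).aestronglyMeasurable) hh, hh⟩
  have hh' : ∀ᵐ x ∂μ, Tendsto (fun n => L (u n) x) atTop (𝓝 (AEEqFun.mk h hm x)) := by
    filter_upwards [hh, AEEqFun.coeFn_mk h hm] with x h1 h2
    rwa [h2]
  refine ⟨AEEqFun.mk h hm, fun v t ht => ?_, u, hh'⟩
  have hlim : Tendsto (fun n => ι (u n)) atTop (𝓝 f) := by
    rw [tendsto_iff_norm_sub_tendsto_zero]
    refine squeeze_zero (fun _ => norm_nonneg _) (fun n => ?_)
      (tendsto_pow_atTop_nhds_zero_of_lt_one (by norm_num) (by norm_num : (1 / 4 : ℝ) < 1))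
    rw [norm_sub_rev]
    exact (hu n).le
  refine measure_le_norm_le_of_tendsto (g := fun n x => L (u n - v) x)
    (ρ := fun n => ‖ι (u n) - ι v‖) (h := fun x => AEEqFun.mk h hm x - L v x) ?_ ?_
    (hlim.sub_const _).norm ht
  · filter_upwards [hh', ae_all_iff.2 fun n => coeFn_map_sub (L := L) (u n) v] with x h1 h2
    simp_rw [h2]
    exact h1.sub_const _
  · intro n s hs
    rw [← map_sub]
    exact hL _ s hs

theorem exists_linear_extension_of_weak_type (hι : DenseRange ι) (hA : 0 ≤ A)
    (hL : ∀ u t, 0 < t → μ {x | t ≤ ‖L u x‖} ≤ ENNReal.ofReal (A * ‖ι u‖ / t)) :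
    ∃ L' : E →ₗ[𝕜] (α →ₘ[μ] 𝕜), (∀ u, L' (ι u) = L u) ∧
      (∀ f t, 0 < t → μ {x | t ≤ ‖L' f x‖} ≤ ENNReal.ofReal (A * ‖f‖ / t)) ∧
      ∀ f, ∃ u : ℕ → D, ∀ᵐ x ∂μ, Tendsto (fun n => L (u n) x) atTop (𝓝 (L' f x)) := by
  choose H hH hlim using IsWeakLimit.exists_of_denseRange hι hA hL
  -- Knowing that 0 is a weak limit at 0 lets the uniqueness statement give homogeneity (g = 0) and
  -- agreement with L on the dense range (f = 0).
  have h0 : IsWeakLimit ι L A 0 0 := by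
    have := IsWeakLimit.of_map hL (0 : D)
    rwa [map_zero, map_zero] at this
  refine ⟨{ toFun := H, map_add' := fun f g => ?_, map_smul' := fun c f => ?_ }, fun u => ?_,
    fun f t ht => ?_, hlim⟩
  · have h := IsWeakLimit.unique_smul_add (c := (1 : 𝕜)) hι hA (hH f) (hH g)
      (by rw [one_smul]; exact hH (f + g))
    rwa [one_smul] at h
  · have h := IsWeakLimit.unique_smul_add (c := c) hι hA (hH f) h0
      (by rw [add_zero]; exact hH (c • f))
    rwa [add_zero] at h
  · have h := IsWeakLimit.unique_smul_add (c := (1 : 𝕜)) hι hA h0 (IsWeakLimit.of_map hL u)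
      (by rw [smul_zero, zero_add]; exact hH (ι u))
    rwa [one_smul, zero_add] at h
  · have h := hH f 0 t ht
    rw [map_zero, map_zero, sub_zero] at h
    refine (measure_mono_ae ?_).trans h
    filter_upwards [AEEqFun.coeFn_zero (α := α) (μ := μ) (β := 𝕜)] with x hx (hxt : t ≤ _)
    change t ≤ _
    rw [hx, Pi.zero_apply, sub_zero]
    exact hxt

end WeakType

/-! ### The dense subspaces `L^p_G ∩ L²_G` -/

theorem eLpNorm_groupAverage_le [Finite G] {p : ℝ≥0∞} (hp : 1 ≤ p) {g : 𝔼 → 𝕜}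
    (hg : AEStronglyMeasurable g) :
    eLpNorm (groupAverage G g) p volume ≤ eLpNorm g p volume := by
  have := Fintype.ofFinite G
  have e : groupAverage G g = (Nat.card G : 𝕜)⁻¹ • ∑ σ : G, (g ∘ fun x => σ.1 x) := by
    ext x
    simp [groupAverage, finsum_eq_sum_of_fintype]
  have hc : (Nat.card G : ℝ≥0∞) ≠ 0 := by exact_mod_cast Nat.card_pos.ne'
  rw [e, eLpNorm_const_smul]
  calc ‖(Nat.card G : 𝕜)⁻¹‖ₑ * eLpNorm (∑ σ : G, (g ∘ fun x => σ.1 x)) p volume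
      ≤ ‖(Nat.card G : 𝕜)⁻¹‖ₑ * ∑ σ : G, eLpNorm (g ∘ fun x => σ.1 x) p volume := by
        gcongr
        exact eLpNorm_sum_le (fun σ _ => hg.comp_measurePreserving σ.1.measurePreserving) hp
    _ = ‖(Nat.card G : 𝕜)⁻¹‖ₑ * (Nat.card G * eLpNorm g p volume) := by
        congr 1
        rw [Finset.sum_congr rfl fun σ _ =>
          eLpNorm_comp_measurePreserving (p := p) hg σ.1.measurePreserving, Finset.sum_const,
          Finset.card_univ, ← Nat.card_eq_fintype_card, nsmul_eq_mul]
    _ = eLpNorm g p volume := by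
        rw [← mul_assoc, ← ofReal_norm, norm_inv, RCLike.norm_natCast,
          ENNReal.ofReal_inv_of_pos (by exact_mod_cast Nat.card_pos), ENNReal.ofReal_natCast,
          ENNReal.inv_mul_cancel hc (ENNReal.natCast_ne_top _), one_mul]

theorem groupAverage_ae_eq_self [Finite G] {f : 𝔼 → 𝕜} (hf : AEInvariant G f) :
    groupAverage G f =ᵐ[volume] f := by
  have := Fintype.ofFinite G
  have hc : (Nat.card G : 𝕜) ≠ 0 := by exact_mod_cast Nat.card_pos.ne'
  have h1 : ∀ᵐ x, ∀ σ : G, f (σ.1 x) = f x := ae_all_iff.2 fun σ => hf σ.1 σ.2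
  filter_upwards [h1] with x hx
  simp only [groupAverage, hx, finsum_eq_sum_of_fintype, Finset.sum_const, Finset.card_univ,
    ← Nat.card_eq_fintype_card, nsmul_eq_mul]
  exact inv_mul_cancel_left₀ hc _

variable (𝕜 G) in
/-- The subspace `L^p_G ∩ L²_G` of `L²_G`. -/
def lpInterL2 (p : ℝ≥0∞) : Submodule 𝕜 (LpG 𝕜 G 2) where
  carrier := {f | MemLp f.1 p volume}
  zero_mem' := (memLp_congr_ae (Lp.coeFn_zero 𝕜 2 volume)).2 MemLp.zero
  add_mem' := fun {f g} hf hg => (memLp_congr_ae (Lp.coeFn_add f.1 g.1)).2 (MemLp.add hf hg)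
  smul_mem' := fun c f hf => (memLp_congr_ae (Lp.coeFn_smul c f.1)).2 (MemLp.const_smul hf c)

theorem aeInvariant_congr {β : Type*} {f g : 𝔼 → β} (h : f =ᵐ[volume] g) (hg : AEInvariant G g) :
    AEInvariant G f := fun σ hσ =>
  ((σ.measurePreserving.quasiMeasurePreserving.ae_eq_comp h).trans (hg σ hσ)).trans h.symm

variable (𝕜 G) in
/-- The inclusion of `L^p_G ∩ L²_G` in `L^p_G`. -/
def lpInterL2Inclusion (p : ℝ≥0∞) : lpInterL2 𝕜 G p →ₗ[𝕜] LpG 𝕜 G p where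
  toFun f := ⟨MemLp.toLp f.1.1 f.2, aeInvariant_congr (MemLp.coeFn_toLp f.2) f.1.2⟩
  map_add' f g := by
    refine LpG.ext ?_
    have h1 := MemLp.coeFn_toLp (f + g).2
    filter_upwards [h1, MemLp.coeFn_toLp f.2, MemLp.coeFn_toLp g.2, Lp.coeFn_add f.1.1 g.1.1,
      Lp.coeFn_add (MemLp.toLp f.1.1 f.2) (MemLp.toLp g.1.1 g.2)] with x h1 h2 h3 h4 h5
    refine h1.trans (h4.trans ?_)
    refine Eq.trans ?_ h5.symm
    rw [Pi.add_apply, Pi.add_apply, h2, h3]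
  map_smul' c f := by
    refine LpG.ext ?_
    have h1 := MemLp.coeFn_toLp (c • f).2
    filter_upwards [h1, MemLp.coeFn_toLp f.2, Lp.coeFn_smul c f.1.1,
      Lp.coeFn_smul c (MemLp.toLp f.1.1 f.2)] with x h1 h2 h4 h5
    refine h1.trans (h4.trans ?_)
    refine Eq.trans ?_ h5.symm
    rw [Pi.smul_apply, Pi.smul_apply, h2]

theorem coeFn_lpInterL2Inclusion {p : ℝ≥0∞} (f : lpInterL2 𝕜 G p) :
    (lpInterL2Inclusion 𝕜 G p f).1 =ᵐ[volume] f.1.1 := MemLp.coeFn_toLp f.2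

theorem exists_lpInterL2Inclusion_eq {p : ℝ≥0∞} {f : LpG 𝕜 G p} {f₂ : LpG 𝕜 G 2}
    (h : f.1 =ᵐ[volume] f₂.1) :
    ∃ u : lpInterL2 𝕜 G p, u.1 = f₂ ∧ lpInterL2Inclusion 𝕜 G p u = f := by
  have hm : f₂ ∈ lpInterL2 𝕜 G p := (memLp_congr_ae h).1 (Lp.memLp f.1)
  exact ⟨⟨f₂, hm⟩, rfl, LpG.ext ((coeFn_lpInterL2Inclusion ⟨f₂, hm⟩).trans h.symm)⟩

/-- Approximate f in `L^p` by a continuous compactly supported g and average: the average is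
invariant and lies in every `L^p`, while averaging fixes f and does not increase `L^p` norms. -/
theorem denseRange_lpInterL2Inclusion [Finite G] {p : ℝ≥0∞} [hp1 : Fact (1 ≤ p)] (hp : p ≠ ∞) :
    DenseRange (lpInterL2Inclusion 𝕜 G p) := by
  intro f
  refine Metric.mem_closure_iff.2 fun ε hε => ?_
  have hε2 : ENNReal.ofReal (ε / 2) ≠ 0 := (ENNReal.ofReal_pos.2 (by positivity)).ne'
  obtain ⟨g, hgc, hg, hgcont, hgm⟩ := (Lp.memLp f.1).exists_hasCompactSupport_eLpNorm_sub_le hp hε2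
  have hac : Continuous (groupAverage G g) := continuous_groupAverage hgcont
  have has : HasCompactSupport (groupAverage G g) := hasCompactSupport_groupAverage hgc
  have hm2 : MemLp (groupAverage G g) 2 volume := hac.memLp_of_hasCompactSupport has
  have hmp : MemLp (groupAverage G g) p volume := hac.memLp_of_hasCompactSupport has
  have hinv : AEInvariant G (groupAverage G g) := fun σ hσ =>
    Eventually.of_forall fun x => groupAverage_apply_of_mem g hσ x
  have h2 : ((hm2.toLp _ : Lp 𝕜 2 volume) : 𝔼 → 𝕜) =ᵐ[volume] groupAverage G g := hm2.coeFn_toLp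
  let u : lpInterL2 𝕜 G p := ⟨⟨hm2.toLp _, aeInvariant_congr h2 hinv⟩, (memLp_congr_ae h2).2 hmp⟩
  refine ⟨_, ⟨u, rfl⟩, ?_⟩
  have hu : (lpInterL2Inclusion 𝕜 G p u).1 =ᵐ[volume] groupAverage G g :=
    (coeFn_lpInterL2Inclusion u).trans h2
  have hlt : ‖f.1 - (lpInterL2Inclusion 𝕜 G p u).1‖ ≤ ε / 2 := by
    rw [Lp.norm_def]
    refine ENNReal.toReal_le_of_le_ofReal (by positivity) ?_
    refine le_trans (le_of_eq ?_) ((eLpNorm_groupAverage_le (G := G) hp1.out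
      ((Lp.memLp f.1).sub hgm).1).trans hg)
    refine eLpNorm_congr_ae ?_
    filter_upwards [Lp.coeFn_sub f.1 (lpInterL2Inclusion 𝕜 G p u).1, hu,
      groupAverage_ae_eq_self f.2] with x h3 h4 h5
    rw [h3, Pi.sub_apply, h4, ← h5]
    simp only [groupAverage, Pi.sub_apply]
    rw [← mul_sub, finsum_sub_distrib (Set.toFinite _) (Set.toFinite _)]
  have hd : dist f (lpInterL2Inclusion 𝕜 G p u) ≤ ε / 2 := by
    rw [dist_eq_norm]
    exact hlt
  linarith

theorem norm_lpInterL2Inclusion {p : ℝ≥0∞} [Fact (1 ≤ p)] (f : lpInterL2 𝕜 G p) :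
    ‖lpInterL2Inclusion 𝕜 G p f‖ = (eLpNorm f.1.1 p volume).toReal := by
  rw [← eLpNorm_congr_ae (coeFn_lpInterL2Inclusion f)]
  exact Lp.norm_def _

/-! ### The three boundedness statements -/

theorem exists_eLpNorm_le [Finite G] (hN : 1 ≤ N) {K : 𝔼 → 𝔼 → 𝕜} {C ε : ℝ}
    (hK : KernelBounds G K C ε) {S : LpG 𝕜 G 2 →L[𝕜] LpG 𝕜 G 2}
    (hS : HasSmoothKernel G (extendByProjection S) K) {p : ℝ≥0∞} (hp : 1 < p) (hp' : p < ∞) :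
    ∃ A : ℝ≥0∞, A ≠ ∞ ∧ ∀ f : LpG 𝕜 G 2,
      eLpNorm (S f).1 p volume ≤ A * eLpNorm f.1 p volume := by
  have hq : 1 < p.toReal := by
    have := (ENNReal.toReal_lt_toReal ENNReal.one_ne_top hp'.ne).2 hp
    simpa using this
  have hp0 : p ≠ 0 := (zero_lt_one.trans hp).ne'
  obtain ⟨A, hA, h⟩ := hS.exists_strong_type hN hK hq
  refine ⟨A ^ (1 / p.toReal), ENNReal.rpow_ne_top_of_nonneg (by positivity) hA, fun f => ?_⟩
  have h1 := h f.1
  rw [extendByProjection_coe] at h1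
  rw [eLpNorm_eq_lintegral_rpow_enorm_toReal hp0 hp'.ne,
    eLpNorm_eq_lintegral_rpow_enorm_toReal hp0 hp'.ne,
    ← ENNReal.mul_rpow_of_nonneg _ _ (by positivity)]
  gcongr

/-- On invariant functions the operator composed with the projection is `S` itself, so the strong
type bound makes `S` bounded in `L^p` norm on the dense subspace `L^p_G ∩ L²_G`. -/
theorem exists_strong_extension [Finite G] (hN : 1 ≤ N) {K : 𝔼 → 𝔼 → 𝕜} {C ε : ℝ}
    (hK : KernelBounds G K C ε) {S : LpG 𝕜 G 2 →L[𝕜] LpG 𝕜 G 2}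
    (hS : HasSmoothKernel G (extendByProjection S) K) {p : ℝ≥0∞} [Fact (1 ≤ p)] (hp : 1 < p)
    (hp' : p < ∞) :
    ∃ Sp : LpG 𝕜 G p →L[𝕜] LpG 𝕜 G p, ∀ (f : LpG 𝕜 G p) (f₂ : LpG 𝕜 G 2),
      f.1 =ᵐ[volume] f₂.1 → (Sp f).1 =ᵐ[volume] (S f₂).1 := by
  obtain ⟨A, hA, hbound⟩ := exists_eLpNorm_le hN hK hS hp hp'
  have hmaps : ∀ f ∈ lpInterL2 𝕜 G p, S.toLinearMap f ∈ lpInterL2 𝕜 G p := fun f hf =>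
    ⟨Lp.aestronglyMeasurable (S f).1,
      (hbound f).trans_lt (ENNReal.mul_lt_top hA.lt_top (MemLp.eLpNorm_lt_top hf))⟩
  set L : lpInterL2 𝕜 G p →ₗ[𝕜] LpG 𝕜 G p :=
    lpInterL2Inclusion 𝕜 G p ∘ₗ S.toLinearMap.restrict hmaps with hL
  have hnorm : ∀ u : lpInterL2 𝕜 G p, ‖L u‖ ≤ A.toReal * ‖lpInterL2Inclusion 𝕜 G p u‖ := by
    intro u
    have h1 : ‖L u‖ = (eLpNorm (S u.1).1 p volume).toReal :=
      norm_lpInterL2Inclusion (S.toLinearMap.restrict hmaps u)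
    rw [h1, norm_lpInterL2Inclusion, ← ENNReal.toReal_mul]
    exact ENNReal.toReal_mono (ENNReal.mul_ne_top hA (MemLp.eLpNorm_ne_top u.2)) (hbound u.1)
  refine ⟨L.extendOfNorm (lpInterL2Inclusion 𝕜 G p), fun f f₂ hf => ?_⟩
  have hdense := denseRange_lpInterL2Inclusion (𝕜 := 𝕜) (G := G) (p := p) hp'.ne
  obtain ⟨u, rfl, rfl⟩ := exists_lpInterL2Inclusion_eq hf
  rw [LinearMap.extendOfNorm_eq hdense ⟨_, hnorm⟩]
  exact coeFn_lpInterL2Inclusion (S.toLinearMap.restrict hmaps u)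

set_option maxHeartbeats 1000000 in
theorem exists_weak_extension [Finite G] (hN : 1 ≤ N) {K : 𝔼 → 𝔼 → 𝕜} {C ε : ℝ}
    (hK : KernelBounds G K C ε) {S : LpG 𝕜 G 2 →L[𝕜] LpG 𝕜 G 2}
    (hS : HasSmoothKernel G (extendByProjection S) K) :
    ∃ S₁ : LpG 𝕜 G 1 →ₗ[𝕜] (𝔼 →ₘ[(volume : Measure 𝔼)] 𝕜),
      (∀ f, AEInvariant G (S₁ f)) ∧
      (∀ (f : LpG 𝕜 G 1) (f₂ : LpG 𝕜 G 2),
        f.1 =ᵐ[volume] f₂.1 → S₁ f =ᵐ[volume] (S f₂).1) ∧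
      ∃ A : ℝ, ∀ (f : LpG 𝕜 G 1) (t : ℝ), 0 < t →
        volume {x | t ≤ ‖S₁ f x‖} ≤ ENNReal.ofReal (A * ‖f‖ / t) := by
  obtain ⟨A, hA, hweak⟩ := (hS.hasKernel hK).exists_weak_type hN hK
  let L : lpInterL2 𝕜 G 1 →ₗ[𝕜] (𝔼 →ₘ[(volume : Measure 𝔼)] 𝕜) :=
    { toFun := fun u => (S u.1).1.1
      map_add' := fun u v => by
        rw [Submodule.coe_add, map_add]
        rfl
      map_smul' := fun c u => by
        rw [Submodule.coe_smul, map_smul]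
        rfl }
  have hL : ∀ (u : lpInterL2 𝕜 G 1) (t : ℝ), 0 < t →
      volume {x | t ≤ ‖L u x‖} ≤ ENNReal.ofReal (A.toReal * ‖lpInterL2Inclusion 𝕜 G 1 u‖ / t) := by
    intro u t ht
    have h1 := hweak u.1.1 (memLp_one_iff_integrable.1 u.2) (ENNReal.ofReal t)
      (ENNReal.ofReal_pos.2 ht).ne' ENNReal.ofReal_ne_top
    rw [extendByProjection_coe] at h1
    have h2 : ∫⁻ x, ‖u.1.1 x‖ₑ = ENNReal.ofReal ‖lpInterL2Inclusion 𝕜 G 1 u‖ := by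
      rw [norm_lpInterL2Inclusion, ENNReal.ofReal_toReal (MemLp.eLpNorm_ne_top u.2),
        eLpNorm_one_eq_lintegral_enorm]
    have h3 : {x | ENNReal.ofReal t ≤ ‖(S u.1).1 x‖ₑ} = {x | t ≤ ‖L u x‖} := by
      ext x
      simp only [Set.mem_ofPred_eq, ← ofReal_norm]
      exact ENNReal.ofReal_le_ofReal_iff (norm_nonneg _)
    have h4 : ∀ s : ℝ, A * (ENNReal.ofReal s / ENNReal.ofReal t) =
        ENNReal.ofReal (A.toReal * s / t) := fun s => by
      rw [mul_div_assoc, ENNReal.ofReal_mul ENNReal.toReal_nonneg, ENNReal.ofReal_toReal hA,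
        ENNReal.ofReal_div_of_pos ht]
    rw [h2, h3, h4] at h1
    exact h1
  have hdense := denseRange_lpInterL2Inclusion (𝕜 := 𝕜) (G := G) ENNReal.one_ne_top
  obtain ⟨S₁, hext, hbound, hlim⟩ := exists_linear_extension_of_weak_type hdense
    ENNReal.toReal_nonneg hL
  refine ⟨S₁, fun f σ hσ => ?_, fun f f₂ hf => ?_, A.toReal, hbound⟩
  -- Invariance passes to an almost everywhere limit of invariant functions S(u n).
  · obtain ⟨u, hu⟩ := hlim f
    filter_upwards [hu, σ.measurePreserving.quasiMeasurePreserving.ae hu,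
      ae_all_iff.2 fun n => (S (u n).1).2 σ hσ] with x h1 h2 h3
    refine tendsto_nhds_unique h2 (h1.congr fun n => ?_)
    exact (h3 n).symm
  · obtain ⟨u, rfl, rfl⟩ := exists_lpInterL2Inclusion_eq hf
    rw [hext]
    rfl

theorem exists_truncation (f : LpG 𝕜 G ∞) (r : ℝ) :
    ∃ F : LpG 𝕜 G 2, F.1 =ᵐ[volume] (Metric.closedBall 0 r).indicator f.1 := by
  have hfin : IsFiniteMeasure (volume.restrict (Metric.closedBall (0 : 𝔼) r)) :=
    isFiniteMeasure_restrict.2 measure_closedBall_lt_top.ne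
  have hm : MemLp ((Metric.closedBall 0 r).indicator f.1) 2 volume :=
    (memLp_indicator_iff_restrict measurableSet_closedBall).2
      (((Lp.memLp f.1).restrict _).mono_exponent le_top)
  refine ⟨⟨hm.toLp _, aeInvariant_congr hm.coeFn_toLp fun σ hσ => ?_⟩, hm.coeFn_toLp⟩
  filter_upwards [f.2 σ hσ] with x hx
  have h : σ x ∈ Metric.closedBall (0 : 𝔼) r ↔ x ∈ Metric.closedBall (0 : 𝔼) r := by simp
  by_cases hxr : x ∈ Metric.closedBall (0 : 𝔼) r
  · rw [Set.indicator_of_mem hxr, Set.indicator_of_mem (h.2 hxr), hx]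
  · rw [Set.indicator_of_notMem hxr, Set.indicator_of_notMem (mt h.1 hxr)]

/-- The limit b comes from the locally uniform Cauchy estimate; its invariance is inherited from the
S(f_j), the subtracted terms being constants. -/
theorem exists_linftyValue [Finite G] {K : 𝔼 → 𝔼 → 𝕜} {C ε : ℝ}
    (hK : KernelBounds G K C ε) {S : LpG 𝕜 G 2 →L[𝕜] LpG 𝕜 G 2}
    (hS : HasSmoothKernel G (extendByProjection S) K) :
    ∃ A : ℝ, ∀ f : LpG 𝕜 G ∞, ∃ b : 𝔼 → 𝕜, IsLinftyValue K S f b ∧ MemBMOG G b ∧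
      bmoNorm b ≤ ENNReal.ofReal (A * ‖f‖) := by
  have hT := hS.hasKernel hK
  obtain ⟨D, hD, hcauchy⟩ := hT.exists_norm_sub_le hK
  obtain ⟨Q, hQ, hbmo⟩ := hT.exists_bmoNorm_le hK
  refine ⟨Q, fun f => ?_⟩
  choose F hF using fun j : ℕ => exists_truncation f (j : ℝ)
  have hfm : AEStronglyMeasurable f.1 volume := Lp.aestronglyMeasurable f.1
  have hf0 : 0 ≤ ‖f‖ := norm_nonneg f
  have hfle : ∀ᵐ y, ‖f.1 y‖ ≤ ‖f‖ := by
    have h1 := ae_le_eLpNormEssSup (f := (f.1 : 𝔼 → 𝕜)) (μ := volume)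
    have e : ‖f‖ = (eLpNorm f.1 ∞ volume).toReal := Lp.norm_def f.1
    filter_upwards [h1] with y hy
    rw [e, ← toReal_enorm]
    exact ENNReal.toReal_mono (Lp.eLpNorm_ne_top _) (by rwa [eLpNorm_exponent_top])
  set β : ℕ → 𝔼 → 𝕜 := fun j x => (S (F j)).1 x - originPotential G K f.1 j with hβ
  have hβT : ∀ j, β j = fun x => extendByProjection S (F j).1 x - originPotential G K f.1 j :=
    fun j => by rw [extendByProjection_coe]
  have hC : LocallyUniformlyCauchyAE β (D * (‖f‖ + 1)) ε := by
    intro j k r hr hrj hj hjk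
    rw [hβT, hβT]
    exact hcauchy f.1 (‖f‖ + 1) hfm (hfle.mono fun y hy => hy.trans (by linarith)) (by positivity)
      (fun j => (F j).1) hF j k r hr hrj hj hjk
  have hloc : ∀ j, LocallyIntegrable (β j) := fun j =>
    (locallyIntegrable_L2 (S (F j)).1).sub (locallyIntegrable_const _)
  obtain ⟨b, hbm, hb⟩ := hC.exists_limit hK.pos fun j => (hloc j).aestronglyMeasurable
  have hbloc := hC.locallyIntegrable_limit hloc hbm hb
  -- The oscillation estimate divides by M and so needs M > 0, which excludes M = ‖f‖ when f = 0;
  -- the bound is obtained for M > ‖f‖ and M is let decrease to ‖f‖.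
  have hle : ∀ M, ‖f‖ < M → bmoNorm b ≤ ENNReal.ofReal (Q * M) := fun M hM =>
    hbmo f.1 M hfm (hfle.mono fun y hy => hy.trans hM.le) (hf0.trans_lt hM)
      (fun j => (F j).1) hF b hbloc (by
        filter_upwards [hb] with x hx
        exact hx.congr fun j => congrFun (hβT j) x)
  have hnorm : bmoNorm b ≤ ENNReal.ofReal (Q * ‖f‖) := by
    have hlim : Tendsto (fun M => ENNReal.ofReal (Q * M)) (𝓝[>] ‖f‖)
        (𝓝 (ENNReal.ofReal (Q * ‖f‖))) :=
      ((ENNReal.continuous_ofReal.comp (continuous_const.mul continuous_id)).tendsto _).mono_left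
        nhdsWithin_le_nhds
    exact ge_of_tendsto hlim (eventually_nhdsWithin_of_forall hle)
  refine ⟨b, ⟨F, hF, hC.tendsto_eLpNorm_sub hK.pos hb⟩, ⟨hbloc, fun σ hσ => ?_, ?_⟩, hnorm⟩
  · filter_upwards [hb, σ.measurePreserving.quasiMeasurePreserving.ae hb,
      ae_all_iff.2 fun n => (S (F n)).2 σ hσ] with x h1 h2 h3
    refine tendsto_nhds_unique h2 (h1.congr fun n => ?_)
    simp only [hβ]
    rw [h3 n]
  · exact hnorm.trans_lt ENNReal.ofReal_lt_top

end ReflectionSIO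

end

/-! ### Assembly of the theorem -/

open ReflectionSIO

theorem theorem1p3 {𝕜 : Type*} [RCLike 𝕜] {N : ℕ} (hN : 1 ≤ N)
    (R : Set (EuclideanSpace ℝ (Fin N))) (hR : IsNormalizedRootSystem R)
    (η : ℝ) (hη : 0 < η) (hη1 : η ≤ 1)
    (T : HolderC 𝕜 (reflectionGroup R) η →ₗ[𝕜] HolderDual 𝕜 (reflectionGroup R) η)
    (K : EuclideanSpace ℝ (Fin N) → EuclideanSpace ℝ (Fin N) → 𝕜)
    (hT : IsSingularIntegral T K)
    -- `T` is bounded on `L²_G`: it extends to a bounded operator `S` of `L²_G`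
    (S : LpG 𝕜 (reflectionGroup R) 2 →L[𝕜] LpG 𝕜 (reflectionGroup R) 2)
    (hS : IsLpExtension hη T 2 S) :
    -- boundedness on `L^p_G` for `1 < p < ∞`
    (∀ (p : ℝ≥0∞) [Fact (1 ≤ p)], 1 < p → p < ∞ →
      ∃ Sp : LpG 𝕜 (reflectionGroup R) p →L[𝕜] LpG 𝕜 (reflectionGroup R) p,
        IsLpExtension hη T p Sp ∧
        ∀ (f : LpG 𝕜 (reflectionGroup R) p) (f₂ : LpG 𝕜 (reflectionGroup R) 2),
          f.1 =ᵐ[volume] f₂.1 → (Sp f).1 =ᵐ[volume] (S f₂).1) ∧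
    -- weak type (1,1) on `L¹_G`
    (∃ S₁ : LpG 𝕜 (reflectionGroup R) 1 →ₗ[𝕜]
          (EuclideanSpace ℝ (Fin N) →ₘ[(volume : Measure (EuclideanSpace ℝ (Fin N)))] 𝕜),
        (∀ f, AEInvariant (reflectionGroup R) (S₁ f)) ∧
        (∀ (f : LpG 𝕜 (reflectionGroup R) 1) (f₂ : LpG 𝕜 (reflectionGroup R) 2),
          f.1 =ᵐ[volume] f₂.1 → S₁ f =ᵐ[volume] (S f₂).1) ∧
        ∃ A : ℝ, ∀ (f : LpG 𝕜 (reflectionGroup R) 1) (t : ℝ), 0 < t →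
          volume {x | t ≤ ‖S₁ f x‖} ≤ ENNReal.ofReal (A * ‖f‖ / t)) ∧
    -- boundedness from `L^∞_G` to `BMO_G`
    (∃ A : ℝ, ∀ f : LpG 𝕜 (reflectionGroup R) ∞,
        ∃ b : EuclideanSpace ℝ (Fin N) → 𝕜, IsLinftyValue K S f b ∧
          MemBMOG (reflectionGroup R) b ∧ bmoNorm b ≤ ENNReal.ofReal (A * ‖f‖)) := by
  have hfin := hR.finite_reflectionGroup
  obtain ⟨C, ε, hK⟩ := hT.kernel.exists_kernelBounds
  have hker := hT.hasSmoothKernel hη hη1 hS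
  refine ⟨fun p _ hp hp' => ?_, exists_weak_extension hN hK hker, exists_linftyValue hK hker⟩
  obtain ⟨Sp, hSp⟩ := exists_strong_extension hN hK hker hp hp'
  refine ⟨Sp, fun f g => ?_, hSp⟩
  -- A test function lies in both `L^p_G` and `L²_G`, where the two operators agree, so the pairing
  -- formula for p is the one assumed for `S`.
  rw [hS f g]
  refine integral_congr_ae ?_
  filter_upwards [hSp (HolderC.toLpG hη p f) (HolderC.toLpG hη 2 f)
    ((coeFn_toLpG hη p f).trans (coeFn_toLpG hη 2 f).symm)] with x hx
  rw [hx]
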